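/- Fix $\varepsilon>0$. Let $u=u(x,t)$, $x\in\mathbb R$, $t\ge 0$, be a solution (in the sense of distributions) of $\varepsilon^2u_{tt}-\varepsilon^2u_{xx}+\sin u=0$ with $L^1$-Sobolev regularity: for every $t\ge 0$ the functions $1-\cos u,\ \sin u,\ u_x,\ u_{xx},\ u_t,\ u_{tx}$ (derivatives in the sense of distributions) lie in $L^1(\mathbb R)$ as functions of $x$. **Jost solutions.** Put $D(z)=\frac14(z+z^{-1})$, $E(z)=\frac14(z-z^{-1})$, $\sigma_3=\mathrm{diag}(1,-1)$ and $$Q=\begin{bmatrix} z^{-1}(1-\cos u) & -z^{-1}\sin u-i\varepsilon(u_x+u_t)\\ -z^{-1}\sin u+i\varepsilon(u_x+u_t) & -z^{-1}(1-\cos u)\end{bmatrix}.$$ For fixed $t$ let $m_1^\pm,m_2^\pm$ be the columns of the matrices $M^\pm(x;z,t)$ given by the bounded continuous solutions of the integral equations (taken column by column) $$M^{+}(x)=\mathbb I-\frac1{4i\varepsilon}\int_x^{\infty}e^{-iE(x-y)\sigma_3/\varepsilon}Q(y)M^+(y)e^{iE(x-y)\sigma_3/\varepsilon}\,dy,\qquad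 M^{-}(x)=\mathbb I+\frac1{4i\varepsilon}\int_{-\infty}^xe^{-iE(x-y)\sigma_3/\varepsilon}Q(y)M^-(y)e^{iE(x-y)\sigma_3/\varepsilon}\,dy;$$ $m_1^+,m_2^-$ are used for $\Im z\le 0$ and $m_1^-,m_2^+$ for $\Im z\ge 0$, $z\neq 0$. Let $J^\pm=M^\pm e^{-iEx\sigma_3/\varepsilon}$, with columns $j_1^\pm,j_2^\pm$. **Scattering data.** For real $z\ne0$ define $S(z;t)$ by $J^+=J^-S$. The entries $S_{11}=\det[j_1^+,j_2^-]$ and $S_{22}=\det[j_1^-,j_2^+]$ extend by these formulas to $\Im z<0$ and $\Im z>0$ respectively. The eigenvalues are the zeros of $S_{22}$ in $\Im z>0$ and of $S_{11}$ in $\Im z<0$; they are symmetric under $z\mapsto -z$ and $z\mapsto z^*$. Let $\rho=S_{21}/S_{22}$ on $\mathbb R\setminus\{0\}$ at time $t=0$. For an eigenvalue $z_n$ with $\Im z_n>0$ let $\eta_n$ be the constant with $j_1^-(x;z_n)=\eta_n\,j_2^+(x;z_n)$ for all $x$ at $t=0$, and let $$c_n=\frac{\eta_n}{S_{22}'(z_n)}\,e^{2i(E(z_n)x+D(z_n)t)/\varepsilon}.$$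 **Assumptions.** All eigenvalues are simple (that is, the zeros of $S_{22}$ in $\Im z>0$ at $t=0$ are simple), and $S_{11}$ and $S_{22}$ have no real zeros. **Riemann–Hilbert problem.** Given $x\in\mathbb R$ and $t\ge0$, find a $2\times2$ matrix function $H(z)$, $z\in\mathbb C\setminus\mathbb R$, such that: (I) $H(z)\to\mathbb I$ as $z\to\infty$, uniformly in all directions. (II) $H$ is meromorphic in the open upper and lower half-planes, analytic off the eigenvalues, with at most simple poles, and for every eigenvalue $z_n$ with $\Im z_n>0$, $\Re z_n\ge0$, $$\operatorname*{Res}_{z_n}H=\lim_{z\to z_n}H\begin{bmatrix}0&0\\c_n&0\end{bmatrix},\quad \operatorname*{Res}_{-z_n^*}H=\lim_{z\to-z_n^*}H\begin{bmatrix}0&0\\-c_n^*&0\end{bmatrix},\quad \operatorname*{Res}_{-z_n}H=\lim_{z\to-z_n}H\begin{bmatrix}0&c_n\\0&0\end{bmatrix},\quad \operatorname*{Res}_{z_n^*}H=\lim_{z\to z_n^*}H\begin{bmatrix}0&-c_n^*\\0&0\end{bmatrix}.$$ (III) $H$ has continuous boundary values $H_\pm$ on $\mathbb R$ from the upper and lower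 half-planes, and $H_+(z)=H_-(z)V(z)$ for all $z\in\mathbb R$, where $$V(z)=\begin{bmatrix}1+|\rho(z)|^2&-\rho(z)^*e^{-2i(Ex+Dt)/\varepsilon}\\-\rho(z)e^{2i(Ex+Dt)/\varepsilon}&1\end{bmatrix}\ (z\ne0),\qquad V(0)=\mathbb I .$$ **Theorem.** For all $x\in\mathbb R$ and $t\ge0$ this Riemann–Hilbert problem has a unique solution (as a function on $\mathbb C\setminus\mathbb R$ away from the eigenvalues), namely $$G(z)=\begin{cases}\big[\,S_{22}(z)^{-1}m_1^-(x;z,t),\ m_2^+(x;z,t)\,\big],&\Im z>0,\\[2pt]\big[\,m_1^+(x;z,t),\ S_{11}(z)^{-1}m_2^-(x;z,t)\,\big],&\Im z<0.\end{cases}$$ -/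

import Mathlib

open scoped ContDiff ComplexConjugate

noncomputable section

namespace SineGordon

open MeasureTheory Set Filter Topology

/-! ### Solutions with `L¹`-Sobolev regularity -/

/-- `g` is the derivative of `f` on the real line in the sense of distributions. -/
def HasWeakDeriv (f g : ℝ → ℝ) : Prop :=
  LocallyIntegrable f volume ∧ LocallyIntegrable g volume ∧
    ∀ φ : ℝ → ℝ, ContDiff ℝ ∞ φ → HasCompactSupport φ →
      ∫ x, f x * deriv φ x = -∫ x, g x * φ x

/-- `v` is the `t`-derivative of `u` on `t ≥ 0` in the sense of distributions in `x`
(one-sided at `t = 0`). -/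
def HasWeakTimeDeriv (u v : ℝ → ℝ → ℝ) : Prop :=
  ∀ φ : ℝ → ℝ, ContDiff ℝ ∞ φ → HasCompactSupport φ → ∀ t : ℝ, 0 ≤ t →
    HasDerivWithinAt (fun s => ∫ x, u x s * φ x) (∫ x, v x t * φ x) (Ici 0) t

/-- `u = u x t` (for `t ≥ 0`) is a solution of `ε² u_tt - ε² u_xx + sin u = 0` with `L¹`-Sobolev
regularity, and `ux`, `uxx`, `ut`, `utx` are its distributional derivatives
`u_x`, `u_xx`, `u_t`, `u_tx`. -/
structure IsL1SobolevSolution (ε : ℝ) (u ux uxx ut utx : ℝ → ℝ → ℝ) : Prop where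
  locallyIntegrable : LocallyIntegrableOn (fun p : ℝ × ℝ => u p.1 p.2) (univ ×ˢ Ici 0) volume
  weakDeriv_x : ∀ t, 0 ≤ t → HasWeakDeriv (fun x => u x t) (fun x => ux x t)
  weakDeriv_xx : ∀ t, 0 ≤ t → HasWeakDeriv (fun x => ux x t) (fun x => uxx x t)
  weakDeriv_tx : ∀ t, 0 ≤ t → HasWeakDeriv (fun x => ut x t) (fun x => utx x t)
  weakDeriv_t : HasWeakTimeDeriv u ut
  /-- the sine-Gordon equation `u_tt = u_xx - sin u / ε²` -/
  equation : HasWeakTimeDeriv ut (fun x t => uxx x t - Real.sin (u x t) / ε ^ 2)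
  integrable_one_sub_cos : ∀ t, 0 ≤ t → Integrable (fun x => 1 - Real.cos (u x t))
  integrable_sin : ∀ t, 0 ≤ t → Integrable (fun x => Real.sin (u x t))
  integrable_ux : ∀ t, 0 ≤ t → Integrable (fun x => ux x t)
  integrable_uxx : ∀ t, 0 ≤ t → Integrable (fun x => uxx x t)
  integrable_ut : ∀ t, 0 ≤ t → Integrable (fun x => ut x t)
  integrable_utx : ∀ t, 0 ≤ t → Integrable (fun x => utx x t)

/-! ### Jost solutions at a fixed time

Below `f`, `f'`, `h` are the functions `u(·,t)`, `u_x(·,t)`, `u_t(·,t)` at one fixed time `t`. -/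

/-- `D(z) = (z + 1/z)/4` -/
def D (z : ℂ) : ℂ := (z + z⁻¹) / 4

/-- `E(z) = (z - 1/z)/4` -/
def E (z : ℂ) : ℂ := (z - z⁻¹) / 4

/-- The decaying part of the coefficient matrix: the eigenvalue equation is
`4iε w_x = (4 E(z) σ₃ + Q) w`. -/
def Q (ε : ℝ) (f f' h : ℝ → ℝ) (z : ℂ) (x : ℝ) : Matrix (Fin 2) (Fin 2) ℂ :=
  !![z⁻¹ * (1 - Real.cos (f x)),
      -(z⁻¹ * Real.sin (f x)) - Complex.I * (ε * (f' x + h x));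
    -(z⁻¹ * Real.sin (f x)) + Complex.I * (ε * (f' x + h x)),
      -(z⁻¹ * (1 - Real.cos (f x)))]

/-- The diagonal entries `1, -1` of `σ₃`. -/
def sgn : Fin 2 → ℂ := ![1, -1]

/-- The diagonal matrix `exp(-i E(z) r σ₃ / ε)`. -/
def expSigma (ε : ℝ) (z : ℂ) (r : ℝ) : Matrix (Fin 2) (Fin 2) ℂ :=
  Matrix.diagonal fun i => Complex.exp (-(Complex.I * E z * r * sgn i) / ε)

/-- The `k`-th column of
`exp(-i E (x - y) σ₃/ε) Q(y) M(y) exp(i E (x - y) σ₃/ε)`, where `m` is the `k`-th column of `M`. -/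
def jostIntegrand (ε : ℝ) (f f' h : ℝ → ℝ) (z : ℂ) (k : Fin 2) (m : ℝ → Fin 2 → ℂ) (x y : ℝ) :
    Fin 2 → ℂ :=
  Complex.exp (Complex.I * E z * (x - y) * sgn k / ε) •
    (expSigma ε z (x - y)).mulVec ((Q ε f f' h z y).mulVec (m y))

/-- `m` is the `k`-th column of `M⁺`: a bounded continuous solution of the Volterra equation
normalized at `x = +∞`. -/
def IsJostPlus (ε : ℝ) (f f' h : ℝ → ℝ) (z : ℂ) (k : Fin 2) (m : ℝ → Fin 2 → ℂ) : Prop :=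
  Continuous m ∧ (∃ C : ℝ, ∀ x, ‖m x‖ ≤ C) ∧
    ∀ x, m x = Pi.single k 1 -
      (1 / (4 * Complex.I * ε)) • ∫ y in Ioi x, jostIntegrand ε f f' h z k m x y

/-- `m` is the `k`-th column of `M⁻`: a bounded continuous solution of the Volterra equation
normalized at `x = -∞`. -/
def IsJostMinus (ε : ℝ) (f f' h : ℝ → ℝ) (z : ℂ) (k : Fin 2) (m : ℝ → Fin 2 → ℂ) : Prop :=
  Continuous m ∧ (∃ C : ℝ, ∀ x, ‖m x‖ ≤ C) ∧
    ∀ x, m x = Pi.single k 1 +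
      (1 / (4 * Complex.I * ε)) • ∫ y in Iic x, jostIntegrand ε f f' h z k m x y

/-- The (unique) `k`-th column `m_k⁺(x; z)` of `M⁺`; columns are indexed by `0, 1`.
Used for `z ≠ 0` with `Im z ≤ 0` if `k = 0` and `Im z ≥ 0` if `k = 1`. -/
def mPlus (ε : ℝ) (f f' h : ℝ → ℝ) (k : Fin 2) (z : ℂ) : ℝ → Fin 2 → ℂ :=
  Classical.epsilon (IsJostPlus ε f f' h z k)

/-- The (unique) `k`-th column `m_k⁻(x; z)` of `M⁻`; columns are indexed by `0, 1`.
Used for `z ≠ 0` with `Im z ≥ 0` if `k = 0` and `Im z ≤ 0` if `k = 1`. -/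
def mMinus (ε : ℝ) (f f' h : ℝ → ℝ) (k : Fin 2) (z : ℂ) : ℝ → Fin 2 → ℂ :=
  Classical.epsilon (IsJostMinus ε f f' h z k)

/-- The column `j_k⁺` of the Jost matrix `J⁺ = M⁺ exp(-i E x σ₃/ε)`. -/
def jPlus (ε : ℝ) (f f' h : ℝ → ℝ) (k : Fin 2) (z : ℂ) (x : ℝ) : Fin 2 → ℂ :=
  Complex.exp (-(Complex.I * E z * x * sgn k) / ε) • mPlus ε f f' h k z x

/-- The column `j_k⁻` of the Jost matrix `J⁻ = M⁻ exp(-i E x σ₃/ε)`. -/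
def jMinus (ε : ℝ) (f f' h : ℝ → ℝ) (k : Fin 2) (z : ℂ) (x : ℝ) : Fin 2 → ℂ :=
  Complex.exp (-(Complex.I * E z * x * sgn k) / ε) • mMinus ε f f' h k z x

/-- The matrix with columns `a` and `b`. -/
def ofCols (a b : Fin 2 → ℂ) : Matrix (Fin 2) (Fin 2) ℂ := !![a 0, b 0; a 1, b 1]

/-! ### Scattering data -/

/-- The scattering matrix for real `z ≠ 0`, defined by `J⁺(x; z) = J⁻(x; z) S(z)`; as it does not
depend on `x` it is read off at `x = 0`. -/
def scatteringMatrix (ε : ℝ) (f f' h : ℝ → ℝ) (z : ℝ) : Matrix (Fin 2) (Fin 2) ℂ :=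
  (ofCols (jMinus ε f f' h 0 z 0) (jMinus ε f f' h 1 z 0))⁻¹ *
    ofCols (jPlus ε f f' h 0 z 0) (jPlus ε f f' h 1 z 0)

/-- The analytic extension of `S₁₁` to `Im z < 0`: the Wronskian `det[j₁⁺, j₂⁻]`, which is
independent of `x` and is read off at `x = 0`. -/
def S11 (ε : ℝ) (f f' h : ℝ → ℝ) (z : ℂ) : ℂ :=
  (ofCols (jPlus ε f f' h 0 z 0) (jMinus ε f f' h 1 z 0)).det

/-- The analytic extension of `S₂₂` to `Im z > 0`: the Wronskian `det[j₁⁻, j₂⁺]`, which is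
independent of `x` and is read off at `x = 0`. -/
def S22 (ε : ℝ) (f f' h : ℝ → ℝ) (z : ℂ) : ℂ :=
  (ofCols (jMinus ε f f' h 0 z 0) (jPlus ε f f' h 1 z 0)).det

/-- The reflection coefficient `ρ = S₂₁/S₂₂` on the real axis, for `z ≠ 0`. -/
def reflection (ε : ℝ) (f f' h : ℝ → ℝ) (z : ℝ) : ℂ :=
  scatteringMatrix ε f f' h z 1 0 / scatteringMatrix ε f f' h z 1 1

/-- The eigenvalues in the open first quadrant or on the positive imaginary axis. -/
def eigenvalues (ε : ℝ) (f f' h : ℝ → ℝ) : Set ℂ :=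
  {z | 0 < z.im ∧ 0 ≤ z.re ∧ S22 ε f f' h z = 0}

/-- The proportionality constant `η` of an eigenvalue `z` in the upper half-plane:
`j₁⁻(x; z) = η j₂⁺(x; z)` for all `x`. -/
def proportionality (ε : ℝ) (f f' h : ℝ → ℝ) (z : ℂ) : ℂ :=
  Classical.epsilon fun η : ℂ => ∀ x, jMinus ε f f' h 0 z x = η • jPlus ε f f' h 1 z x

/-- The modified proportionality constant `c⁰ = η / S₂₂'(z)`. -/
def modifiedProportionality (ε : ℝ) (f f' h : ℝ → ℝ) (z : ℂ) : ℂ :=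
  proportionality ε f f' h z / deriv (S22 ε f f' h) z

/-! ### The matrix `G` -/

/-- The matrix `G(z)` built from the Jost solutions, for `Im z ≠ 0` away from the eigenvalues. -/
def G (ε : ℝ) (f f' h : ℝ → ℝ) (x : ℝ) (z : ℂ) : Matrix (Fin 2) (Fin 2) ℂ :=
  if 0 < z.im then
    ofCols ((S22 ε f f' h z)⁻¹ • mMinus ε f f' h 0 z x) (mPlus ε f f' h 1 z x)
  else
    ofCols (mPlus ε f f' h 0 z x) ((S11 ε f f' h z)⁻¹ • mMinus ε f f' h 1 z x)

/-! ### The Riemann-Hilbert problem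

It is posed in terms of a reflection coefficient `ρ`, a set `Z` of eigenvalues in the closed first
quadrant and modified proportionality constants `c₀`. -/

/-- The quartets `{z, -z*, -z, z*}`, `z ∈ Z`. -/
def poles (Z : Set ℂ) : Set ℂ := {z | z ∈ Z ∨ -conj z ∈ Z ∨ -z ∈ Z ∨ conj z ∈ Z}

/-- The complex plane without the real axis and the poles. -/
def domain (Z : Set ℂ) : Set ℂ := {z | z.im ≠ 0 ∧ z ∉ poles Z}

/-- The residue parameter `c = c⁰ exp(2i(E(z)x + D(z)t)/ε)`. -/
def residueConst (ε : ℝ) (c₀ : ℂ → ℂ) (x t : ℝ) (z : ℂ) : ℂ :=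
  c₀ z * Complex.exp (2 * Complex.I * (E z * x + D z * t) / ε)

/-- `Res_{w} H = lim_{z → w} H(z) C`, where `H` has at most a simple pole at `w`. -/
def ResidueCondition (H : ℂ → Matrix (Fin 2) (Fin 2) ℂ) (w : ℂ)
    (C : Matrix (Fin 2) (Fin 2) ℂ) : Prop :=
  ∃ R : Matrix (Fin 2) (Fin 2) ℂ,
    Tendsto (fun z => (z - w) • H z) (𝓝[≠] w) (𝓝 R) ∧
    Tendsto (fun z => H z * C) (𝓝[≠] w) (𝓝 R)

/-- The jump matrix `V(z)` on the real axis. At `z = 0`, where the exponentials are undefined, it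
is given its limiting value, the identity. -/
def jump (ε : ℝ) (ρ : ℝ → ℂ) (x t : ℝ) (z : ℝ) : Matrix (Fin 2) (Fin 2) ℂ :=
  if z = 0 then 1 else
    !![1 + (‖ρ z‖ : ℂ) ^ 2,
        -(conj (ρ z) * Complex.exp (-(2 * Complex.I * (E z * x + D z * t)) / ε));
      -(ρ z * Complex.exp (2 * Complex.I * (E z * x + D z * t) / ε)), 1]

/-- `H` solves the Riemann-Hilbert problem with scattering data `ρ`, `Z`, `c₀` and
parameters `x`, `t`. Only the values of `H` on `domain Z` matter. -/
structure SolvesRHP (ε : ℝ) (ρ : ℝ → ℂ) (Z : Set ℂ) (c₀ : ℂ → ℂ) (x t : ℝ)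
    (H : ℂ → Matrix (Fin 2) (Fin 2) ℂ) : Prop where
  /-- (I) normalization, uniform in all directions -/
  normalization : Tendsto H (cocompact ℂ ⊓ 𝓟 (domain Z)) (𝓝 1)
  /-- (II) analyticity in the half-planes off the eigenvalues -/
  analytic : ∀ z ∈ domain Z, ∀ i j, AnalyticAt ℂ (fun w => H w i j) z
  /-- (II) meromorphy in the half-planes with at most simple poles -/
  meromorphic : ∀ z : ℂ, z.im ≠ 0 → ∀ i j, MeromorphicAt (fun w => H w i j) z ∧
    ((-1 : ℤ) : WithTop ℤ) ≤ meromorphicOrderAt (fun w => H w i j) z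
  /-- (II) the residue conditions -/
  residue : ∀ z ∈ Z,
    ResidueCondition H z !![0, 0; residueConst ε c₀ x t z, 0] ∧
    ResidueCondition H (-conj z) !![0, 0; -conj (residueConst ε c₀ x t z), 0] ∧
    ResidueCondition H (-z) !![0, residueConst ε c₀ x t z; 0, 0] ∧
    ResidueCondition H (conj z) !![0, -conj (residueConst ε c₀ x t z); 0, 0]
  /-- (III) continuous boundary values and the jump relation -/
  boundary : ∃ Hp Hm : ℝ → Matrix (Fin 2) (Fin 2) ℂ, Continuous Hp ∧ Continuous Hm ∧
    (∀ s : ℝ, Tendsto H (𝓝[{z | 0 < z.im} ∩ domain Z] (s : ℂ)) (𝓝 (Hp s))) ∧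
    (∀ s : ℝ, Tendsto H (𝓝[{z | z.im < 0} ∩ domain Z] (s : ℂ)) (𝓝 (Hm s))) ∧
    ∀ s : ℝ, Hp s = Hm s * jump ε ρ x t s

/-- The Riemann-Hilbert problem whose scattering data are computed from the potentials
`f = u(·,0)`, `f' = u_x(·,0)`, `h = u_t(·,0)` at time `0`. -/
def SolvesRHPOf (ε : ℝ) (f f' h : ℝ → ℝ) (x t : ℝ) (H : ℂ → Matrix (Fin 2) (Fin 2) ℂ) : Prop :=
  SolvesRHP ε (reflection ε f f' h) (eigenvalues ε f f' h) (modifiedProportionality ε f f' h) x t H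

end SineGordon

end

noncomputable section

namespace SineGordon

open MeasureTheory Set Filter Topology

/-! ### Volterra equations on the line -/

/-! At a fixed time everything is built from the single column m₁⁻. For Im z ≥ 0 its Volterra kernel
is dominated by an integrable weight, so the Neumann series converges uniformly on |z| ≥ δ. The sum
is continuous up to the real axis, holomorphic inside, and tends to e₁ as z → ∞ by a
Riemann–Lebesgue argument (`NicePotential.tendsto_mMinus_zero_cobounded`). The other three columns
are images of it: z ↦ -z acts through a rotation by a right angle, x ↦ -x through the exchange of
components, and -z̄ through conjugation. Rotating by the angle u/2 exchanges z and -1/z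
(`SolvesLax.gauge`), so the limit z → 0 is the limit z → ∞ of another potential. There G tends from
both half-planes to the same matrix, a rotation up to sign, in accordance with V(0) = 1. Such
symmetries can be read off because each Jost solution is characterized by the linear equation
together with its asymptotics (`NicePotential.eq_jMinus_zero`).

With `flip` the transposed adjugate, G(-z) = flip G(z) and det G = 1. On the real axis the jump
matrix is the product of the conjugate transpose of G₊ with G₊, and flip(A) Aᵀ = det A turns this
into the jump relation (`NicePotential.jump_relation`). The residue condition at a zero of S₂₂
expresses j₁⁻ = η j₂⁺, and the other three points of the quartet follow by symmetry. Thus G at time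
t solves a Riemann–Hilbert problem with the data of time t (`NicePotential.solvesRHP`).

It remains to see that the data evolve by the factor exp(2iDt/ε). The given regularity is
distributional in t, so a classical meaning has to be found first. The wave operator factors: P =
u_x + u_t satisfies P_t - P_x = -sin u/ε² and u satisfies u_t + u_x = P. Mollification, with joint
bounds supplied by the Banach–Steinhaus theorem, shows that u and P are jointly continuous and
differentiable along the respective characteristics
(`IsL1SobolevSolution.exists_isRegularSolution`). These are exactly the derivatives in the zero
curvature equation of the Lax pair in characteristic directions. A Grönwall estimate for difference
quotients then carries solutions of the linear problem at time 0 to solutions at time t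
(`hasDerivWithinAt_of_zero_curvature`). The propagator becomes diagonal as x → ±∞, so the Jost
normalization survives up to an explicit phase (`IsRegularSolution.isJost`); its determinant is 1,
so the Wronskians change only by these phases.

For uniqueness, compare a solution H with G through H·adj(G). The jump cancels because det V = 1,
and the poles cancel because both matrices satisfy the same residue conditions with nilpotent
matrices. The product therefore extends to an entire function tending to the identity at infinity,
by Morera's theorem across the axis and Liouville's theorem (`SolvesRHP.eqOn`,
`eq_const_of_tendsto`). -/

/-- A continuous, nonnegative, integrable weight. -/
structure IsWeight (ν : ℝ → ℝ) : Prop where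
  continuous : Continuous ν
  nonneg : ∀ x, 0 ≤ ν x
  integrable : Integrable ν

/-- The primitive of `ν` vanishing at `-∞`. -/
def cumulative (ν : ℝ → ℝ) (x : ℝ) : ℝ := ∫ y in Iic x, ν y

theorem IsWeight.hasDerivAt_cumulative {ν : ℝ → ℝ} (hν : IsWeight ν) (x : ℝ) :
    HasDerivAt (cumulative ν) (ν x) x := by
  have h1 : cumulative ν = fun x => (∫ y in Iic (0 : ℝ), ν y) + ∫ y in (0 : ℝ)..x, ν y := by
    funext x
    rw [← intervalIntegral.integral_Iic_sub_Iic hν.integrable.integrableOn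
      hν.integrable.integrableOn, add_sub_cancel]
    rfl
  rw [h1]
  exact (intervalIntegral.integral_hasDerivAt_right hν.integrable.intervalIntegrable
    hν.continuous.stronglyMeasurable.stronglyMeasurableAtFilter
    hν.continuous.continuousAt).const_add _

theorem IsWeight.cumulative_nonneg {ν : ℝ → ℝ} (hν : IsWeight ν) (x : ℝ) :
    0 ≤ cumulative ν x := integral_nonneg hν.nonneg

theorem IsWeight.cumulative_le {ν : ℝ → ℝ} (hν : IsWeight ν) (x : ℝ) :
    cumulative ν x ≤ ∫ y, ν y :=
  setIntegral_le_integral hν.integrable (Eventually.of_forall hν.nonneg)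

theorem IsWeight.continuous_cumulative {ν : ℝ → ℝ} (hν : IsWeight ν) :
    Continuous (cumulative ν) :=
  continuous_iff_continuousAt.2 fun x => (hν.hasDerivAt_cumulative x).continuousAt

theorem IsWeight.tendsto_cumulative {ν : ℝ → ℝ} (hν : IsWeight ν) :
    Tendsto (cumulative ν) atBot (𝓝 0) := by
  have h : Tendsto (fun x => (∫ y in Iic (0 : ℝ), ν y) - ∫ y in x..0, ν y) atBot
      (𝓝 ((∫ y in Iic (0 : ℝ), ν y) - ∫ y in Iic (0 : ℝ), ν y)) :=
    tendsto_const_nhds.sub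
      (intervalIntegral_tendsto_integral_Iic 0 hν.integrable.integrableOn tendsto_id)
  rw [sub_self] at h
  refine h.congr fun x => ?_
  rw [← intervalIntegral.integral_Iic_sub_Iic hν.integrable.integrableOn
    hν.integrable.integrableOn, sub_sub_cancel]
  rfl

theorem IsWeight.integrable_mul_exp {ν : ℝ → ℝ} (hν : IsWeight ν) :
    Integrable fun y => ν y * Real.exp (4 * cumulative ν y) := by
  refine hν.integrable.mul_bdd (c := Real.exp (4 * ∫ y, ν y))
    (Real.continuous_exp.comp
      (continuous_const.mul hν.continuous_cumulative)).aestronglyMeasurable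
    (Eventually.of_forall fun y => ?_)
  rw [Real.norm_eq_abs, Real.abs_exp]
  exact Real.exp_le_exp.2 (by linarith [hν.cumulative_le y])

/-- The integrand is the derivative of exp(4 · cumulative)/4. The constant 4 is chosen against the
factor 2 lost in `norm_mulVec_le`: in the sup norm weighted by exp(-4 · cumulative), a Volterra
operator then contracts by 2/4 = 1/2. -/
theorem IsWeight.integral_mul_exp_le {ν : ℝ → ℝ} (hν : IsWeight ν) (x : ℝ) :
    ∫ y in Iic x, ν y * Real.exp (4 * cumulative ν y) ≤ Real.exp (4 * cumulative ν x) / 4 := by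
  have h := integral_Iic_of_hasDerivAt_of_tendsto'
    (f := fun y => Real.exp (4 * cumulative ν y) / 4)
    (f' := fun y => ν y * Real.exp (4 * cumulative ν y)) (a := x) (m := Real.exp (4 * 0) / 4)
    (fun y _ => by
      have := (((hν.hasDerivAt_cumulative y).const_mul 4).exp).div_const 4
      exact this.congr_deriv (by ring)) hν.integrable_mul_exp.integrableOn
    (((Real.continuous_exp.tendsto _).comp (hν.tendsto_cumulative.const_mul 4)).div_const 4)
  rw [h]
  exact sub_le_self _ (by positivity)

theorem norm_mulVec_le {M : Matrix (Fin 2) (Fin 2) ℂ} {c : ℝ} (hM : ∀ i j, ‖M i j‖ ≤ c)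
    (v : Fin 2 → ℂ) : ‖M.mulVec v‖ ≤ 2 * c * ‖v‖ := by
  have hc : 0 ≤ c := (norm_nonneg _).trans (hM 0 0)
  refine (pi_norm_le_iff_of_nonneg (by positivity)).2 fun i => ?_
  rw [Matrix.mulVec, dotProduct, Fin.sum_univ_two]
  have h0 := mul_le_mul (hM i 0) (norm_le_pi_norm v 0) (norm_nonneg _) hc
  have h1 := mul_le_mul (hM i 1) (norm_le_pi_norm v 1) (norm_nonneg _) hc
  calc _ ≤ ‖M i 0 * v 0‖ + ‖M i 1 * v 1‖ := norm_add_le _ _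
    _ ≤ c * ‖v‖ + c * ‖v‖ := by rw [norm_mul, norm_mul]; exact add_le_add h0 h1
    _ = _ := by ring

/-- A family of matrix-valued Volterra kernels dominated by the weight `ν`. -/
structure IsVolterraFamily {P : Type*} [TopologicalSpace P] (ν : ℝ → ℝ)
    (L : P → ℝ → ℝ → Matrix (Fin 2) (Fin 2) ℂ) : Prop where
  meas : ∀ p x, AEStronglyMeasurable (L p x) volume
  bound : ∀ p x y, y ≤ x → ∀ i j, ‖L p x y i j‖ ≤ ν y
  cont : ∀ p₀ x₀, ∀ᵐ y, ContinuousAt (fun q : P × ℝ => L q.1 q.2 y) (p₀, x₀)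

/-- The Neumann iterates of a Volterra kernel. -/
def volterraIter (L : ℝ → ℝ → Matrix (Fin 2) (Fin 2) ℂ) (e : Fin 2 → ℂ) : ℕ → ℝ → Fin 2 → ℂ
  | 0, _ => e
  | n + 1, x => ∫ y in Iic x, (L x y).mulVec (volterraIter L e n y)

/-- The Neumann series of a Volterra kernel. -/
def volterraSol (L : ℝ → ℝ → Matrix (Fin 2) (Fin 2) ℂ) (e : Fin 2 → ℂ) (x : ℝ) : Fin 2 → ℂ :=
  ∑' n, volterraIter L e n x

section Volterra

variable {P : Type*} [TopologicalSpace P] {ν : ℝ → ℝ}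
  {L : P → ℝ → ℝ → Matrix (Fin 2) (Fin 2) ℂ}

theorem IsVolterraFamily.norm_integrand_le (hL : IsVolterraFamily ν L) (p : P) {x y : ℝ}
    (hxy : y ≤ x) {v : Fin 2 → ℂ} {c : ℝ} (hv : ‖v‖ ≤ c) (hν : 0 ≤ ν y) :
    ‖(L p x y).mulVec v‖ ≤ 2 * c * ν y := by
  refine (norm_mulVec_le (hL.bound p x y hxy) v).trans ?_
  nlinarith

theorem aestronglyMeasurable_mulVec {α : Type*} [MeasurableSpace α] {μ : Measure α}
    {M : α → Matrix (Fin 2) (Fin 2) ℂ}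
    {v : α → Fin 2 → ℂ} (hM : AEStronglyMeasurable M μ) (hv : AEStronglyMeasurable v μ) :
    AEStronglyMeasurable (fun y => (M y).mulVec (v y)) μ := by
  have h : Continuous fun q : Matrix (Fin 2) (Fin 2) ℂ × (Fin 2 → ℂ) => q.1.mulVec q.2 :=
    continuous_fst.matrix_mulVec continuous_snd
  exact h.comp_aestronglyMeasurable (hM.prodMk hv)

theorem IsVolterraFamily.integrableOn (hν : IsWeight ν) (hL : IsVolterraFamily ν L) (p : P)
    (x : ℝ) {m : ℝ → Fin 2 → ℂ} {c : ℝ} (hm : AEStronglyMeasurable m volume)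
    (hc : ∀ y, y ≤ x → ‖m y‖ ≤ c) :
    IntegrableOn (fun y => (L p x y).mulVec (m y)) (Iic x) := by
  refine Integrable.mono' (g := fun y => 2 * c * ν y) (hν.integrable.integrableOn.const_mul _)
    (aestronglyMeasurable_mulVec (hL.meas p x).restrict hm.restrict) ?_
  filter_upwards [ae_restrict_mem measurableSet_Iic] with y hy
  exact hL.norm_integrand_le p hy (hc y hy) (hν.nonneg y)

theorem IsVolterraFamily.continuous_integral [FirstCountableTopology P] (hν : IsWeight ν)
    (hL : IsVolterraFamily ν L) {m : P → ℝ → Fin 2 → ℂ} {c : ℝ}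
    (hm : Continuous fun q : P × ℝ => m q.1 q.2) (hc : ∀ p y, ‖m p y‖ ≤ c) :
    Continuous fun q : P × ℝ => ∫ y in Iic q.2, (L q.1 q.2 y).mulVec (m q.1 y) := by
  have hmp : ∀ p, Continuous (m p) := fun p => hm.comp (Continuous.prodMk_right p)
  refine continuous_iff_continuousAt.2 fun q₀ => ?_
  have h1 : (fun q : P × ℝ => ∫ y in Iic q.2, (L q.1 q.2 y).mulVec (m q.1 y)) =
      fun q : P × ℝ => ∫ y, (Iic q.2).indicator (fun y => (L q.1 q.2 y).mulVec (m q.1 y)) y := by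
    funext q
    rw [integral_indicator measurableSet_Iic]
  rw [h1]
  refine continuousAt_of_dominated (bound := fun y => 2 * c * ν y)
    (Eventually.of_forall fun q => ?_)
    (Eventually.of_forall fun q => Eventually.of_forall fun y => ?_)
    (hν.integrable.const_mul _) ?_
  · exact (aestronglyMeasurable_mulVec (hL.meas _ _)
      (hmp _).aestronglyMeasurable).indicator measurableSet_Iic
  · have hc0 : 0 ≤ c := (norm_nonneg _).trans (hc q.1 y)
    by_cases hy : y ∈ Iic q.2
    · rw [indicator_of_mem hy]
      exact hL.norm_integrand_le q.1 hy (hc q.1 y) (hν.nonneg y)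
    · rw [indicator_of_notMem hy, norm_zero]
      have := hν.nonneg y
      positivity
  -- The indicator of the moving half-line is locally constant in `q` except at the one point y =
  -- `q₀.2`, which is a null set.
  · filter_upwards [hL.cont q₀.1 q₀.2, Measure.ae_ne volume q₀.2] with y hy hne
    rcases lt_or_gt_of_ne hne with h | h
    · have h2 : ∀ᶠ q : P × ℝ in 𝓝 q₀, y ∈ Iic q.2 := by
        filter_upwards [continuous_snd.continuousAt.eventually (lt_mem_nhds h)] with q hq
        exact le_of_lt hq
      refine ContinuousAt.congr (f := fun q : P × ℝ => (L q.1 q.2 y).mulVec (m q.1 y)) ?_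
        (h2.mono fun q hq => by simp only [indicator_of_mem hq])
      have h3 : Continuous fun q : P × ℝ => m q.1 y :=
        hm.comp (continuous_fst.prodMk continuous_const)
      have h4 : Continuous fun q : Matrix (Fin 2) (Fin 2) ℂ × (Fin 2 → ℂ) => q.1.mulVec q.2 :=
        continuous_fst.matrix_mulVec continuous_snd
      exact h4.continuousAt.comp (hy.prodMk h3.continuousAt)
    · have h2 : ∀ᶠ q : P × ℝ in 𝓝 q₀, y ∉ Iic q.2 := by
        filter_upwards [continuous_snd.continuousAt.eventually (gt_mem_nhds h)] with q hq
        exact not_le_of_gt hq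
      exact ContinuousAt.congr (f := fun _ => (0 : Fin 2 → ℂ)) continuousAt_const
        (h2.mono fun q hq => (indicator_of_notMem hq _).symm)

/-- Each iteration halves the norm weighted by exp(-4 · cumulative), by
`IsWeight.integral_mul_exp_le`. Continuity is propagated in the same induction, because the integral
operator needs a measurable, bounded input. -/
theorem IsVolterraFamily.iter_spec [FirstCountableTopology P] (hν : IsWeight ν)
    (hL : IsVolterraFamily ν L) (e : Fin 2 → ℂ) (n : ℕ) :
    (Continuous fun q : P × ℝ => volterraIter (L q.1) e n q.2) ∧
    ∀ p x, ‖volterraIter (L p) e n x‖ ≤ (1 / 2) ^ n * ‖e‖ * Real.exp (4 * cumulative ν x) := by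
  induction n with
  | zero =>
    refine ⟨continuous_const, fun p x => ?_⟩
    have : 1 ≤ Real.exp (4 * cumulative ν x) :=
      Real.one_le_exp (by linarith [hν.cumulative_nonneg x])
    simp only [volterraIter, pow_zero, one_mul]
    nlinarith [norm_nonneg e]
  | succ n ih =>
    obtain ⟨ihc, ihb⟩ := ih
    have hb : ∀ p y, ‖volterraIter (L p) e n y‖ ≤
        (1 / 2) ^ n * ‖e‖ * Real.exp (4 * ∫ y, ν y) := fun p y =>
      (ihb p y).trans (mul_le_mul_of_nonneg_left
        (Real.exp_le_exp.2 (by linarith [hν.cumulative_le y])) (by positivity))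
    refine ⟨hL.continuous_integral hν ihc hb, fun p x => ?_⟩
    have h1 : ‖∫ y in Iic x, (L p x y).mulVec (volterraIter (L p) e n y)‖ ≤
        ∫ y in Iic x, 2 * ((1 / 2) ^ n * ‖e‖) * (ν y * Real.exp (4 * cumulative ν y)) := by
      refine norm_integral_le_of_norm_le (hν.integrable_mul_exp.integrableOn.const_mul _) ?_
      filter_upwards [ae_restrict_mem measurableSet_Iic] with y hy
      refine (hL.norm_integrand_le p hy (ihb p y) (hν.nonneg y)).trans_eq ?_
      ring
    refine h1.trans ?_
    rw [integral_const_mul, pow_succ]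
    have h2 := hν.integral_mul_exp_le x
    have h3 : 0 ≤ (1 / 2 : ℝ) ^ n * ‖e‖ := by positivity
    nlinarith

/-- A bound for the Neumann series which is uniform in all parameters. -/
def volterraBound (ν : ℝ → ℝ) (e : Fin 2 → ℂ) : ℝ := ‖e‖ * Real.exp (4 * ∫ y, ν y)

theorem IsVolterraFamily.norm_iter_le [FirstCountableTopology P] (hν : IsWeight ν)
    (hL : IsVolterraFamily ν L) (e : Fin 2 → ℂ) (n : ℕ) (p : P) (x : ℝ) :
    ‖volterraIter (L p) e n x‖ ≤ (1 / 2) ^ n * volterraBound ν e := by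
  refine ((hL.iter_spec hν e n).2 p x).trans ?_
  rw [volterraBound, mul_assoc]
  have := Real.exp_le_exp.2 (by linarith [hν.cumulative_le x] : 4 * cumulative ν x ≤ 4 * ∫ y, ν y)
  gcongr

theorem summable_volterraBound (ν : ℝ → ℝ) (e : Fin 2 → ℂ) :
    Summable fun n : ℕ => (1 / 2 : ℝ) ^ n * volterraBound ν e :=
  (summable_geometric_of_lt_one (by norm_num) (by norm_num)).mul_right _

theorem IsVolterraFamily.continuous_sol [FirstCountableTopology P] (hν : IsWeight ν)
    (hL : IsVolterraFamily ν L) (e : Fin 2 → ℂ) :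
    Continuous fun q : P × ℝ => volterraSol (L q.1) e q.2 :=
  continuous_tsum (fun n => (hL.iter_spec hν e n).1) (summable_volterraBound ν e)
    fun n q => hL.norm_iter_le hν e n q.1 q.2

theorem IsVolterraFamily.continuous_sol_right [FirstCountableTopology P] (hν : IsWeight ν)
    (hL : IsVolterraFamily ν L) (e : Fin 2 → ℂ) (p : P) : Continuous (volterraSol (L p) e) :=
  (hL.continuous_sol hν e).comp (Continuous.prodMk_right p)

theorem IsVolterraFamily.continuous_sol_left [FirstCountableTopology P] (hν : IsWeight ν)
    (hL : IsVolterraFamily ν L) (e : Fin 2 → ℂ) (x : ℝ) :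
    Continuous fun p => volterraSol (L p) e x :=
  (hL.continuous_sol hν e).comp (Continuous.prodMk_left x)

theorem IsVolterraFamily.norm_sol_le [FirstCountableTopology P] (hν : IsWeight ν)
    (hL : IsVolterraFamily ν L) (e : Fin 2 → ℂ) (p : P) (x : ℝ) :
    ‖volterraSol (L p) e x‖ ≤ 2 * volterraBound ν e := by
  refine tsum_of_norm_bounded ?_ fun n => hL.norm_iter_le hν e n p x
  exact hasSum_geometric_two.mul_right _

theorem IsVolterraFamily.sol_eq [FirstCountableTopology P] (hν : IsWeight ν)
    (hL : IsVolterraFamily ν L) (e : Fin 2 → ℂ) (p : P) (x : ℝ) :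
    volterraSol (L p) e x = e + ∫ y in Iic x, (L p x y).mulVec (volterraSol (L p) e y) := by
  have hs : ∀ y, Summable fun n => volterraIter (L p) e n y := fun y =>
    Summable.of_norm_bounded (summable_volterraBound ν e) fun n => hL.norm_iter_le hν e n p y
  have hc : ∀ n, Continuous (volterraIter (L p) e n) := fun n =>
    (hL.iter_spec hν e n).1.comp (Continuous.prodMk_right p)
  have h1 : HasSum (fun n => ∫ y in Iic x, (L p x y).mulVec (volterraIter (L p) e n y))
      (∫ y in Iic x, (L p x y).mulVec (volterraSol (L p) e y)) := by
    refine hasSum_integral_of_dominated_convergence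
      (fun n y => 2 * ((1 / 2) ^ n * volterraBound ν e) * ν y)
      (fun n => (hL.integrableOn hν p x (hc n).aestronglyMeasurable
        fun y _ => hL.norm_iter_le hν e n p y).aestronglyMeasurable) (fun n => ?_) ?_ ?_ ?_
    · filter_upwards [ae_restrict_mem measurableSet_Iic] with y hy
      exact hL.norm_integrand_le p hy (hL.norm_iter_le hν e n p y) (hν.nonneg y)
    · exact Eventually.of_forall fun y => ((summable_volterraBound ν e).mul_left 2).mul_right _
    · simp_rw [tsum_mul_right]
      exact hν.integrable.integrableOn.const_mul _
    · refine Eventually.of_forall fun y => ?_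
      have h2 : Continuous fun v : Fin 2 → ℂ => (L p x y).mulVec v :=
        continuous_const.matrix_mulVec continuous_id
      exact (hs y).hasSum.map (Matrix.mulVecLin (L p x y)).toAddMonoidHom h2
  rw [volterraSol, (hs x).tsum_eq_zero_add, ← h1.tsum_eq]
  rfl

/-- Two solutions of a Volterra equation that are bounded near `-∞` agree. -/
theorem IsVolterraFamily.eq_of_eq [FirstCountableTopology P] (hν : IsWeight ν)
    (hL : IsVolterraFamily ν L) (e : Fin 2 → ℂ) (p : P) {m m' : ℝ → Fin 2 → ℂ} {X c : ℝ}
    (hm : Continuous m) (hm' : Continuous m') (hc : ∀ x, x ≤ X → ‖m x‖ ≤ c)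
    (hc' : ∀ x, x ≤ X → ‖m' x‖ ≤ c)
    (h : ∀ x, x ≤ X → m x = e + ∫ y in Iic x, (L p x y).mulVec (m y))
    (h' : ∀ x, x ≤ X → m' x = e + ∫ y in Iic x, (L p x y).mulVec (m' y)) :
    ∀ x, x ≤ X → m x = m' x := by
  set d : ℝ → Fin 2 → ℂ := fun x => m x - m' x with hd
  have hdx : ∀ x, x ≤ X → d x = ∫ y in Iic x, (L p x y).mulVec (d y) := fun x hx => by
    have h1 := hL.integrableOn hν p x hm.aestronglyMeasurable fun y hy => hc y (hy.trans hx)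
    have h2 := hL.integrableOn hν p x hm'.aestronglyMeasurable fun y hy => hc' y (hy.trans hx)
    have h3 := integral_sub h1 h2
    simp only [hd, Matrix.mulVec_sub, h3]
    rw [h x hx, h' x hx]
    abel
  -- The difference is a fixed point of the homogeneous operator, which contracts by 1/2 in the
  -- weighted norm; iterating forces it to vanish.
  have key : ∀ n : ℕ, ∀ x, x ≤ X →
      ‖d x‖ ≤ (1 / 2) ^ n * (2 * c) * Real.exp (4 * cumulative ν x) := by
    intro n
    induction n with
    | zero =>
      intro x hx
      have h1 : ‖d x‖ ≤ 2 * c := (norm_sub_le _ _).trans (by linarith [hc x hx, hc' x hx])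
      have h2 : 1 ≤ Real.exp (4 * cumulative ν x) :=
        Real.one_le_exp (by linarith [hν.cumulative_nonneg x])
      nlinarith [norm_nonneg (d x)]
    | succ n ih =>
      intro x hx
      have hc0 : 0 ≤ c := (norm_nonneg _).trans (hc x hx)
      rw [hdx x hx]
      have h1 : ‖∫ y in Iic x, (L p x y).mulVec (d y)‖ ≤
          ∫ y in Iic x, 2 * ((1 / 2) ^ n * (2 * c)) * (ν y * Real.exp (4 * cumulative ν y)) := by
        refine norm_integral_le_of_norm_le (hν.integrable_mul_exp.integrableOn.const_mul _) ?_
        filter_upwards [ae_restrict_mem measurableSet_Iic] with y hy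
        refine (hL.norm_integrand_le p hy (ih y (le_trans hy hx)) (hν.nonneg y)).trans_eq ?_
        ring
      refine h1.trans ?_
      rw [integral_const_mul, pow_succ]
      have h2 := hν.integral_mul_exp_le x
      have h3 : 0 ≤ (1 / 2 : ℝ) ^ n * (2 * c) := by positivity
      nlinarith
  intro x hx
  have h1 : Tendsto (fun n : ℕ => (1 / 2 : ℝ) ^ n * (2 * c) * Real.exp (4 * cumulative ν x)) atTop
      (𝓝 (0 * (2 * c) * Real.exp (4 * cumulative ν x))) :=
    ((tendsto_pow_atTop_nhds_zero_of_lt_one (by norm_num) (by norm_num)).mul_const _).mul_const _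
  have h2 : ‖d x‖ ≤ 0 := by
    refine ge_of_tendsto' (by simpa using h1) fun n => key n x hx
  exact sub_eq_zero.1 (norm_le_zero_iff.1 h2)

/-- Tannery's theorem: the geometric bound is uniform in the parameter, so limits may be taken term
by term and only the zeroth term `e` survives. -/
theorem IsVolterraFamily.tendsto_sol [FirstCountableTopology P] (hν : IsWeight ν)
    (hL : IsVolterraFamily ν L) (e : Fin 2 → ℂ) {l : Filter P} (x : ℝ)
    (h : ∀ n, Tendsto (fun p => volterraIter (L p) e (n + 1) x) l (𝓝 0)) :
    Tendsto (fun p => volterraSol (L p) e x) l (𝓝 e) := by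
  have h1 := tendsto_tsum_of_dominated_convergence (𝓕 := l)
    (f := fun p n => volterraIter (L p) e n x) (g := fun n => if n = 0 then e else 0)
    (summable_volterraBound ν e) (fun n => ?_)
    (Eventually.of_forall fun p n => hL.norm_iter_le hν e n p x)
  · rwa [tsum_ite_eq 0 (fun _ => e)] at h1
  · cases n with
    | zero => simpa [volterraIter] using tendsto_const_nhds
    | succ n => simpa using h n

/-- Smallness of one iterate passes to the next by dominated convergence, so oscillation has to be
exploited only once, in the first iterate. The limit filter must be countably generated for
dominated convergence to apply. -/
theorem IsVolterraFamily.tendsto_iter_succ [FirstCountableTopology P] (hν : IsWeight ν)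
    (hL : IsVolterraFamily ν L) (e : Fin 2 → ℂ) {l : Filter P} [l.IsCountablyGenerated]
    (h : ∀ x, Tendsto (fun p => volterraIter (L p) e 1 x) l (𝓝 0)) (n : ℕ) (x : ℝ) :
    Tendsto (fun p => volterraIter (L p) e (n + 1) x) l (𝓝 0) := by
  induction n generalizing x with
  | zero => exact h x
  | succ n ih =>
    have hc : ∀ p, Continuous (volterraIter (L p) e (n + 1)) := fun p =>
      (hL.iter_spec hν e (n + 1)).1.comp (Continuous.prodMk_right p)
    have h1 := tendsto_integral_filter_of_dominated_convergence (l := l)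
      (μ := volume.restrict (Iic x))
      (F := fun p y => (L p x y).mulVec (volterraIter (L p) e (n + 1) y)) (f := fun _ => 0)
      (fun y => 2 * ((1 / 2) ^ (n + 1) * volterraBound ν e) * ν y)
      (Eventually.of_forall fun p => (hL.integrableOn hν p x (hc p).aestronglyMeasurable
        fun y _ => hL.norm_iter_le hν e _ p y).aestronglyMeasurable)
      (Eventually.of_forall fun p => ?_) (hν.integrable.integrableOn.const_mul _) ?_
    · simpa [volterraIter] using h1
    · filter_upwards [ae_restrict_mem measurableSet_Iic] with y hy
      exact hL.norm_integrand_le p hy (hL.norm_iter_le hν e _ p y) (hν.nonneg y)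
    · filter_upwards [ae_restrict_mem measurableSet_Iic] with y hy
      refine squeeze_zero_norm (a := fun p => 2 * ν y * ‖volterraIter (L p) e (n + 1) y‖)
        (fun p => ?_) ?_
      · exact norm_mulVec_le (hL.bound p x y hy) _
      · simpa using (ih y).norm.const_mul (2 * ν y)

end Volterra

/-- An integral of holomorphic functions with an integrable bound is holomorphic. -/
theorem differentiableOn_integral_of_bound {F : Type*} [NormedAddCommGroup F] [NormedSpace ℂ F]
    [CompleteSpace F] {α : Type*} [MeasurableSpace α] {μ : Measure α} {U : Set ℂ} (hU : IsOpen U)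
    {f : ℂ → α → F} {b : α → ℝ} (hb : Integrable b μ)
    (hm : ∀ z ∈ U, AEStronglyMeasurable (f z) μ) (hf : ∀ᵐ a ∂μ, DifferentiableOn ℂ (f · a) U)
    (hbd : ∀ᵐ a ∂μ, ∀ z ∈ U, ‖f z a‖ ≤ b a) :
    DifferentiableOn ℂ (fun z => ∫ a, f z a ∂μ) U := by
  intro z hz
  obtain ⟨r, hr, hrU⟩ := Metric.isOpen_iff.1 hU z hz
  have hball : ∀ w ∈ Metric.ball z (r / 2), Metric.closedBall w (r / 4) ⊆ U := fun w hw =>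
    fun v hv => hrU (by
      rw [Metric.mem_ball] at hw ⊢
      rw [Metric.mem_closedBall] at hv
      linarith [dist_triangle v w z])
  have hz' : z ∈ Metric.ball z (r / 2) := Metric.mem_ball_self (by positivity)
  have hder : ∀ᵐ a ∂μ, ∀ w ∈ Metric.ball z (r / 2),
      HasDerivAt (f · a) (deriv (f · a) w) w := by
    filter_upwards [hf] with a ha w hw
    exact (ha.differentiableAt (hU.mem_nhds (hball w hw
      (Metric.mem_closedBall_self (by positivity))))).hasDerivAt
  -- Cauchy's estimate on circles of radius r/4 turns the bound on the functions into an integrable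
  -- bound on their derivatives.
  have hbd' : ∀ᵐ a ∂μ, ∀ w ∈ Metric.ball z (r / 2), ‖deriv (f · a) w‖ ≤ b a / (r / 4) := by
    filter_upwards [hf, hbd] with a ha hba w hw
    refine Complex.norm_deriv_le_of_forall_mem_sphere_norm_le (by positivity)
      (ha.mono ?_).diffContOnCl fun v hv => hba v (hball w hw (Metric.sphere_subset_closedBall hv))
    exact Metric.closure_ball_subset_closedBall.trans (hball w hw)
  -- The derivative is an almost everywhere limit of difference quotients along a sequence of
  -- increments tending to 0, each of modulus at most r/2.
  have hmd : AEStronglyMeasurable (fun a => deriv (f · a) z) μ := by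
    have hseq : Tendsto (fun n : ℕ => ((n : ℂ) + 1)⁻¹ * ((r / 2 : ℝ) : ℂ)) atTop (𝓝[≠] 0) := by
      refine tendsto_nhdsWithin_iff.2 ⟨?_, Eventually.of_forall fun n => ?_⟩
      · have := (tendsto_one_div_add_atTop_nhds_zero_nat (𝕜 := ℂ)).mul_const ((r / 2 : ℝ) : ℂ)
        simpa using this
      · have h1 : (n : ℂ) + 1 ≠ 0 := by exact_mod_cast n.succ_ne_zero
        have h2 : ((r / 2 : ℝ) : ℂ) ≠ 0 := by exact_mod_cast (by positivity : (r / 2) ≠ 0)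
        exact mul_ne_zero (inv_ne_zero h1) h2
    refine aestronglyMeasurable_of_tendsto_ae (u := atTop)
      (f := fun n : ℕ => fun a => (((n : ℂ) + 1)⁻¹ * ((r / 2 : ℝ) : ℂ))⁻¹ •
        (f (z + ((n : ℂ) + 1)⁻¹ * ((r / 2 : ℝ) : ℂ)) a - f z a)) (fun n => ?_) ?_
    · refine ((hm _ (hrU ?_)).sub (hm z hz)).const_smul _
      rw [Metric.mem_ball, dist_eq_norm, add_sub_cancel_left, norm_mul, norm_inv,
        Complex.norm_real, Real.norm_eq_abs, abs_of_pos (by positivity)]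
      have h1 : (1 : ℝ) ≤ ‖(n : ℂ) + 1‖ := by
        have : ((n : ℂ) + 1) = ((n + 1 : ℕ) : ℂ) := by push_cast; ring
        rw [this, Complex.norm_natCast]
        exact_mod_cast Nat.le_add_left 1 n
      have h2 : ‖(n : ℂ) + 1‖⁻¹ ≤ 1 := inv_le_one_of_one_le₀ h1
      nlinarith
    · filter_upwards [hder] with a ha
      exact ((ha z hz').tendsto_slope_zero).comp hseq
  exact (hasDerivAt_integral_of_dominated_loc_of_deriv_le
    (Metric.ball_mem_nhds z (by positivity : 0 < r / 2))
    (by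
      filter_upwards [hU.mem_nhds hz] with w hw using hm w hw)
    (Integrable.mono' hb (hm z hz) (hbd.mono fun a ha => ha z hz)) hmd hbd'
    (hb.div_const _) hder).2.differentiableAt.differentiableWithinAt

/-- The iterates are holomorphic by induction and the series converges uniformly. The family lives
on `S`, which in the application contains boundary points, while differentiation takes place on the
open set `U`. -/
theorem IsVolterraFamily.differentiableOn_sol {U S : Set ℂ} (hU : IsOpen U) (hUS : U ⊆ S)
    {ν : ℝ → ℝ} (hν : IsWeight ν) {L : ℂ → ℝ → ℝ → Matrix (Fin 2) (Fin 2) ℂ}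
    (hL : IsVolterraFamily ν (fun p : S => L p)) (e : Fin 2 → ℂ)
    (hd : ∀ x y, y ≤ x → ∀ i j, DifferentiableOn ℂ (fun z => L z x y i j) U) (x : ℝ) :
    DifferentiableOn ℂ (fun z => volterraSol (L z) e x) U := by
  have hit : ∀ n x, DifferentiableOn ℂ (fun z => volterraIter (L z) e n x) U := by
    intro n
    induction n with
    | zero => exact fun x => differentiableOn_const _
    | succ n ih =>
      intro x
      have hc : ∀ p : S, Continuous (volterraIter (L p) e n) := fun p =>
        (hL.iter_spec hν e n).1.comp (Continuous.prodMk_right p)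
      refine differentiableOn_integral_of_bound hU
        (b := fun y => 2 * ((1 / 2) ^ n * volterraBound ν e) * ν y)
        (hν.integrable.integrableOn.const_mul _)
        (fun z hz => (hL.integrableOn hν ⟨z, hUS hz⟩ x (hc ⟨z, hUS hz⟩).aestronglyMeasurable
          fun y _ => hL.norm_iter_le hν e n ⟨z, hUS hz⟩ y).aestronglyMeasurable) ?_ ?_
      · filter_upwards [ae_restrict_mem measurableSet_Iic] with y hy
        refine differentiableOn_pi.2 fun i => ?_
        simp only [Matrix.mulVec, dotProduct, Fin.sum_univ_two]
        have h1 := differentiableOn_pi.1 (ih y)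
        exact ((hd x y hy i 0).mul (h1 0)).add ((hd x y hy i 1).mul (h1 1))
      · filter_upwards [ae_restrict_mem measurableSet_Iic] with y hy z hz
        exact hL.norm_integrand_le ⟨z, hUS hz⟩ hy
          (hL.norm_iter_le hν e n ⟨z, hUS hz⟩ y) (hν.nonneg y)
  exact Complex.differentiableOn_tsum_of_summable_norm (summable_volterraBound ν e)
    (fun n => hit n x) hU fun n z hz => hL.norm_iter_le hν e n ⟨z, hUS hz⟩ x

/-! ### Oscillatory integrals -/

theorem norm_exp_mul_I_le_one {θ : ℂ} (hθ : 0 ≤ θ.im) {r : ℝ} (hr : 0 ≤ r) :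
    ‖Complex.exp (Complex.I * θ * r)‖ ≤ 1 := by
  rw [Complex.norm_exp]
  refine Real.exp_le_one_iff.2 ?_
  simp only [Complex.mul_re, Complex.I_re, Complex.I_im, Complex.ofReal_re, Complex.ofReal_im,
    Complex.mul_im]
  nlinarith

/-- One integration by parts. The exponential is bounded by 1 because y ≤ x and Im θ ≥ 0, and it
equals 1 at the endpoint y = x, which leaves the term ‖g x‖. -/
theorem norm_integral_exp_mul_le_of_contDiff {g : ℝ → ℂ} (hg : ContDiff ℝ ∞ g)
    (hgs : HasCompactSupport g) (x : ℝ) {θ : ℂ} (hθ : 0 ≤ θ.im) (hθ0 : θ ≠ 0) :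
    ‖∫ y in Iic x, Complex.exp (Complex.I * θ * ((x - y : ℝ) : ℂ)) * g y‖ ≤
      ‖θ‖⁻¹ * ((∫ y, ‖deriv g y‖) + ‖g x‖) := by
  have hIθ : Complex.I * θ ≠ 0 := mul_ne_zero Complex.I_ne_zero hθ0
  have hg' : Continuous (deriv g) := hg.continuous_deriv (by simp)
  have hexp : Continuous fun y : ℝ => Complex.exp (Complex.I * θ * ((x - y : ℝ) : ℂ)) := by fun_prop
  have hE : ∀ y, HasDerivAt (fun y : ℝ => Complex.exp (Complex.I * θ * ((x - y : ℝ) : ℂ)))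
      (-(Complex.I * θ) * Complex.exp (Complex.I * θ * ((x - y : ℝ) : ℂ))) y := fun y => by
    have h1 : HasDerivAt (fun y : ℝ => ((x - y : ℝ) : ℂ)) (-1) y := by
      simpa using ((hasDerivAt_id y).const_sub x).ofReal_comp
    exact ((h1.const_mul (Complex.I * θ)).cexp).congr_deriv (by ring)
  have hint1 : Integrable fun y => Complex.exp (Complex.I * θ * ((x - y : ℝ) : ℂ)) * g y :=
    (hexp.mul hg.continuous).integrable_of_hasCompactSupport hgs.mul_left
  have hint2 : Integrable fun y => Complex.exp (Complex.I * θ * ((x - y : ℝ) : ℂ)) * deriv g y :=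
    (hexp.mul hg').integrable_of_hasCompactSupport hgs.deriv.mul_left
  have h1 := integral_Iic_of_hasDerivAt_of_tendsto' (a := x) (m := (0 : ℂ))
    (f := fun y => Complex.exp (Complex.I * θ * ((x - y : ℝ) : ℂ)) * g y)
    (f' := fun y => -(Complex.I * θ) * (Complex.exp (Complex.I * θ * ((x - y : ℝ) : ℂ)) * g y) +
      Complex.exp (Complex.I * θ * ((x - y : ℝ) : ℂ)) * deriv g y)
    (fun y _ => ((hE y).mul
      (hg.differentiable (by simp) y).hasDerivAt).congr_deriv (by ring))
    ((hint1.const_mul _).add hint2).integrableOn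
    (tendsto_const_nhds.congr' (by
      obtain ⟨R, hR⟩ := hgs.isCompact.isBounded.subset_closedBall 0
      filter_upwards [eventually_lt_atBot (-R)] with y hy
      have : g y = 0 := image_eq_zero_of_notMem_tsupport fun hmem => by
        have := hR hmem
        rw [mem_closedBall_zero_iff, Real.norm_eq_abs, abs_le] at this
        linarith [this.1]
      rw [this, mul_zero]))
  rw [integral_add (hint1.const_mul _).integrableOn hint2.integrableOn, integral_const_mul] at h1
  have h2 : ∫ y in Iic x, Complex.exp (Complex.I * θ * ((x - y : ℝ) : ℂ)) * g y =
      (Complex.I * θ)⁻¹ * ((∫ y in Iic x, Complex.exp (Complex.I * θ * ((x - y : ℝ) : ℂ)) *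
        deriv g y) - g x) := by
    rw [eq_inv_mul_iff_mul_eq₀ hIθ]
    simp only [sub_self, Complex.ofReal_zero, mul_zero, Complex.exp_zero, one_mul, sub_zero] at h1
    linear_combination -h1
  rw [h2, norm_mul, norm_inv, norm_mul, Complex.norm_I, one_mul]
  refine mul_le_mul_of_nonneg_left ((norm_sub_le _ _).trans (add_le_add ?_ le_rfl))
    (inv_nonneg.2 (norm_nonneg _))
  have hint3 : Integrable fun y => ‖deriv g y‖ :=
    (hg'.integrable_of_hasCompactSupport hgs.deriv).norm
  refine (norm_integral_le_of_norm_le hint3.integrableOn ?_).trans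
    (setIntegral_le_integral hint3 (Eventually.of_forall fun _ => norm_nonneg _))
  filter_upwards [ae_restrict_mem measurableSet_Iic] with y hy
  rw [norm_mul]
  exact mul_le_of_le_one_left (norm_nonneg _) (norm_exp_mul_I_le_one hθ (sub_nonneg.2 hy))

/-- A Riemann-Lebesgue lemma for complex frequencies in the closed upper half-plane. -/
theorem tendsto_integral_exp_mul {g : ℝ → ℂ} (hg : Integrable g) (x : ℝ) :
    Tendsto (fun θ : ℂ => ∫ y in Iic x, Complex.exp (Complex.I * θ * ((x - y : ℝ) : ℂ)) * g y)
      (Bornology.cobounded ℂ ⊓ 𝓟 {θ | 0 ≤ θ.im}) (𝓝 0) := by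
  rw [Metric.tendsto_nhds]
  intro η hη
  -- Approximate in L¹ by a smooth compactly supported function. The error is harmless for all
  -- admissible frequencies at once, since the exponential has modulus at most 1.
  obtain ⟨k, hks, hk, hgk⟩ := (memLp_one_iff_integrable.2 hg).exist_eLpNorm_sub_le
    (by simp) le_rfl (half_pos hη)
  have hkint : Integrable k := hk.continuous.integrable_of_hasCompactSupport hks
  have hgk' : ∫ y, ‖g y - k y‖ ≤ η / 2 := by
    have h1 := ENNReal.toReal_mono ENNReal.ofReal_ne_top hgk
    rw [ENNReal.toReal_ofReal (half_pos hη).le, eLpNorm_one_eq_lintegral_enorm] at h1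
    rwa [← integral_norm_eq_lintegral_enorm (hg.sub hkint).aestronglyMeasurable] at h1
  set C : ℝ := (∫ y, ‖deriv k y‖) + ‖k x‖ with hC
  have hC0 : 0 ≤ C := add_nonneg (integral_nonneg fun _ => norm_nonneg _) (norm_nonneg _)
  have hev : ∀ᶠ θ : ℂ in Bornology.cobounded ℂ, 2 * (C + 1) / η < ‖θ‖ :=
    tendsto_norm_cobounded_atTop.eventually_gt_atTop _
  filter_upwards [hev.filter_mono inf_le_left, mem_inf_of_right (mem_principal_self _)] with θ h1 h2
  have h2 : 0 ≤ θ.im := h2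
  have hpos : 0 < ‖θ‖ := lt_of_le_of_lt (by positivity) h1
  have hmeas : AEStronglyMeasurable (fun y : ℝ =>
      Complex.exp (Complex.I * θ * ((x - y : ℝ) : ℂ))) (volume.restrict (Iic x)) := by
    refine Continuous.aestronglyMeasurable ?_
    fun_prop
  have hbd : ∀ᵐ y ∂(volume.restrict (Iic x)),
      ‖Complex.exp (Complex.I * θ * ((x - y : ℝ) : ℂ))‖ ≤ 1 := by
    filter_upwards [ae_restrict_mem measurableSet_Iic] with y hy
    exact norm_exp_mul_I_le_one h2 (sub_nonneg.2 hy)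
  have hi1 := hkint.integrableOn (s := Iic x) |>.bdd_mul hmeas hbd
  have hi2 := (hg.sub hkint).integrableOn (s := Iic x) |>.bdd_mul hmeas hbd
  have hsplit : ∫ y in Iic x, Complex.exp (Complex.I * θ * ((x - y : ℝ) : ℂ)) * g y =
      (∫ y in Iic x, Complex.exp (Complex.I * θ * ((x - y : ℝ) : ℂ)) * k y) +
      ∫ y in Iic x, Complex.exp (Complex.I * θ * ((x - y : ℝ) : ℂ)) * (g - k) y := by
    rw [← integral_add hi1 hi2]
    congr 1
    funext y
    simp only [Pi.sub_apply]
    ring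
  rw [dist_zero_right, hsplit]
  have e1 := norm_integral_exp_mul_le_of_contDiff hk hks x h2 (norm_pos_iff.1 hpos)
  have e2 : ‖∫ y in Iic x, Complex.exp (Complex.I * θ * ((x - y : ℝ) : ℂ)) * (g - k) y‖ ≤
      η / 2 := by
    refine (norm_integral_le_of_norm_le (hg.sub hkint).norm.integrableOn ?_).trans
      ((setIntegral_le_integral (hg.sub hkint).norm
        (Eventually.of_forall fun _ => norm_nonneg _)).trans hgk')
    filter_upwards [hbd] with y hy
    rw [norm_mul]
    exact mul_le_of_le_one_left (norm_nonneg _) hy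
  have e3 : ‖θ‖⁻¹ * C < η / 2 := by
    rw [inv_mul_lt_iff₀ hpos]
    rw [div_lt_iff₀ hη] at h1
    nlinarith
  calc _ ≤ _ := norm_add_le _ _
    _ < η / 2 + η / 2 := add_lt_add_of_lt_of_le (e1.trans_lt e3) e2
    _ = η := by ring

theorem hasDerivAt_integral_Iic {F : Type*} [NormedAddCommGroup F] [NormedSpace ℝ F]
    [CompleteSpace F] {g : ℝ → F} (hg : Continuous g) (hi : ∀ x, IntegrableOn g (Iic x)) (x : ℝ) :
    HasDerivAt (fun x => ∫ y in Iic x, g y) (g x) x := by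
  have h1 : (fun x => ∫ y in Iic x, g y) =
      fun x => (∫ y in Iic (0 : ℝ), g y) + ∫ y in (0 : ℝ)..x, g y := by
    funext x
    rw [← intervalIntegral.integral_Iic_sub_Iic (hi _) (hi _), add_sub_cancel]
  rw [h1]
  exact (intervalIntegral.integral_hasDerivAt_right (hg.intervalIntegrable _ _)
    hg.stronglyMeasurable.stronglyMeasurableAtFilter hg.continuousAt).const_add _

/-! ### Classical potentials -/

/-- Potentials `f = u(·,t)`, `f' = u_x(·,t)`, `h = u_t(·,t)` which are continuous, with `f'` the
classical derivative of `f`. -/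
structure NicePotential (f f' h : ℝ → ℝ) : Prop where
  hasDerivAt : ∀ x, HasDerivAt f (f' x) x
  continuous_deriv : Continuous f'
  continuous_h : Continuous h
  integrable_one_sub_cos : Integrable fun x => 1 - Real.cos (f x)
  integrable_sin : Integrable fun x => Real.sin (f x)
  integrable_deriv : Integrable f'
  integrable_h : Integrable h

theorem NicePotential.continuous {f f' h : ℝ → ℝ} (hf : NicePotential f f' h) : Continuous f :=
  continuous_iff_continuousAt.2 fun x => (hf.hasDerivAt x).continuousAt

/-- These are the potentials met by the gauge transformation z ↦ -1/z: `f` and `f'` change sign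
while `h` does not, as for u(x,t) ↦ -u(x,-t). -/
theorem NicePotential.neg {f f' h : ℝ → ℝ} (hf : NicePotential f f' h) :
    NicePotential (fun x => -f x) (fun x => -f' x) h where
  hasDerivAt x := (hf.hasDerivAt x).neg
  continuous_deriv := hf.continuous_deriv.neg
  continuous_h := hf.continuous_h
  integrable_one_sub_cos := by simpa using hf.integrable_one_sub_cos
  integrable_sin := by simpa using hf.integrable_sin
  integrable_deriv := hf.integrable_deriv.neg
  integrable_h := hf.integrable_h

/-- The signs are those of u(x,t) ↦ -u(-x,-t); the two minus signs cancel in both derivatives.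
Spatial reflection exchanges the roles of m₁⁻ and m₂⁺. -/
theorem NicePotential.reflect {f f' h : ℝ → ℝ} (hf : NicePotential f f' h) :
    NicePotential (fun x => -f (-x)) (fun x => f' (-x)) (fun x => h (-x)) where
  hasDerivAt x := by
    exact ((hf.hasDerivAt (-x)).scomp x (hasDerivAt_neg x)).neg.congr_deriv (by simp)
  continuous_deriv := hf.continuous_deriv.comp continuous_neg
  continuous_h := hf.continuous_h.comp continuous_neg
  integrable_one_sub_cos := by simpa using hf.integrable_one_sub_cos.comp_neg
  integrable_sin := by simpa using hf.integrable_sin.comp_neg.neg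
  integrable_deriv := hf.integrable_deriv.comp_neg
  integrable_h := hf.integrable_h.comp_neg

/-- The weight controlling the potential matrix for `|z| ≥ δ`. -/
def potentialWeight (ε δ : ℝ) (f f' h : ℝ → ℝ) (y : ℝ) : ℝ :=
  (4 * ε)⁻¹ * (δ⁻¹ * (|1 - Real.cos (f y)| + |Real.sin (f y)|) + ε * |f' y + h y|)

theorem NicePotential.isWeight {f f' h : ℝ → ℝ} (hf : NicePotential f f' h) {ε δ : ℝ} (hε : 0 < ε)
    (hδ : 0 < δ) : IsWeight (potentialWeight ε δ f f' h) where
  continuous := by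
    have h1 := hf.continuous
    have h2 := hf.continuous_deriv
    have h3 := hf.continuous_h
    unfold potentialWeight
    fun_prop
  nonneg y := by
    unfold potentialWeight
    positivity
  integrable := (((hf.integrable_one_sub_cos.abs.add hf.integrable_sin.abs).const_mul _).add
    ((hf.integrable_deriv.add hf.integrable_h).abs.const_mul _)).const_mul _

theorem norm_Q_le {ε δ : ℝ} (hε : 0 < ε) (hδ : 0 < δ) (f f' h : ℝ → ℝ) {z : ℂ} (hz : δ ≤ ‖z‖)
    (y : ℝ) (i j : Fin 2) :
    ‖(1 / (4 * Complex.I * ε) : ℂ) * Q ε f f' h z y i j‖ ≤ potentialWeight ε δ f f' h y := by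
  have h1 : ‖(1 / (4 * Complex.I * ε) : ℂ)‖ = (4 * ε)⁻¹ := by
    simp [abs_of_pos hε]
  have h2 : ‖z⁻¹‖ ≤ δ⁻¹ := by
    rw [norm_inv]
    exact inv_anti₀ hδ hz
  have h3 : ‖z⁻¹ * (1 - Real.cos (f y) : ℂ)‖ ≤ δ⁻¹ * |1 - Real.cos (f y)| := by
    have : (1 - Real.cos (f y) : ℂ) = ((1 - Real.cos (f y) : ℝ) : ℂ) := by push_cast; rfl
    rw [this, norm_mul, Complex.norm_real, Real.norm_eq_abs]
    gcongr
  have h4 : ‖z⁻¹ * (Real.sin (f y) : ℂ)‖ ≤ δ⁻¹ * |Real.sin (f y)| := by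
    rw [norm_mul, Complex.norm_real, Real.norm_eq_abs]
    gcongr
  have h5 : ‖Complex.I * (ε * (f' y + h y) : ℂ)‖ = ε * |f' y + h y| := by
    have : (ε * (f' y + h y) : ℂ) = ((ε * (f' y + h y) : ℝ) : ℂ) := by push_cast; rfl
    rw [this, norm_mul, Complex.norm_I, one_mul, Complex.norm_real, Real.norm_eq_abs, abs_mul,
      abs_of_pos hε]
  have p1 : 0 ≤ δ⁻¹ * |1 - Real.cos (f y)| := by positivity
  have p2 : 0 ≤ δ⁻¹ * |Real.sin (f y)| := by positivity
  have p3 : 0 ≤ ε * |f' y + h y| := by positivity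
  rw [norm_mul, h1, potentialWeight]
  refine mul_le_mul_of_nonneg_left ?_ (by positivity)
  rw [mul_add]
  fin_cases i <;> fin_cases j <;> simp only [Q, Fin.zero_eta, Fin.mk_one, Matrix.of_apply,
    Matrix.cons_val', Matrix.cons_val_zero, Matrix.cons_val_one, Matrix.cons_val_fin_one, norm_neg]
  · linarith
  · refine (norm_sub_le _ _).trans ?_
    rw [norm_neg, h5]
    linarith
  · refine (norm_add_le _ _).trans ?_
    rw [norm_neg, h5]
    linarith
  · linarith

/-- Both z and -1/z lie in the closed upper half-plane. This makes the exponentials in the kernel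
decay. -/
theorem E_im_nonneg {z : ℂ} (hz : 0 ≤ z.im) : 0 ≤ (E z).im := by
  have : (E z).im = (z.im + z.im / Complex.normSq z) / 4 := by
    simp [E, Complex.inv_im]
    norm_num [Complex.normSq]
    ring
  rw [this]
  have := Complex.normSq_nonneg z
  positivity

theorem E_neg (z : ℂ) : E (-z) = -E z := by
  simp [E, inv_neg]; ring

/-- The Volterra kernel of `m₁⁻`. -/
def jostKernel (ε : ℝ) (f f' h : ℝ → ℝ) (z : ℂ) (x y : ℝ) : Matrix (Fin 2) (Fin 2) ℂ :=
  Matrix.diagonal ![1, Complex.exp (Complex.I * (2 * E z / ε) * ((x - y : ℝ) : ℂ))] *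
    ((1 / (4 * Complex.I * ε) : ℂ) • Q ε f f' h z y)

theorem jostIntegrand_eq (ε : ℝ) (f f' h : ℝ → ℝ) (z : ℂ) (m : ℝ → Fin 2 → ℂ) (x y : ℝ) :
    (1 / (4 * Complex.I * ε) : ℂ) • jostIntegrand ε f f' h z 0 m x y =
      (jostKernel ε f f' h z x y).mulVec (m y) := by
  have e1 : Complex.exp (Complex.I * E z * (x - y) * sgn 0 / ε) *
      Complex.exp (-(Complex.I * E z * ((x - y : ℝ) : ℂ) * sgn 0) / ε) = 1 := by
    rw [← Complex.exp_add, ← Complex.exp_zero]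
    congr 1
    push_cast
    ring
  have e2 : Complex.exp (Complex.I * E z * (x - y) * sgn 0 / ε) *
      Complex.exp (-(Complex.I * E z * ((x - y : ℝ) : ℂ) * sgn 1) / ε) =
      Complex.exp (Complex.I * (2 * E z / ε) * ((x - y : ℝ) : ℂ)) := by
    rw [← Complex.exp_add]
    congr 1
    simp [sgn]
    ring
  rw [jostKernel, jostIntegrand, expSigma, ← Matrix.mulVec_mulVec, Matrix.smul_mulVec]
  funext i
  fin_cases i
  · simp only [Fin.zero_eta, Pi.smul_apply, smul_eq_mul, Matrix.mulVec_diagonal,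
      Matrix.cons_val_zero]
    linear_combination (1 / (4 * Complex.I * ε) * (Q ε f f' h z y).mulVec (m y) 0) * e1
  · simp only [Fin.mk_one, Pi.smul_apply, smul_eq_mul, Matrix.mulVec_diagonal,
      Matrix.cons_val_one, Matrix.cons_val_fin_one]
    linear_combination (1 / (4 * Complex.I * ε) * (Q ε f f' h z y).mulVec (m y) 1) * e2

theorem isJostMinus_zero_iff (ε : ℝ) (f f' h : ℝ → ℝ) (z : ℂ) (m : ℝ → Fin 2 → ℂ) :
    IsJostMinus ε f f' h z 0 m ↔ Continuous m ∧ (∃ C : ℝ, ∀ x, ‖m x‖ ≤ C) ∧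
      ∀ x, m x = Pi.single 0 1 + ∫ y in Iic x, (jostKernel ε f f' h z x y).mulVec (m y) := by
  simp only [IsJostMinus, ← jostIntegrand_eq, integral_smul]

theorem aestronglyMeasurable_matrix {M : ℝ → Matrix (Fin 2) (Fin 2) ℂ} (hM : Continuous M)
    {μ : Measure ℝ} : AEStronglyMeasurable M μ := by
  have : TopologicalSpace.PseudoMetrizableSpace (Matrix (Fin 2) (Fin 2) ℂ) :=
    inferInstanceAs (TopologicalSpace.PseudoMetrizableSpace (Fin 2 → Fin 2 → ℂ))
  exact hM.aestronglyMeasurable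

/-- Spectral parameters in the closed upper half-plane away from zero. -/
def upperSet (δ : ℝ) : Set ℂ := {z | 0 ≤ z.im ∧ δ < ‖z‖}

/-- The only exponential in the kernel is exp(2iE(x - y)/ε), of modulus at most 1 for y ≤ x and Im z
≥ 0. Staying away from z = 0 bounds the factor z⁻¹ in the potential. -/
theorem NicePotential.isVolterraFamily {f f' h : ℝ → ℝ} (hf : NicePotential f f' h) {ε δ : ℝ}
    (hε : 0 < ε) (hδ : 0 < δ) :
    IsVolterraFamily (potentialWeight ε δ f f' h)
      (fun z : upperSet δ => jostKernel ε f f' h z) where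
  meas z x := by
    have h1 := hf.continuous
    have h2 := hf.continuous_deriv
    have h3 := hf.continuous_h
    refine aestronglyMeasurable_matrix (continuous_matrix fun i j => ?_)
    fin_cases i <;> fin_cases j <;> simp [jostKernel, Q, Matrix.diagonal_mul] <;> fun_prop
  bound z x y hxy i j := by
    have hz := z.2
    have h1 := norm_Q_le hε hδ f f' h hz.2.le y i j
    have h2 : ‖Complex.exp (Complex.I * (2 * E z / ε) * ((x - y : ℝ) : ℂ))‖ ≤ 1 := by
      refine norm_exp_mul_I_le_one ?_ (sub_nonneg.2 hxy)
      have : (2 * E z / ε : ℂ) = ((2 / ε : ℝ) : ℂ) * E z := by push_cast; ring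
      rw [this, Complex.im_ofReal_mul]
      have := E_im_nonneg hz.1
      positivity
    rw [jostKernel, Matrix.diagonal_mul, norm_mul]
    refine le_trans (mul_le_of_le_one_left (norm_nonneg _) ?_) h1
    fin_cases i
    · simp
    · exact h2
  cont z₀ x₀ := by
    refine Eventually.of_forall fun y => Continuous.continuousAt ?_
    have hz : ∀ q : upperSet δ × ℝ, (q.1 : ℂ) ≠ 0 := fun q =>
      norm_pos_iff.1 (hδ.trans q.1.2.2)
    have hinv : Continuous fun q : upperSet δ × ℝ => (q.1 : ℂ)⁻¹ :=
      (continuous_subtype_val.comp continuous_fst).inv₀ hz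
    have hE : Continuous fun q : upperSet δ × ℝ => E (q.1 : ℂ) :=
      ((continuous_subtype_val.comp continuous_fst).sub hinv).div_const _
    refine continuous_matrix fun i j => ?_
    fin_cases i <;> fin_cases j <;> simp [jostKernel, Q, Matrix.diagonal_mul] <;> fun_prop

/-! ### Jost solutions and the eigenvalue equation -/

/-- The coefficient matrix `4 E(z) σ₃ + Q` of the eigenvalue equation. -/
def lax (ε : ℝ) (f f' h : ℝ → ℝ) (z : ℂ) (x : ℝ) : Matrix (Fin 2) (Fin 2) ℂ :=
  Matrix.diagonal (fun i => 4 * E z * sgn i) + Q ε f f' h z x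

/-- `w` solves the eigenvalue equation `4iε w_x = (4 E(z) σ₃ + Q) w`. -/
def SolvesLax (ε : ℝ) (f f' h : ℝ → ℝ) (z : ℂ) (w : ℝ → Fin 2 → ℂ) : Prop :=
  ∀ x, HasDerivAt w ((1 / (4 * Complex.I * ε) : ℂ) • (lax ε f f' h z x).mulVec (w x)) x

/-- The phase `exp(i E(z) x (σ₃)ₖₖ / ε)`. -/
def phase (ε : ℝ) (z : ℂ) (k : Fin 2) (x : ℝ) : ℂ :=
  Complex.exp (Complex.I * E z * x * sgn k / ε)

/-- `w` solves the eigenvalue equation and is asymptotic to `exp(-i E(z) x (σ₃)ₖₖ / ε) eₖ`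
along `l`. -/
def IsJost (ε : ℝ) (f f' h : ℝ → ℝ) (z : ℂ) (k : Fin 2) (l : Filter ℝ) (w : ℝ → Fin 2 → ℂ) :
    Prop :=
  SolvesLax ε f f' h z w ∧ Tendsto (fun x => phase ε z k x • w x) l (𝓝 (Pi.single k 1))

theorem phase_ne_zero (ε : ℝ) (z : ℂ) (k : Fin 2) (x : ℝ) : phase ε z k x ≠ 0 :=
  Complex.exp_ne_zero _

theorem phase_zero_mul_phase_one (ε : ℝ) (z : ℂ) (x : ℝ) :
    phase ε z 0 x * phase ε z 1 x = 1 := by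
  rw [phase, phase, ← Complex.exp_add, ← Complex.exp_zero]
  congr 1
  simp [sgn]
  ring

theorem phase_mul_exp (ε : ℝ) (z : ℂ) (k : Fin 2) (x : ℝ) :
    phase ε z k x * Complex.exp (-(Complex.I * E z * x * sgn k) / ε) = 1 := by
  rw [phase, ← Complex.exp_add, ← Complex.exp_zero]
  congr 1
  ring

theorem phase_smul_jMinus (ε : ℝ) (f f' h : ℝ → ℝ) (k : Fin 2) (z : ℂ) (x : ℝ) :
    phase ε z k x • jMinus ε f f' h k z x = mMinus ε f f' h k z x := by
  rw [jMinus, smul_smul, phase_mul_exp, one_smul]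

theorem phase_smul_jPlus (ε : ℝ) (f f' h : ℝ → ℝ) (k : Fin 2) (z : ℂ) (x : ℝ) :
    phase ε z k x • jPlus ε f f' h k z x = mPlus ε f f' h k z x := by
  rw [jPlus, smul_smul, phase_mul_exp, one_smul]

theorem hasDerivAt_phase (ε : ℝ) (z : ℂ) (k : Fin 2) (x : ℝ) :
    HasDerivAt (phase ε z k) (Complex.I * E z * sgn k / ε * phase ε z k x) x := by
  have h1 : HasDerivAt (fun x : ℝ => Complex.I * E z * x * sgn k / ε)
      (Complex.I * E z * sgn k / ε) x := by
    simpa using (((Complex.ofRealCLM.hasDerivAt (x := x)).const_mul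
      (Complex.I * E z)).mul_const (sgn k)).div_const (ε : ℂ)
  exact h1.cexp.congr_deriv (mul_comm _ _)

theorem continuous_phase (ε : ℝ) (z : ℂ) (k : Fin 2) : Continuous (phase ε z k) :=
  continuous_iff_continuousAt.2 fun x => (hasDerivAt_phase ε z k x).continuousAt

/-- Passage to the interaction picture: the phases remove the diagonal term 4E(z)σ₃, leaving only
the integrable part `Q` on the right. -/
theorem solvesLax_iff {ε : ℝ} (hε : ε ≠ 0) (f f' h : ℝ → ℝ) (z : ℂ) (w : ℝ → Fin 2 → ℂ) :
    SolvesLax ε f f' h z w ↔ ∀ x i, HasDerivAt (fun x => phase ε z i x * w x i)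
      (phase ε z i x * ((1 / (4 * Complex.I * ε) : ℂ) • Q ε f f' h z x).mulVec (w x) i) x := by
  have hεc : (ε : ℂ) ≠ 0 := by exact_mod_cast hε
  refine forall_congr' fun x => ?_
  rw [hasDerivAt_pi]
  refine forall_congr' fun i => ?_
  have e1 : ((1 / (4 * Complex.I * ε) : ℂ) • (lax ε f f' h z x).mulVec (w x)) i =
      -(Complex.I * E z * sgn i / ε) * w x i +
      ((1 / (4 * Complex.I * ε) : ℂ) • Q ε f f' h z x).mulVec (w x) i := by
    rw [lax, Matrix.add_mulVec, Matrix.smul_mulVec]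
    simp only [Pi.smul_apply, Pi.add_apply, Matrix.mulVec_diagonal, smul_eq_mul]
    have : (1 / (4 * Complex.I * ε) : ℂ) * (4 * E z * sgn i * w x i) =
        -(Complex.I * E z * sgn i / ε) * w x i := by
      field_simp
      simp
    rw [mul_add, this]
  rw [e1]
  constructor
  · intro hw
    exact ((hasDerivAt_phase ε z i x).mul hw).congr_deriv (by ring)
  · intro hw
    have h2 : HasDerivAt (fun x => (phase ε z i x)⁻¹)
        (-(Complex.I * E z * sgn i / ε) * (phase ε z i x)⁻¹) x := by
      refine ((hasDerivAt_phase ε z i x).inv (phase_ne_zero ε z i x)).congr_deriv ?_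
      have := phase_ne_zero ε z i x
      field_simp
    have h3 := h2.mul hw
    have e2 : (fun x => w x i) = (fun x => (phase ε z i x)⁻¹) * fun x => phase ε z i x * w x i := by
      funext y
      simp [phase_ne_zero]
    rw [e2]
    refine h3.congr_deriv ?_
    have := phase_ne_zero ε z i x
    field_simp

theorem SolvesLax.continuous {ε : ℝ} {f f' h : ℝ → ℝ} {z : ℂ} {w : ℝ → Fin 2 → ℂ}
    (hw : SolvesLax ε f f' h z w) : Continuous w :=
  continuous_iff_continuousAt.2 fun x => (hw x).continuousAt

/-- The derivative of `exp(i E(z) x ((σ₃)ᵢᵢ - 1) / ε) mᵢ`. -/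
def jostDensity (ε : ℝ) (f f' h : ℝ → ℝ) (z : ℂ) (m : ℝ → Fin 2 → ℂ) (i : Fin 2) (y : ℝ) : ℂ :=
  phase ε z i y * (phase ε z 0 y)⁻¹ *
    ((1 / (4 * Complex.I * ε) : ℂ) • Q ε f f' h z y).mulVec (m y) i

/-- The dependence on x and y separates, so each component of the Volterra integral is an explicit
phase in x times a primitive, and the fundamental theorem of calculus applies. -/
theorem jostKernel_mulVec_apply (ε : ℝ) (f f' h : ℝ → ℝ) (z : ℂ) (m : ℝ → Fin 2 → ℂ) (x y : ℝ)
    (i : Fin 2) : (jostKernel ε f f' h z x y).mulVec (m y) i =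
      (phase ε z i x)⁻¹ * phase ε z 0 x * jostDensity ε f f' h z m i y := by
  rw [jostKernel, ← Matrix.mulVec_mulVec, Matrix.mulVec_diagonal, jostDensity, ← mul_assoc]
  congr 1
  have h1 := phase_ne_zero ε z 0 x
  have h2 := phase_ne_zero ε z 0 y
  fin_cases i
  · simp only [Fin.zero_eta, Matrix.cons_val_zero]
    field_simp
  · have h3 : (phase ε z 1 x)⁻¹ = phase ε z 0 x := by
      exact inv_eq_of_mul_eq_one_left (phase_zero_mul_phase_one ε z x)
    have h4 : (phase ε z 0 y)⁻¹ = phase ε z 1 y := by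
      exact inv_eq_of_mul_eq_one_right (phase_zero_mul_phase_one ε z y)
    simp only [Fin.mk_one, Matrix.cons_val_one, Matrix.cons_val_fin_one]
    rw [h3, h4]
    simp only [phase, ← Complex.exp_add]
    congr 1
    simp [sgn]
    ring

theorem exists_norm_le_of_tendsto_atBot {F : Type*} [NormedAddCommGroup F] {m : ℝ → F}
    (hm : Continuous m) {a : F} (h : Tendsto m atBot (𝓝 a)) (X : ℝ) :
    ∃ c, ∀ y, y ≤ X → ‖m y‖ ≤ c := by
  obtain ⟨b, hb⟩ := eventually_atBot.1 (h.norm.eventually (gt_mem_nhds (lt_add_one ‖a‖)))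
  obtain ⟨c, hc⟩ := (isCompact_Icc (a := b) (b := X)).exists_bound_of_continuousOn hm.continuousOn
  refine ⟨max c (‖a‖ + 1), fun y hy => ?_⟩
  rcases le_total y b with h1 | h1
  · exact (hb y h1).le.trans (le_max_right _ _)
  · exact (hc y ⟨h1, hy⟩).trans (le_max_left _ _)

section

variable {f f' h : ℝ → ℝ} {ε : ℝ} {z : ℂ}

theorem mem_upperSet_half (hz : z ≠ 0) (hz' : 0 ≤ z.im) : z ∈ upperSet (‖z‖ / 2) :=
  ⟨hz', by linarith [norm_pos_iff.2 hz]⟩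

theorem NicePotential.isJostMinus_volterraSol (hf : NicePotential f f' h) (hε : 0 < ε) (hz : z ≠ 0)
    (hz' : 0 ≤ z.im) :
    IsJostMinus ε f f' h z 0 (volterraSol (jostKernel ε f f' h z) (Pi.single 0 1)) := by
  have hδ : 0 < ‖z‖ / 2 := by linarith [norm_pos_iff.2 hz]
  have hν := hf.isWeight hε hδ
  have hL := hf.isVolterraFamily hε hδ
  let p : upperSet (‖z‖ / 2) := ⟨z, mem_upperSet_half hz hz'⟩
  rw [isJostMinus_zero_iff]
  exact ⟨hL.continuous_sol_right hν (Pi.single 0 1) p,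
    ⟨_, hL.norm_sol_le hν (Pi.single 0 1) p⟩, hL.sol_eq hν (Pi.single 0 1) p⟩

/-- Boundedness is required only on left half-lines: a solution known through its asymptotics at -∞
is not known to be bounded at +∞ beforehand. -/
theorem NicePotential.volterraSol_unique (hf : NicePotential f f' h) (hε : 0 < ε) (hz : z ≠ 0)
    (hz' : 0 ≤ z.im) {m : ℝ → Fin 2 → ℂ} (hm : Continuous m)
    (hb : ∀ X, ∃ c, ∀ y, y ≤ X → ‖m y‖ ≤ c)
    (heq : ∀ x, m x = Pi.single 0 1 + ∫ y in Iic x, (jostKernel ε f f' h z x y).mulVec (m y)) :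
    m = volterraSol (jostKernel ε f f' h z) (Pi.single 0 1) := by
  have hδ : 0 < ‖z‖ / 2 := by linarith [norm_pos_iff.2 hz]
  have hν := hf.isWeight hε hδ
  have hL := hf.isVolterraFamily hε hδ
  let p : upperSet (‖z‖ / 2) := ⟨z, mem_upperSet_half hz hz'⟩
  funext X
  obtain ⟨c, hc⟩ := hb X
  refine hL.eq_of_eq hν (Pi.single 0 1) p (c := max c _) hm
    (hL.continuous_sol_right hν (Pi.single 0 1) p)
    (fun x hx => (hc x hx).trans (le_max_left _ _))
    (fun x _ => (hL.norm_sol_le hν (Pi.single 0 1) p x).trans (le_max_right _ _))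
    (fun x _ => heq x) (fun x _ => hL.sol_eq hν (Pi.single 0 1) p x) X le_rfl

theorem NicePotential.isJostMinus_mMinus_zero (hf : NicePotential f f' h) (hε : 0 < ε) (hz : z ≠ 0)
    (hz' : 0 ≤ z.im) : IsJostMinus ε f f' h z 0 (mMinus ε f f' h 0 z) :=
  Classical.epsilon_spec ⟨_, hf.isJostMinus_volterraSol hε hz hz'⟩

theorem NicePotential.eq_volterraSol (hf : NicePotential f f' h) (hε : 0 < ε) (hz : z ≠ 0)
    (hz' : 0 ≤ z.im) {m : ℝ → Fin 2 → ℂ} (hm : IsJostMinus ε f f' h z 0 m) :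
    m = volterraSol (jostKernel ε f f' h z) (Pi.single 0 1) := by
  obtain ⟨h1, ⟨C, h2⟩, h3⟩ := (isJostMinus_zero_iff ..).1 hm
  exact hf.volterraSol_unique hε hz hz' h1 (fun _ => ⟨C, fun y _ => h2 y⟩) h3

theorem NicePotential.mMinus_zero_eq (hf : NicePotential f f' h) (hε : 0 < ε) (hz : z ≠ 0)
    (hz' : 0 ≤ z.im) :
    mMinus ε f f' h 0 z = volterraSol (jostKernel ε f f' h z) (Pi.single 0 1) :=
  hf.eq_volterraSol hε hz hz' (hf.isJostMinus_mMinus_zero hε hz hz')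

theorem NicePotential.tendsto_mMinus_zero (hf : NicePotential f f' h) (hε : 0 < ε) (hz : z ≠ 0)
    (hz' : 0 ≤ z.im) : Tendsto (mMinus ε f f' h 0 z) atBot (𝓝 (Pi.single 0 1)) := by
  have hδ : 0 < ‖z‖ / 2 := by linarith [norm_pos_iff.2 hz]
  have hν := hf.isWeight hε hδ
  have hL := hf.isVolterraFamily hε hδ
  let p : upperSet (‖z‖ / 2) := ⟨z, mem_upperSet_half hz hz'⟩
  obtain ⟨-, ⟨C, hC⟩, h3⟩ := (isJostMinus_zero_iff ..).1 (hf.isJostMinus_mMinus_zero hε hz hz')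
  rw [tendsto_iff_norm_sub_tendsto_zero]
  refine squeeze_zero (fun x => norm_nonneg _) (fun x => ?_)
    (by simpa using hν.tendsto_cumulative.const_mul (2 * C))
  rw [h3 x, add_sub_cancel_left, cumulative, ← integral_const_mul]
  refine norm_integral_le_of_norm_le (hν.integrable.integrableOn.const_mul _) ?_
  filter_upwards [ae_restrict_mem measurableSet_Iic] with y hy
  exact hL.norm_integrand_le p hy (hC y) (hν.nonneg y)

theorem NicePotential.continuous_Q (hf : NicePotential f f' h) (ε : ℝ) (z : ℂ) :
    Continuous (Q ε f f' h z) := by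
  have h1 := hf.continuous
  have h2 := hf.continuous_deriv
  have h3 := hf.continuous_h
  refine continuous_matrix fun i j => ?_
  fin_cases i <;> fin_cases j <;> simp [Q] <;> fun_prop

theorem NicePotential.continuous_jostDensity (hf : NicePotential f f' h) (ε : ℝ) (z : ℂ)
    {m : ℝ → Fin 2 → ℂ} (hm : Continuous m) (i : Fin 2) :
    Continuous (jostDensity ε f f' h z m i) :=
  ((continuous_phase ε z i).mul ((continuous_phase ε z 0).inv₀ (phase_ne_zero ε z 0))).mul
    ((continuous_apply i).comp
      (((hf.continuous_Q ε z).const_smul (1 / (4 * Complex.I * ε) : ℂ)).matrix_mulVec hm))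

theorem NicePotential.integrableOn_jostDensity (hf : NicePotential f f' h) (hε : 0 < ε)
    (hz : z ≠ 0) (hz' : 0 ≤ z.im) {m : ℝ → Fin 2 → ℂ} (hm : Continuous m) {X c : ℝ}
    (hc : ∀ y, y ≤ X → ‖m y‖ ≤ c) (i : Fin 2) :
    IntegrableOn (jostDensity ε f f' h z m i) (Iic X) := by
  have hδ : 0 < ‖z‖ / 2 := by linarith [norm_pos_iff.2 hz]
  have h1 := (hf.isVolterraFamily hε hδ).integrableOn (hf.isWeight hε hδ)
    ⟨z, mem_upperSet_half hz hz'⟩ X hm.aestronglyMeasurable hc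
  have h2 := (h1.eval i).const_mul (((phase ε z i X)⁻¹ * phase ε z 0 X)⁻¹)
  refine h2.congr (Eventually.of_forall fun y => ?_)
  simp only [jostKernel_mulVec_apply]
  rw [inv_mul_cancel_left₀]
  exact mul_ne_zero (inv_ne_zero (phase_ne_zero _ _ _ _)) (phase_ne_zero _ _ _ _)

theorem NicePotential.integral_jostKernel_apply (hf : NicePotential f f' h) (hε : 0 < ε)
    (hz : z ≠ 0) (hz' : 0 ≤ z.im) {m : ℝ → Fin 2 → ℂ} (hm : Continuous m) {X c : ℝ}
    (hc : ∀ y, y ≤ X → ‖m y‖ ≤ c) (i : Fin 2) :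
    (∫ y in Iic X, (jostKernel ε f f' h z X y).mulVec (m y)) i =
      (phase ε z i X)⁻¹ * phase ε z 0 X * ∫ y in Iic X, jostDensity ε f f' h z m i y := by
  have hδ : 0 < ‖z‖ / 2 := by linarith [norm_pos_iff.2 hz]
  have h1 := (hf.isVolterraFamily hε hδ).integrableOn (hf.isWeight hε hδ)
    ⟨z, mem_upperSet_half hz hz'⟩ X hm.aestronglyMeasurable hc
  rw [eval_integral fun j => h1.eval j]
  simp only [jostKernel_mulVec_apply, integral_const_mul]

theorem NicePotential.isJost_jMinus_zero (hf : NicePotential f f' h) (hε : 0 < ε) (hz : z ≠ 0)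
    (hz' : 0 ≤ z.im) : IsJost ε f f' h z 0 atBot (jMinus ε f f' h 0 z) := by
  refine ⟨?_, by simpa only [phase_smul_jMinus] using hf.tendsto_mMinus_zero hε hz hz'⟩
  obtain ⟨hm, ⟨C, hC⟩, h3⟩ := (isJostMinus_zero_iff ..).1 (hf.isJostMinus_mMinus_zero hε hz hz')
  have hj : ∀ x, jMinus ε f f' h 0 z x = (phase ε z 0 x)⁻¹ • mMinus ε f f' h 0 z x := fun x => by
    rw [← phase_smul_jMinus, inv_smul_smul₀ (phase_ne_zero _ _ _ _)]
  rw [solvesLax_iff hε.ne']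
  intro x i
  -- In the interaction picture the Volterra equation says that each component is a constant plus a
  -- primitive of `jostDensity`.
  have h4 : (fun x => phase ε z i x * jMinus ε f f' h 0 z x i) = fun x =>
      (Pi.single 0 1 : Fin 2 → ℂ) i +
        ∫ y in Iic x, jostDensity ε f f' h z (mMinus ε f f' h 0 z) i y := by
    funext x
    have h5 := hf.integral_jostKernel_apply hε hz hz' hm (X := x) (fun y _ => hC y) i
    have h6 := congrFun (h3 x) i
    rw [Pi.add_apply, h5] at h6
    have hp0 := phase_ne_zero ε z 0 x
    have hpi := phase_ne_zero ε z i x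
    rw [hj, Pi.smul_apply, smul_eq_mul, h6]
    fin_cases i
    · simp only [Fin.zero_eta] at hpi ⊢
      field_simp
    · simp only [Fin.mk_one] at hpi ⊢
      simp
      field_simp
  rw [h4]
  refine ((hasDerivAt_integral_Iic (hf.continuous_jostDensity ε z hm i)
    (fun X => hf.integrableOn_jostDensity hε hz hz' hm (fun y _ => hC y) i) x).const_add
      _).congr_deriv ?_
  rw [jostDensity, hj, Matrix.mulVec_smul, Pi.smul_apply, smul_eq_mul]
  ring

theorem norm_phase_one_le (hε : 0 < ε) (hz' : 0 ≤ z.im) {x : ℝ} (hx : x ≤ 0) :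
    ‖phase ε z 1 x‖ ≤ 1 := by
  have h1 : phase ε z 1 x = Complex.exp (Complex.I * (((1 / ε : ℝ) : ℂ) * E z) * ((-x : ℝ) : ℂ)) := by
    rw [phase]
    congr 1
    simp [sgn]
    ring
  rw [h1]
  refine norm_exp_mul_I_le_one ?_ (by linarith)
  rw [Complex.im_ofReal_mul]
  have := E_im_nonneg hz'
  positivity

/-- The eigenvalue equation and the asymptotics at `-∞` determine `j₁⁻`. -/
theorem NicePotential.eq_jMinus_zero (hf : NicePotential f f' h) (hε : 0 < ε) (hz : z ≠ 0)
    (hz' : 0 ≤ z.im) {w : ℝ → Fin 2 → ℂ} (hw : IsJost ε f f' h z 0 atBot w) :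
    w = jMinus ε f f' h 0 z := by
  set m : ℝ → Fin 2 → ℂ := fun x => phase ε z 0 x • w x with hm_def
  have hm : Continuous m := (continuous_phase ε z 0).smul hw.1.continuous
  have hb := exists_norm_le_of_tendsto_atBot hm hw.2
  have hwm : ∀ x, w x = (phase ε z 0 x)⁻¹ • m x := fun x => by
    rw [hm_def, inv_smul_smul₀ (phase_ne_zero _ _ _ _)]
  suffices hs : m = mMinus ε f f' h 0 z by
    funext x
    rw [hwm, hs, ← phase_smul_jMinus, inv_smul_smul₀ (phase_ne_zero _ _ _ _)]
  rw [hf.mMinus_zero_eq hε hz hz']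
  refine hf.volterraSol_unique hε hz hz' hm hb fun X => ?_
  obtain ⟨c, hc⟩ := hb X
  have hder := (solvesLax_iff hε.ne' ..).1 hw.1
  -- The hypothesis gives the second component only after multiplication by phase 0. Since phase 1 =
  -- (phase 1)² · phase 0 and |phase 1| ≤ 1 for x ≤ 0, multiplication by phase 1 also gives the
  -- limit 0.
  have hlim : ∀ i, Tendsto (fun x => phase ε z i x * w x i) atBot
      (𝓝 ((Pi.single 0 1 : Fin 2 → ℂ) i)) := by
    have hlim0 := tendsto_pi_nhds.1 hw.2
    intro i
    fin_cases i
    · exact hlim0 0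
    · have h1 := hlim0 1
      simp only [Pi.smul_apply, smul_eq_mul] at h1
      simp only [Fin.mk_one, Fin.isValue, ne_eq, one_ne_zero, not_false_eq_true,
        Pi.single_eq_of_ne] at h1 ⊢
      rw [tendsto_zero_iff_norm_tendsto_zero] at h1 ⊢
      refine squeeze_zero' (Eventually.of_forall fun x => norm_nonneg _) ?_ h1
      filter_upwards [eventually_le_atBot 0] with x hx
      have h2 : phase ε z 1 x = phase ε z 1 x * phase ε z 1 x * phase ε z 0 x := by
        rw [mul_assoc, mul_comm (phase ε z 1 x) (phase ε z 0 x), phase_zero_mul_phase_one, mul_one]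
      rw [h2, mul_assoc, norm_mul]
      refine mul_le_of_le_one_left (norm_nonneg _) ?_
      rw [norm_mul]
      have := norm_phase_one_le hε hz' hx
      exact mul_le_one₀ this (norm_nonneg _) this
  funext i
  have h1 := integral_Iic_of_hasDerivAt_of_tendsto' (a := X)
    (f := fun x => phase ε z i x * w x i) (f' := jostDensity ε f f' h z m i)
    (fun x _ => (hder x i).congr_deriv (by
      rw [jostDensity, hwm, Matrix.mulVec_smul, Pi.smul_apply, smul_eq_mul]
      ring))
    (hf.integrableOn_jostDensity hε hz hz' hm hc i) (hlim i)
  rw [Pi.add_apply, hf.integral_jostKernel_apply hε hz hz' hm hc i, h1, hm_def]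
  simp only [Pi.smul_apply, smul_eq_mul]
  have hp0 := phase_ne_zero ε z 0 X
  have hpi := phase_ne_zero ε z i X
  fin_cases i
  · simp only [Fin.zero_eta] at hpi ⊢
    simp
    field_simp
    ring
  · simp only [Fin.mk_one] at hpi ⊢
    simp
    field_simp

/-! Dependence of `m₁⁻` on the spectral parameter. -/

/-- Continuity is local, so near z the uniform Volterra estimates with cutoff |z|/2 suffice. -/
theorem NicePotential.continuousOn_mMinus_zero (hf : NicePotential f f' h) (hε : 0 < ε) (x : ℝ) :
    ContinuousOn (fun z => mMinus ε f f' h 0 z x) {z | 0 ≤ z.im ∧ z ≠ 0} := by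
  rintro z ⟨hz', hz⟩
  have hδ : 0 < ‖z‖ / 2 := by linarith [norm_pos_iff.2 hz]
  have h1 : ContinuousOn (fun z => volterraSol (jostKernel ε f f' h z) (Pi.single 0 1) x)
      (upperSet (‖z‖ / 2)) := by
    rw [continuousOn_iff_continuous_domRestrict]
    exact (hf.isVolterraFamily hε hδ).continuous_sol_left (hf.isWeight hε hδ) (Pi.single 0 1) x
  have h2 := (h1 z (mem_upperSet_half hz hz')).congr (g := fun z => mMinus ε f f' h 0 z x)
    (fun w hw => by rw [hf.mMinus_zero_eq hε (norm_pos_iff.1 (hδ.trans hw.2)) hw.1])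
    (by rw [hf.mMinus_zero_eq hε hz hz'])
  refine h2.mono_of_mem_nhdsWithin ?_
  have h3 : {w : ℂ | ‖z‖ / 2 < ‖w‖} ∈ 𝓝 z :=
    (isOpen_lt continuous_const continuous_norm).mem_nhds (by
      simp only [mem_ofPred_eq]; linarith [norm_pos_iff.2 hz])
  filter_upwards [self_mem_nhdsWithin, mem_nhdsWithin_of_mem_nhds h3] with w hw1 hw2
  exact ⟨hw1.1, hw2⟩

theorem NicePotential.differentiableOn_mMinus_zero (hf : NicePotential f f' h) (hε : 0 < ε)
    (x : ℝ) : DifferentiableOn ℂ (fun z => mMinus ε f f' h 0 z x) {z | 0 < z.im} := by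
  intro z hz
  have hz : 0 < z.im := hz
  have hz0 : z ≠ 0 := fun h0 => by simp [h0] at hz
  have hδ : 0 < ‖z‖ / 2 := by linarith [norm_pos_iff.2 hz0]
  set U : Set ℂ := {w | 0 < w.im} ∩ {w | ‖z‖ / 2 < ‖w‖} with hU_def
  have hU : IsOpen U := (isOpen_lt continuous_const Complex.continuous_im).inter
    (isOpen_lt continuous_const continuous_norm)
  have hUne : ∀ w ∈ U, w ≠ 0 := fun w hw => norm_pos_iff.1 (hδ.trans hw.2)
  have h1 := (hf.isVolterraFamily hε hδ).differentiableOn_sol (S := upperSet (‖z‖ / 2)) hU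
    (fun w hw => ⟨le_of_lt hw.1, hw.2⟩) (hf.isWeight hε hδ) (Pi.single 0 1)
    (fun x y _ i j => by
      have hE : DifferentiableOn ℂ E U :=
        (differentiableOn_id.sub (differentiableOn_id.inv hUne)).div_const 4
      have hi : DifferentiableOn ℂ (fun w : ℂ => w⁻¹) U := differentiableOn_id.inv hUne
      fin_cases i <;> fin_cases j <;> simp [jostKernel, Q, Matrix.diagonal_mul] <;> fun_prop) x
  have hzU : z ∈ U := ⟨hz, by simp only [mem_ofPred_eq]; linarith [norm_pos_iff.2 hz0]⟩
  refine DifferentiableAt.differentiableWithinAt ?_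
  refine (h1.differentiableAt (hU.mem_nhds hzU)).congr_of_eventuallyEq ?_
  filter_upwards [hU.mem_nhds hzU] with w hw
  rw [hf.mMinus_zero_eq hε (hUne w hw) (le_of_lt hw.1)]

theorem tendsto_E_cobounded : Tendsto E (Bornology.cobounded ℂ) (Bornology.cobounded ℂ) := by
  rw [← tendsto_norm_atTop_iff_cobounded]
  have h1 : Tendsto (fun z : ℂ => (‖z‖ - 1) / 4) (Bornology.cobounded ℂ) atTop :=
    (tendsto_atTop_add_const_right _ (-1) tendsto_norm_cobounded_atTop).atTop_div_const
      (by norm_num)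
  refine tendsto_atTop_mono' _ ?_ h1
  filter_upwards [tendsto_norm_cobounded_atTop.eventually_ge_atTop 1] with z hz
  have h2 : ‖z⁻¹‖ ≤ 1 := by
    rw [norm_inv]
    exact inv_le_one_of_one_le₀ hz
  rw [E, norm_div]
  have h3 := norm_sub_norm_le z z⁻¹
  have h4 : ‖(4 : ℂ)‖ = 4 := by simp
  rw [h4]
  linarith

/-- Most of the potential carries a factor z⁻¹. The remaining off-diagonal part f' + h does not
become small, but is integrated against an exponential whose frequency 2E(z)/ε tends to infinity. -/
theorem NicePotential.tendsto_mMinus_zero_cobounded (hf : NicePotential f f' h) (hε : 0 < ε)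
    (x : ℝ) : Tendsto (fun z => mMinus ε f f' h 0 z x)
      (Bornology.cobounded ℂ ⊓ 𝓟 {z | 0 ≤ z.im}) (𝓝 (Pi.single 0 1)) := by
  have hν := hf.isWeight hε one_pos
  have hL := hf.isVolterraFamily hε one_pos
  -- The limit is taken on the subtype |z| > 1, Im z ≥ 0, the parameter space on which the Volterra
  -- bounds are uniform.
  set l : Filter (upperSet 1) := comap Subtype.val (Bornology.cobounded ℂ) with hl
  have : (Bornology.cobounded ℂ).IsCountablyGenerated := by
    rw [← comap_norm_atTop]
    infer_instance
  have hlim : Tendsto (fun z : upperSet 1 => (z : ℂ)) l (Bornology.cobounded ℂ) := tendsto_comap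
  have hinv : Tendsto (fun z : upperSet 1 => (z : ℂ)⁻¹) l (𝓝 0) := tendsto_inv₀_cobounded.comp hlim
  have hfreq : Tendsto (fun z : upperSet 1 => 2 * E z / ε) l
      (Bornology.cobounded ℂ ⊓ 𝓟 {θ : ℂ | 0 ≤ θ.im}) := by
    refine tendsto_inf.2 ⟨?_, tendsto_principal.2 (Eventually.of_forall fun z => ?_)⟩
    · have h1 : Tendsto (fun z : ℂ => (2 / ε : ℂ) * E z) (Bornology.cobounded ℂ)
          (Bornology.cobounded ℂ) := by
        rw [← tendsto_norm_atTop_iff_cobounded]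
        simp_rw [norm_mul]
        refine Tendsto.const_mul_atTop ?_ (tendsto_norm_cobounded_atTop.comp tendsto_E_cobounded)
        rw [norm_pos_iff]
        exact div_ne_zero two_ne_zero (by exact_mod_cast hε.ne')
      refine (h1.comp hlim).congr fun z => ?_
      simp only [Function.comp_apply]
      ring
    · have : (2 * E z / ε : ℂ) = ((2 / ε : ℝ) : ℂ) * E z := by push_cast; ring
      rw [mem_ofPred_eq, this, Complex.im_ofReal_mul]
      have := E_im_nonneg z.2.1
      positivity
  have hfirst : ∀ x, Tendsto (fun p : upperSet 1 =>
      volterraIter (jostKernel ε f f' h p) (Pi.single 0 1) 1 x) l (𝓝 0) := by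
    intro x
    have hint : ∀ (p : upperSet 1) (i : Fin 2), IntegrableOn (fun y =>
        (jostKernel ε f f' h p x y).mulVec (Pi.single 0 1) i) (Iic x) := fun p i =>
      (hL.integrableOn hν p x (m := fun _ => Pi.single 0 1) aestronglyMeasurable_const
        (c := ‖(Pi.single 0 1 : Fin 2 → ℂ)‖) fun _ _ => le_rfl).eval i
    refine tendsto_pi_nhds.2 fun i => ?_
    have hval : ∀ p : upperSet 1, volterraIter (jostKernel ε f f' h p) (Pi.single 0 1) 1 x i =
        ∫ y in Iic x, (jostKernel ε f f' h p x y).mulVec (Pi.single 0 1) i := fun p =>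
      eval_integral (hint p) i
    simp_rw [hval]
    fin_cases i
    · have e1 : ∀ p : upperSet 1, ∫ y in Iic x,
          (jostKernel ε f f' h p x y).mulVec (Pi.single 0 1) 0 =
          (p : ℂ)⁻¹ * ∫ y in Iic x, (1 / (4 * Complex.I * ε) : ℂ) * (1 - Real.cos (f y) : ℂ) :=
        fun p => by
          rw [← integral_const_mul]
          congr 1
          funext y
          simp [jostKernel, Q, Matrix.diagonal_mul]
          ring
      simp only [Fin.zero_eta, e1]
      simpa using hinv.mul_const _
    · have hs : Integrable fun y => (1 / (4 * Complex.I * ε) : ℂ) * (-(Real.sin (f y)) : ℂ) :=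
        (hf.integrable_sin.ofReal (𝕜 := ℂ)).neg.const_mul _
      have hp : Integrable fun y => (1 / (4 * Complex.I * ε) : ℂ) *
          (Complex.I * (ε * ((f' y + h y : ℝ) : ℂ))) :=
        (((hf.integrable_deriv.add hf.integrable_h).ofReal (𝕜 := ℂ)).const_mul _
          |>.const_mul _).const_mul _
      have r1 := (tendsto_integral_exp_mul hs x).comp hfreq
      have r2 := (tendsto_integral_exp_mul hp x).comp hfreq
      -- The sine term keeps an explicit factor z⁻¹; the term with f' + h relies on the
      -- Riemann–Lebesgue lemma alone.
      have e1 : ∀ p : upperSet 1, ∫ y in Iic x,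
          (jostKernel ε f f' h p x y).mulVec (Pi.single 0 1) 1 =
          (p : ℂ)⁻¹ * (∫ y in Iic x, Complex.exp (Complex.I * (2 * E p / ε) * ((x - y : ℝ) : ℂ)) *
            ((1 / (4 * Complex.I * ε) : ℂ) * (-(Real.sin (f y)) : ℂ))) +
          ∫ y in Iic x, Complex.exp (Complex.I * (2 * E p / ε) * ((x - y : ℝ) : ℂ)) *
            ((1 / (4 * Complex.I * ε) : ℂ) * (Complex.I * (ε * ((f' y + h y : ℝ) : ℂ)))) :=
        fun p => by
          have hm : AEStronglyMeasurable (fun y : ℝ => Complex.exp (Complex.I * (2 * E p / ε) *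
              ((x - y : ℝ) : ℂ))) (volume.restrict (Iic x)) := by
            refine Continuous.aestronglyMeasurable ?_
            fun_prop
          have hb : ∀ᵐ y ∂(volume.restrict (Iic x)), ‖Complex.exp (Complex.I * (2 * E p / ε) *
              ((x - y : ℝ) : ℂ))‖ ≤ 1 := by
            filter_upwards [ae_restrict_mem measurableSet_Iic] with y hy
            refine norm_exp_mul_I_le_one ?_ (sub_nonneg.2 hy)
            have : (2 * E p / ε : ℂ) = ((2 / ε : ℝ) : ℂ) * E p := by push_cast; ring
            rw [this, Complex.im_ofReal_mul]
            have := E_im_nonneg p.2.1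
            positivity
          rw [← integral_const_mul, ← integral_add
            ((hs.integrableOn.bdd_mul hm hb).const_mul _) (hp.integrableOn.bdd_mul hm hb)]
          congr 1
          funext y
          simp [jostKernel, Q, Matrix.diagonal_mul]
          ring
      simp only [Fin.mk_one, e1]
      simpa using (hinv.mul r1).add r2
  have h1 := hL.tendsto_sol hν (Pi.single 0 1) (l := l) x fun n =>
    hL.tendsto_iter_succ hν (Pi.single 0 1) hfirst n x
  have h2 : Tendsto (fun z => mMinus ε f f' h 0 z x) (Bornology.cobounded ℂ ⊓ 𝓟 (upperSet 1))
      (𝓝 (Pi.single 0 1)) := by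
    rw [← map_comap_setCoe_val, tendsto_map'_iff]
    refine h1.congr fun z => ?_
    have hz0 : (z : ℂ) ≠ 0 := norm_pos_iff.1 (one_pos.trans z.2.2)
    rw [Function.comp_apply, hf.mMinus_zero_eq hε hz0 z.2.1]
  refine h2.mono_left (le_inf inf_le_left ?_)
  rw [le_principal_iff]
  have h3 : ∀ᶠ z : ℂ in Bornology.cobounded ℂ, 1 < ‖z‖ :=
    tendsto_norm_cobounded_atTop.eventually_gt_atTop 1
  filter_upwards [h3.filter_mono inf_le_left, mem_inf_of_right (mem_principal_self _)] with z a b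
  exact ⟨b, a⟩

end

/-! ### Symmetries of the Jost solutions -/

/-- The rotation `(a, b) ↦ (-b, a)`. -/
def rot : (Fin 2 → ℂ) ≃L[ℂ] (Fin 2 → ℂ) :=
  LinearEquiv.toContinuousLinearEquiv
    { toFun := fun v => ![-v 1, v 0]
      map_add' := fun v w => by ext i; fin_cases i <;> simp; ring
      map_smul' := fun c v => by ext i; fin_cases i <;> simp
      invFun := fun v => ![v 1, -v 0]
      left_inv := fun v => by ext i; fin_cases i <;> simp
      right_inv := fun v => by ext i; fin_cases i <;> simp }

/-- The exchange `(a, b) ↦ (b, a)`. -/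
def swap : (Fin 2 → ℂ) ≃L[ℂ] (Fin 2 → ℂ) :=
  LinearEquiv.toContinuousLinearEquiv
    { toFun := fun v => ![v 1, v 0]
      map_add' := fun v w => by ext i; fin_cases i <;> simp
      map_smul' := fun c v => by ext i; fin_cases i <;> simp
      invFun := fun v => ![v 1, v 0]
      left_inv := fun v => by ext i; fin_cases i <;> simp
      right_inv := fun v => by ext i; fin_cases i <;> simp }

@[simp] theorem rot_apply (v : Fin 2 → ℂ) : rot v = ![-v 1, v 0] := rfl
@[simp] theorem rot_symm_apply (v : Fin 2 → ℂ) : rot.symm v = ![v 1, -v 0] := rfl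
@[simp] theorem swap_apply (v : Fin 2 → ℂ) : swap v = ![v 1, v 0] := rfl

theorem mulVec_apply_two (M : Matrix (Fin 2) (Fin 2) ℂ) (v : Fin 2 → ℂ) (i : Fin 2) :
    M.mulVec v i = M i 0 * v 0 + M i 1 * v 1 := by
  rw [Matrix.mulVec, dotProduct, Fin.sum_univ_two]

theorem exists_norm_map_le (A : (Fin 2 → ℂ) ≃L[ℂ] (Fin 2 → ℂ)) {m : ℝ → Fin 2 → ℂ}
    (hm : ∃ C : ℝ, ∀ x, ‖m x‖ ≤ C) : ∃ C : ℝ, ∀ x, ‖A (m x)‖ ≤ C := by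
  obtain ⟨C, hC⟩ := hm
  exact ⟨‖(A : (Fin 2 → ℂ) →L[ℂ] (Fin 2 → ℂ))‖ * C, fun x =>
    ((A : (Fin 2 → ℂ) →L[ℂ] (Fin 2 → ℂ)).le_opNorm _).trans
      (mul_le_mul_of_nonneg_left (hC x) (norm_nonneg _))⟩

theorem hasDerivAt_map (A : (Fin 2 → ℂ) ≃L[ℂ] (Fin 2 → ℂ)) {w : ℝ → Fin 2 → ℂ} {w' : Fin 2 → ℂ}
    {x : ℝ} (hw : HasDerivAt w w' x) : HasDerivAt (fun x => A (w x)) (A w') x :=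
  ((A : (Fin 2 → ℂ) →L[ℂ] (Fin 2 → ℂ)).restrictScalars ℝ).hasFDerivAt.comp_hasDerivAt x hw

theorem rot_single : rot (Pi.single 0 1) = Pi.single 1 1 := by
  ext i; fin_cases i <;> simp

theorem rot_symm_single : rot.symm (Pi.single 1 1) = Pi.single 0 1 := by
  ext i; fin_cases i <;> simp

theorem swap_single_zero : swap (Pi.single 0 1) = Pi.single 1 1 := by
  ext i; fin_cases i <;> simp

theorem swap_single_one : swap (Pi.single 1 1) = Pi.single 0 1 := by
  ext i; fin_cases i <;> simp

theorem swap_swap (v : Fin 2 → ℂ) : swap (swap v) = v := by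
  ext i; fin_cases i <;> simp

theorem E_neg_inv (z : ℂ) : E (-z⁻¹) = E z := by
  simp [E, inv_neg]; ring

theorem E_neg_conj (z : ℂ) : E (-conj z) = -conj (E z) := by
  rw [E_neg]; simp [E, map_ofNat]

/-- Conjugation by the right-angle rotation turns Q(z) into Q(-z). It exchanges the diagonal entries
of σ₃, which is compensated by E being odd. -/
theorem jostIntegrand_neg_zero (ε : ℝ) (f f' h : ℝ → ℝ) (z : ℂ) (m : ℝ → Fin 2 → ℂ) (x y : ℝ) :
    jostIntegrand ε f f' h (-z) 1 (fun s => rot (m s)) x y =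
      rot (jostIntegrand ε f f' h z 0 m x y) := by
  ext i
  fin_cases i <;>
    simp [jostIntegrand, expSigma, -Matrix.cons_mulVec, Q, sgn, E_neg, inv_neg] <;> ring

theorem jostIntegrand_neg_one (ε : ℝ) (f f' h : ℝ → ℝ) (z : ℂ) (m : ℝ → Fin 2 → ℂ) (x y : ℝ) :
    jostIntegrand ε f f' h (-z) 0 (fun s => rot.symm (m s)) x y =
      rot.symm (jostIntegrand ε f f' h z 1 m x y) := by
  ext i
  fin_cases i <;>
    simp [jostIntegrand, expSigma, -Matrix.cons_mulVec, Q, sgn, E_neg, inv_neg] <;> ring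

theorem IsJostMinus.map_rot {ε : ℝ} {f f' h : ℝ → ℝ} {z : ℂ} {m : ℝ → Fin 2 → ℂ}
    (hm : IsJostMinus ε f f' h z 0 m) : IsJostMinus ε f f' h (-z) 1 (fun s => rot (m s)) := by
  obtain ⟨h1, ⟨C, hC⟩, h3⟩ := hm
  refine ⟨rot.continuous.comp h1, exists_norm_map_le rot ⟨C, fun x => hC x⟩, fun x => ?_⟩
  simp only [jostIntegrand_neg_zero, ContinuousLinearEquiv.integral_comp_comm]
  conv_lhs => rw [h3 x]
  rw [map_add, map_smul, rot_single]

theorem IsJostMinus.map_rot_symm {ε : ℝ} {f f' h : ℝ → ℝ} {z : ℂ} {m : ℝ → Fin 2 → ℂ}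
    (hm : IsJostMinus ε f f' h z 1 m) : IsJostMinus ε f f' h (-z) 0 (fun s => rot.symm (m s)) := by
  obtain ⟨h1, ⟨C, hC⟩, h3⟩ := hm
  refine ⟨rot.symm.continuous.comp h1, exists_norm_map_le rot.symm ⟨C, fun x => hC x⟩, fun x => ?_⟩
  simp only [jostIntegrand_neg_one, ContinuousLinearEquiv.integral_comp_comm]
  conv_lhs => rw [h3 x]
  rw [map_add, map_smul, rot_symm_single]

theorem IsJostPlus.map_rot {ε : ℝ} {f f' h : ℝ → ℝ} {z : ℂ} {m : ℝ → Fin 2 → ℂ}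
    (hm : IsJostPlus ε f f' h z 0 m) : IsJostPlus ε f f' h (-z) 1 (fun s => rot (m s)) := by
  obtain ⟨h1, ⟨C, hC⟩, h3⟩ := hm
  refine ⟨rot.continuous.comp h1, exists_norm_map_le rot ⟨C, fun x => hC x⟩, fun x => ?_⟩
  simp only [jostIntegrand_neg_zero, ContinuousLinearEquiv.integral_comp_comm]
  conv_lhs => rw [h3 x]
  rw [map_sub, map_smul, rot_single]

theorem IsJostPlus.map_rot_symm {ε : ℝ} {f f' h : ℝ → ℝ} {z : ℂ} {m : ℝ → Fin 2 → ℂ}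
    (hm : IsJostPlus ε f f' h z 1 m) : IsJostPlus ε f f' h (-z) 0 (fun s => rot.symm (m s)) := by
  obtain ⟨h1, ⟨C, hC⟩, h3⟩ := hm
  refine ⟨rot.symm.continuous.comp h1, exists_norm_map_le rot.symm ⟨C, fun x => hC x⟩, fun x => ?_⟩
  simp only [jostIntegrand_neg_one, ContinuousLinearEquiv.integral_comp_comm]
  conv_lhs => rw [h3 x]
  rw [map_sub, map_smul, rot_symm_single]

/-- For the reflected potential, `Q` at y is minus the conjugate by `swap` of the old `Q` at -y. The
minus sign accounts for the reversed orientation of the line, turning an equation from +∞ into one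
from -∞. -/
theorem jostIntegrand_reflect_zero (ε : ℝ) (f f' h : ℝ → ℝ) (z : ℂ) (m : ℝ → Fin 2 → ℂ)
    (x y : ℝ) :
    jostIntegrand ε (fun s => -f (-s)) (fun s => f' (-s)) (fun s => h (-s)) z 1
      (fun s => swap (m (-s))) x y = -swap (jostIntegrand ε f f' h z 0 m (-x) (-y)) := by
  ext i
  fin_cases i <;>
    simp [jostIntegrand, expSigma, -Matrix.cons_mulVec, Q, sgn] <;> ring_nf

theorem jostIntegrand_reflect_one (ε : ℝ) (f f' h : ℝ → ℝ) (z : ℂ) (m : ℝ → Fin 2 → ℂ)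
    (x y : ℝ) :
    jostIntegrand ε (fun s => -f (-s)) (fun s => f' (-s)) (fun s => h (-s)) z 0
      (fun s => swap (m (-s))) x y = -swap (jostIntegrand ε f f' h z 1 m (-x) (-y)) := by
  ext i
  fin_cases i <;>
    simp [jostIntegrand, expSigma, -Matrix.cons_mulVec, Q, sgn] <;> ring_nf

theorem IsJostMinus.reflect {ε : ℝ} {f f' h : ℝ → ℝ} {z : ℂ} {m : ℝ → Fin 2 → ℂ}
    (hm : IsJostMinus ε f f' h z 0 m) :
    IsJostPlus ε (fun s => -f (-s)) (fun s => f' (-s)) (fun s => h (-s)) z 1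
      (fun s => swap (m (-s))) := by
  obtain ⟨h1, ⟨C, hC⟩, h3⟩ := hm
  refine ⟨swap.continuous.comp (h1.comp continuous_neg), exists_norm_map_le swap ⟨C, fun x => hC (-x)⟩, fun x => ?_⟩
  simp only [jostIntegrand_reflect_zero, integral_neg, ContinuousLinearEquiv.integral_comp_comm]
  conv_lhs => rw [h3 (-x)]
  rw [map_add, map_smul, swap_single_zero, smul_neg, sub_neg_eq_add,
    integral_comp_neg_Ioi x fun y => jostIntegrand ε f f' h z 0 m (-x) y]

theorem IsJostPlus.reflect {ε : ℝ} {f f' h : ℝ → ℝ} {z : ℂ} {m : ℝ → Fin 2 → ℂ}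
    (hm : IsJostPlus ε f f' h z 1 m) :
    IsJostMinus ε (fun s => -f (-s)) (fun s => f' (-s)) (fun s => h (-s)) z 0
      (fun s => swap (m (-s))) := by
  obtain ⟨h1, ⟨C, hC⟩, h3⟩ := hm
  refine ⟨swap.continuous.comp (h1.comp continuous_neg), exists_norm_map_le swap ⟨C, fun x => hC (-x)⟩, fun x => ?_⟩
  simp only [jostIntegrand_reflect_one, integral_neg, ContinuousLinearEquiv.integral_comp_comm]
  conv_lhs => rw [h3 (-x)]
  rw [map_sub, map_smul, swap_single_one, smul_neg, ← sub_eq_add_neg,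
    integral_comp_neg_Iic x fun y => jostIntegrand ε f f' h z 1 m (-x) y]

section

variable {f f' h : ℝ → ℝ} {ε : ℝ} {z : ℂ}

theorem NicePotential.isJostMinus_unique (hf : NicePotential f f' h) (hε : 0 < ε) (hz : z ≠ 0)
    (hz' : 0 ≤ z.im) {m m' : ℝ → Fin 2 → ℂ} (hm : IsJostMinus ε f f' h z 0 m)
    (hm' : IsJostMinus ε f f' h z 0 m') : m = m' :=
  (hf.eq_volterraSol hε hz hz' hm).trans (hf.eq_volterraSol hε hz hz' hm').symm

/-- The left side is some solution picked by choice. Pulled back by the inverse rotation it solves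
the equation of m₁⁻, where uniqueness is known. -/
theorem NicePotential.mMinus_one_neg (hf : NicePotential f f' h) (hε : 0 < ε) (hz : z ≠ 0)
    (hz' : 0 ≤ z.im) (x : ℝ) :
    mMinus ε f f' h 1 (-z) x = rot (mMinus ε f f' h 0 z x) := by
  have h1 : IsJostMinus ε f f' h (-z) 1 (mMinus ε f f' h 1 (-z)) :=
    Classical.epsilon_spec ⟨_, (hf.isJostMinus_mMinus_zero hε hz hz').map_rot⟩
  have h2 := h1.map_rot_symm
  rw [neg_neg] at h2
  have h3 := hf.isJostMinus_unique hε hz hz' (hf.isJostMinus_mMinus_zero hε hz hz') h2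
  rw [h3, ContinuousLinearEquiv.apply_symm_apply]

theorem NicePotential.mPlus_one_eq (hf : NicePotential f f' h) (hε : 0 < ε) (hz : z ≠ 0)
    (hz' : 0 ≤ z.im) (x : ℝ) : mPlus ε f f' h 1 z x =
      swap (mMinus ε (fun s => -f (-s)) (fun s => f' (-s)) (fun s => h (-s)) 0 z (-x)) := by
  have h0 := (hf.reflect.isJostMinus_mMinus_zero hε hz hz').reflect
  simp only [neg_neg] at h0
  have h1 : IsJostPlus ε f f' h z 1 (mPlus ε f f' h 1 z) := Classical.epsilon_spec ⟨_, h0⟩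
  have h3 := hf.reflect.isJostMinus_unique hε hz hz'
    (hf.reflect.isJostMinus_mMinus_zero hε hz hz') h1.reflect
  rw [h3, swap_swap, neg_neg]

theorem NicePotential.isJostPlus_mPlus_one (hf : NicePotential f f' h) (hε : 0 < ε) (hz : z ≠ 0)
    (hz' : 0 ≤ z.im) : IsJostPlus ε f f' h z 1 (mPlus ε f f' h 1 z) := by
  have h0 := (hf.reflect.isJostMinus_mMinus_zero hε hz hz').reflect
  simp only [neg_neg] at h0
  exact Classical.epsilon_spec ⟨_, h0⟩

theorem NicePotential.isJostPlus_unique (hf : NicePotential f f' h) (hε : 0 < ε) (hz : z ≠ 0)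
    (hz' : 0 ≤ z.im) {m m' : ℝ → Fin 2 → ℂ} (hm : IsJostPlus ε f f' h z 1 m)
    (hm' : IsJostPlus ε f f' h z 1 m') : m = m' := by
  have h1 := hf.reflect.isJostMinus_unique hε hz hz' hm.reflect hm'.reflect
  funext x
  have h2 := congrFun h1 (-x)
  rw [neg_neg] at h2
  exact swap.injective h2

theorem NicePotential.mPlus_zero_neg (hf : NicePotential f f' h) (hε : 0 < ε) (hz : z ≠ 0)
    (hz' : 0 ≤ z.im) (x : ℝ) :
    mPlus ε f f' h 0 (-z) x = rot.symm (mPlus ε f f' h 1 z x) := by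
  have h1 : IsJostPlus ε f f' h (-z) 0 (mPlus ε f f' h 0 (-z)) :=
    Classical.epsilon_spec ⟨_, (hf.isJostPlus_mPlus_one hε hz hz').map_rot_symm⟩
  have h2 := h1.map_rot
  rw [neg_neg] at h2
  have h3 := hf.isJostPlus_unique hε hz hz' (hf.isJostPlus_mPlus_one hε hz hz') h2
  rw [h3, ContinuousLinearEquiv.symm_apply_apply]

/-! Symmetries of the eigenvalue equation. -/

theorem SolvesLax.map_rot {w : ℝ → Fin 2 → ℂ} (hw : SolvesLax ε f f' h z w) :
    SolvesLax ε f f' h (-z) (fun x => rot (w x)) := fun x => by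
  refine (hasDerivAt_map rot (hw x)).congr_deriv ?_
  ext i
  fin_cases i <;> simp [lax, Q, sgn, E_neg, inv_neg] <;>
    first | ring1 | (left; ring1)

theorem SolvesLax.map_rot_symm {w : ℝ → Fin 2 → ℂ} (hw : SolvesLax ε f f' h z w) :
    SolvesLax ε f f' h (-z) (fun x => rot.symm (w x)) := fun x => by
  refine (hasDerivAt_map rot.symm (hw x)).congr_deriv ?_
  ext i
  fin_cases i <;> simp [lax, Q, sgn, E_neg, inv_neg] <;>
    first | ring1 | (left; ring1)

theorem SolvesLax.reflect {w : ℝ → Fin 2 → ℂ} (hw : SolvesLax ε f f' h z w) :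
    SolvesLax ε (fun s => -f (-s)) (fun s => f' (-s)) (fun s => h (-s)) z
      (fun x => swap (w (-x))) := fun x => by
  refine (hasDerivAt_map swap ((hw (-x)).scomp x (hasDerivAt_neg x))).congr_deriv ?_
  ext i
  fin_cases i <;> simp [lax, Q, sgn] <;> ring1

/-- The potential is real, so E and Q at -z̄ are minus the conjugates of E and Q at z; the sign is
absorbed by the conjugate of 1/(4iε). -/
theorem SolvesLax.map_conj {w : ℝ → Fin 2 → ℂ} (hw : SolvesLax ε f f' h z w) :
    SolvesLax ε f f' h (-conj z) (fun x i => conj (w x i)) := fun x => by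
  rw [hasDerivAt_pi]
  intro i
  have h1 := (Complex.conjCLE : ℂ →L[ℝ] ℂ).hasFDerivAt.comp_hasDerivAt x (hasDerivAt_pi.1 (hw x) i)
  refine h1.congr_deriv ?_
  fin_cases i <;> simp [lax, Q, sgn, E, inv_neg, map_ofNat,
    -Complex.ofReal_cos, -Complex.ofReal_sin] <;> ring

theorem SolvesLax.smul {w : ℝ → Fin 2 → ℂ} (hw : SolvesLax ε f f' h z w) (c : ℂ) :
    SolvesLax ε f f' h z (fun x => c • w x) := fun x => by
  refine ((hw x).const_smul c).congr_deriv ?_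
  rw [Matrix.mulVec_smul, smul_comm]

theorem phase_neg (ε : ℝ) (z : ℂ) (x : ℝ) : phase ε (-z) 1 x = phase ε z 0 x := by
  simp [phase, E_neg, sgn]

theorem phase_neg' (ε : ℝ) (z : ℂ) (x : ℝ) : phase ε (-z) 0 x = phase ε z 1 x := by
  simp [phase, E_neg, sgn]

theorem phase_neg_conj (ε : ℝ) (z : ℂ) (k : Fin 2) (x : ℝ) :
    phase ε (-conj z) k x = conj (phase ε z k x) := by
  rw [phase, phase, ← Complex.exp_conj, E_neg_conj]
  fin_cases k <;> simp [sgn]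

theorem IsJost.map_rot {l : Filter ℝ} {w : ℝ → Fin 2 → ℂ} (hw : IsJost ε f f' h z 0 l w) :
    IsJost ε f f' h (-z) 1 l (fun x => rot (w x)) := by
  refine ⟨hw.1.map_rot, ?_⟩
  have := (rot.continuous.tendsto _).comp hw.2
  rw [rot_single] at this
  refine this.congr fun x => ?_
  rw [Function.comp_apply, map_smul, phase_neg]

theorem IsJost.map_rot_symm {l : Filter ℝ} {w : ℝ → Fin 2 → ℂ} (hw : IsJost ε f f' h z 1 l w) :
    IsJost ε f f' h (-z) 0 l (fun x => rot.symm (w x)) := by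
  refine ⟨hw.1.map_rot_symm, ?_⟩
  have := (rot.symm.continuous.tendsto _).comp hw.2
  rw [rot_symm_single] at this
  refine this.congr fun x => ?_
  rw [Function.comp_apply, map_smul, phase_neg']

theorem phase_reflect (ε : ℝ) (z : ℂ) (x : ℝ) : phase ε z 1 x = phase ε z 0 (-x) := by
  simp [phase, sgn]

theorem IsJost.reflect {w : ℝ → Fin 2 → ℂ} (hw : IsJost ε f f' h z 0 atBot w) :
    IsJost ε (fun s => -f (-s)) (fun s => f' (-s)) (fun s => h (-s)) z 1 atTop
      (fun x => swap (w (-x))) := by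
  refine ⟨hw.1.reflect, ?_⟩
  have := ((swap.continuous.tendsto _).comp hw.2).comp tendsto_neg_atTop_atBot
  rw [swap_single_zero] at this
  refine this.congr fun x => ?_
  rw [Function.comp_apply, Function.comp_apply, map_smul, phase_reflect]

theorem IsJost.reflect' {w : ℝ → Fin 2 → ℂ} (hw : IsJost ε f f' h z 1 atTop w) :
    IsJost ε (fun s => -f (-s)) (fun s => f' (-s)) (fun s => h (-s)) z 0 atBot
      (fun x => swap (w (-x))) := by
  refine ⟨hw.1.reflect, ?_⟩
  have := ((swap.continuous.tendsto _).comp hw.2).comp tendsto_neg_atBot_atTop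
  rw [swap_single_one] at this
  refine this.congr fun x => ?_
  rw [Function.comp_apply, Function.comp_apply, map_smul, phase_reflect, neg_neg]

theorem IsJost.map_conj {l : Filter ℝ} {k : Fin 2} {w : ℝ → Fin 2 → ℂ}
    (hw : IsJost ε f f' h z k l w) :
    IsJost ε f f' h (-conj z) k l (fun x i => conj (w x i)) := by
  refine ⟨hw.1.map_conj, tendsto_pi_nhds.2 fun i => ?_⟩
  have := (Complex.continuous_conj.tendsto _).comp (tendsto_pi_nhds.1 hw.2 i)
  have e : conj ((Pi.single k 1 : Fin 2 → ℂ) i) = (Pi.single k 1 : Fin 2 → ℂ) i := by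
    rw [Pi.single_apply]; split_ifs <;> simp
  rw [e] at this
  refine this.congr fun x => ?_
  simp [phase_neg_conj]

/-! The four Jost solutions are characterized by the eigenvalue equation and their asymptotics. -/

theorem NicePotential.jPlus_one_eq (hf : NicePotential f f' h) (hε : 0 < ε) (hz : z ≠ 0)
    (hz' : 0 ≤ z.im) (x : ℝ) : jPlus ε f f' h 1 z x =
      swap (jMinus ε (fun s => -f (-s)) (fun s => f' (-s)) (fun s => h (-s)) 0 z (-x)) := by
  rw [jPlus, jMinus, map_smul, hf.mPlus_one_eq hε hz hz']
  simp [sgn]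

theorem NicePotential.jMinus_one_neg (hf : NicePotential f f' h) (hε : 0 < ε) (hz : z ≠ 0)
    (hz' : 0 ≤ z.im) (x : ℝ) : jMinus ε f f' h 1 (-z) x = rot (jMinus ε f f' h 0 z x) := by
  rw [jMinus, jMinus, map_smul, hf.mMinus_one_neg hε hz hz']
  simp [sgn, E_neg]

theorem NicePotential.jPlus_zero_neg (hf : NicePotential f f' h) (hε : 0 < ε) (hz : z ≠ 0)
    (hz' : 0 ≤ z.im) (x : ℝ) : jPlus ε f f' h 0 (-z) x = rot.symm (jPlus ε f f' h 1 z x) := by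
  rw [jPlus, jPlus, map_smul, hf.mPlus_zero_neg hε hz hz']
  simp [sgn, E_neg]

theorem NicePotential.isJost_jPlus_one (hf : NicePotential f f' h) (hε : 0 < ε) (hz : z ≠ 0)
    (hz' : 0 ≤ z.im) : IsJost ε f f' h z 1 atTop (jPlus ε f f' h 1 z) := by
  have h1 := (hf.reflect.isJost_jMinus_zero hε hz hz').reflect
  simp only [neg_neg] at h1
  rwa [funext (hf.jPlus_one_eq hε hz hz')]

theorem NicePotential.eq_jPlus_one (hf : NicePotential f f' h) (hε : 0 < ε) (hz : z ≠ 0)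
    (hz' : 0 ≤ z.im) {w : ℝ → Fin 2 → ℂ} (hw : IsJost ε f f' h z 1 atTop w) :
    w = jPlus ε f f' h 1 z := by
  have h1 := hf.reflect.eq_jMinus_zero hε hz hz' hw.reflect'
  funext x
  rw [hf.jPlus_one_eq hε hz hz', ← h1, swap_swap, neg_neg]

theorem NicePotential.isJost_jMinus_one (hf : NicePotential f f' h) (hε : 0 < ε) (hz : z ≠ 0)
    (hz' : z.im ≤ 0) : IsJost ε f f' h z 1 atBot (jMinus ε f f' h 1 z) := by
  have hn : 0 ≤ (-z).im := by simpa using hz'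
  have h1 := (hf.isJost_jMinus_zero hε (neg_ne_zero.2 hz) hn).map_rot
  rw [← funext (hf.jMinus_one_neg hε (neg_ne_zero.2 hz) hn)] at h1
  simpa only [neg_neg] using h1

theorem NicePotential.isJost_jPlus_zero (hf : NicePotential f f' h) (hε : 0 < ε) (hz : z ≠ 0)
    (hz' : z.im ≤ 0) : IsJost ε f f' h z 0 atTop (jPlus ε f f' h 0 z) := by
  have hn : 0 ≤ (-z).im := by simpa using hz'
  have h1 := (hf.isJost_jPlus_one hε (neg_ne_zero.2 hz) hn).map_rot_symm
  rw [← funext (hf.jPlus_zero_neg hε (neg_ne_zero.2 hz) hn)] at h1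
  simpa only [neg_neg] using h1

theorem NicePotential.eq_jPlus_zero (hf : NicePotential f f' h) (hε : 0 < ε) (hz : z ≠ 0)
    (hz' : z.im ≤ 0) {w : ℝ → Fin 2 → ℂ} (hw : IsJost ε f f' h z 0 atTop w) :
    w = jPlus ε f f' h 0 z := by
  have hn : 0 ≤ (-z).im := by simpa using hz'
  have h1 := hf.eq_jPlus_one hε (neg_ne_zero.2 hz) hn hw.map_rot
  funext x
  have h2 := hf.jPlus_zero_neg hε (neg_ne_zero.2 hz) hn x
  rw [neg_neg] at h2
  rw [h2, ← h1, ContinuousLinearEquiv.symm_apply_apply]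

/-! The gauge transformation relating `z` and `-1/z`. -/

/-- The rotation by the angle `θ / 2`. -/
def halfRotation (θ : ℝ) : Matrix (Fin 2) (Fin 2) ℂ :=
  !![(Real.cos (θ / 2) : ℂ), -(Real.sin (θ / 2) : ℂ);
    (Real.sin (θ / 2) : ℂ), (Real.cos (θ / 2) : ℂ)]

theorem continuous_halfRotation : Continuous halfRotation := by
  refine continuous_matrix fun i j => ?_
  fin_cases i <;> fin_cases j <;> simp [halfRotation, -Complex.ofReal_cos, -Complex.ofReal_sin] <;>
    fun_prop

/-- The coefficient matrix is zσ₃ - z⁻¹(cos f σ₃ + sin f σ₁) + ε(f' + h)σ₂. Conjugation by the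
rotation through f/2 straightens the second term into σ₃ and bends the first, exchanging z and -1/z
with f replaced by -f. Differentiating the rotation shifts f' + h by -2f', to -f' + h. -/
theorem SolvesLax.gauge (hε : ε ≠ 0) (hz : z ≠ 0) (hf : ∀ x, HasDerivAt f (f' x) x)
    {w : ℝ → Fin 2 → ℂ}
    (hw : SolvesLax ε (fun x => -f x) (fun x => -f' x) h (-z⁻¹) w) :
    SolvesLax ε f f' h z (fun x => (halfRotation (f x)).mulVec (w x)) := fun x => by
  have hc : HasDerivAt (fun x => (Real.cos (f x / 2) : ℂ)) ((-Real.sin (f x / 2) * (f' x / 2) : ℝ) : ℂ) x :=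
    ((hf x).div_const 2).cos.ofReal_comp
  have hs : HasDerivAt (fun x => (Real.sin (f x / 2) : ℂ)) ((Real.cos (f x / 2) * (f' x / 2) : ℝ) : ℂ) x :=
    ((hf x).div_const 2).sin.ofReal_comp
  have hw0 := hasDerivAt_pi.1 (hw x) 0
  have hw1 := hasDerivAt_pi.1 (hw x) 1
  have hεc : (ε : ℂ) ≠ 0 := by exact_mod_cast hε
  -- All trigonometric functions are expressed through the half angle; what remains is a polynomial
  -- identity modulo sin² + cos² = 1 and i² = -1.
  have e1 : Real.cos (f x) = Real.cos (f x / 2) ^ 2 - Real.sin (f x / 2) ^ 2 := by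
    rw [← Real.cos_two_mul']; congr 1; ring
  have e2 : Real.sin (f x) = 2 * Real.sin (f x / 2) * Real.cos (f x / 2) := by
    rw [← Real.sin_two_mul]; congr 1; ring
  have e3 : (Real.sin (f x / 2) : ℂ) ^ 2 = 1 - (Real.cos (f x / 2) : ℂ) ^ 2 := by
    exact_mod_cast Real.sin_sq (f x / 2)
  rw [hasDerivAt_pi]
  intro i
  fin_cases i
  · have h1 := (hc.mul hw0).sub (hs.mul hw1)
    have h2 : (fun x => (halfRotation (f x)).mulVec (w x) 0) = fun x =>
        (Real.cos (f x / 2) : ℂ) * w x 0 - (Real.sin (f x / 2) : ℂ) * w x 1 := by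
      funext y
      rw [mulVec_apply_two]
      simp [halfRotation, -Complex.ofReal_cos, -Complex.ofReal_sin]
      ring
    simp only [Fin.zero_eta, h2]
    refine h1.congr_deriv ?_
    simp only [Pi.smul_apply, mulVec_apply_two]
    simp [-Complex.ofReal_cos, -Complex.ofReal_sin, E, lax, Q, sgn, halfRotation,
      Real.cos_neg, Real.sin_neg, e1, e2]
    generalize (Real.cos (f x / 2) : ℂ) = c at *
    generalize (Real.sin (f x / 2) : ℂ) = s at *
    field_simp
    linear_combination (Complex.I * (2 * z ^ 2 * s * w x 1 - 2 * s * w x 1 - 2 * c * z ^ 2 * w x 0 -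
      2 * c * w x 0)) * e3 - (4 * s * f' x * w x 0 * ε * z + 4 * c * f' x * w x 1 * ε * z) * Complex.I_sq
  · have h1 := (hs.mul hw0).add (hc.mul hw1)
    have h2 : (fun x => (halfRotation (f x)).mulVec (w x) 1) = fun x =>
        (Real.sin (f x / 2) : ℂ) * w x 0 + (Real.cos (f x / 2) : ℂ) * w x 1 := by
      funext y
      rw [mulVec_apply_two]
      simp [halfRotation, -Complex.ofReal_cos, -Complex.ofReal_sin]
    simp only [Fin.mk_one, h2]
    refine h1.congr_deriv ?_
    simp only [Pi.smul_apply, mulVec_apply_two]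
    simp [-Complex.ofReal_cos, -Complex.ofReal_sin, E, lax, Q, sgn, halfRotation,
      Real.cos_neg, Real.sin_neg, e1, e2]
    generalize (Real.cos (f x / 2) : ℂ) = c at *
    generalize (Real.sin (f x / 2) : ℂ) = s at *
    field_simp
    linear_combination (Complex.I * (2 * c * z ^ 2 * w x 1 + 2 * c * w x 1 + 2 * z ^ 2 * s * w x 0 -
      2 * s * w x 0)) * e3 + (4 * c * f' x * w x 0 * ε * z - 4 * s * f' x * w x 1 * ε * z) * Complex.I_sq

end

/-! ### Wronskians -/

theorem det_ofCols (a b : Fin 2 → ℂ) : (ofCols a b).det = a 0 * b 1 - b 0 * a 1 := by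
  simp [ofCols, Matrix.det_fin_two]

theorem det_ofCols_smul (c d : ℂ) (a b : Fin 2 → ℂ) :
    (ofCols (c • a) (d • b)).det = c * d * (ofCols a b).det := by
  simp only [det_ofCols, Pi.smul_apply, smul_eq_mul]; ring

theorem continuous_ofCols : Continuous fun q : (Fin 2 → ℂ) × (Fin 2 → ℂ) => ofCols q.1 q.2 := by
  refine continuous_matrix fun i j => ?_
  fin_cases i <;> fin_cases j <;> simp [ofCols] <;> fun_prop

theorem continuous_det_ofCols :
    Continuous fun q : (Fin 2 → ℂ) × (Fin 2 → ℂ) => (ofCols q.1 q.2).det := by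
  simp only [det_ofCols]
  fun_prop

theorem hasDerivAt_det_ofCols {v w : ℝ → Fin 2 → ℂ} {v' w' : Fin 2 → ℂ} {x : ℝ}
    (hv : HasDerivAt v v' x) (hw : HasDerivAt w w' x) :
    HasDerivAt (fun x => (ofCols (v x) (w x)).det)
      ((ofCols v' (w x)).det + (ofCols (v x) w').det) x := by
  simp only [det_ofCols]
  have hv' := hasDerivAt_pi.1 hv
  have hw' := hasDerivAt_pi.1 hw
  exact (((hv' 0).mul (hw' 1)).sub ((hw' 0).mul (hv' 1))).congr_deriv (by ring)

theorem det_ofCols_mulVec_add {M : Matrix (Fin 2) (Fin 2) ℂ} (hM : M 0 0 + M 1 1 = 0)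
    (v w : Fin 2 → ℂ) : (ofCols (M.mulVec v) w).det + (ofCols v (M.mulVec w)).det = 0 := by
  simp only [det_ofCols, mulVec_apply_two]
  linear_combination (v 0 * w 1 - v 1 * w 0) * hM

section

variable {f f' h : ℝ → ℝ} {ε : ℝ} {z : ℂ}

/-- The coefficient matrix has trace zero, so Wronskians are constant by Abel's identity. -/
theorem SolvesLax.det_eq {v w : ℝ → Fin 2 → ℂ} (hv : SolvesLax ε f f' h z v)
    (hw : SolvesLax ε f f' h z w) (x y : ℝ) :
    (ofCols (v x) (w x)).det = (ofCols (v y) (w y)).det := by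
  have hd : ∀ x, HasDerivAt (fun x => (ofCols (v x) (w x)).det) 0 x := fun x => by
    refine (hasDerivAt_det_ofCols (hv x) (hw x)).congr_deriv ?_
    simp only [← Matrix.smul_mulVec]
    refine det_ofCols_mulVec_add ?_ _ _
    simp [lax, Q, sgn]
    ring
  exact is_const_of_deriv_eq_zero (fun x => (hd x).differentiableAt) (fun x => (hd x).deriv) x y

/-- The Wronskian is constant and the two phases have product 1, so its value is that of the
normalized limits, det(e₁, e₂) = 1. -/
theorem SolvesLax.det_eq_of_tendsto {v w : ℝ → Fin 2 → ℂ} (hv : SolvesLax ε f f' h z v)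
    (hw : SolvesLax ε f f' h z w) {l : Filter ℝ} [l.NeBot]
    (hvl : Tendsto (fun x => phase ε z 0 x • v x) l (𝓝 (Pi.single 0 1)))
    (hwl : Tendsto (fun x => phase ε z 1 x • w x) l (𝓝 (Pi.single 1 1))) (x : ℝ) :
    (ofCols (v x) (w x)).det = 1 := by
  have h1 := (continuous_det_ofCols.tendsto _).comp (hvl.prodMk_nhds hwl)
  have h2 : (fun y => (ofCols (v x) (w x)).det) =
      (fun q : (Fin 2 → ℂ) × (Fin 2 → ℂ) => (ofCols q.1 q.2).det) ∘
      fun y => (phase ε z 0 y • v y, phase ε z 1 y • w y) := by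
    funext y
    rw [Function.comp_apply, det_ofCols_smul, phase_zero_mul_phase_one, one_mul,
      hv.det_eq hw x y]
  rw [← h2] at h1
  have h3 := tendsto_nhds_unique tendsto_const_nhds h1
  rw [h3]
  simp [det_ofCols]

/-- The Wronskian `S₂₂` can be computed at any point. -/
theorem NicePotential.det_j_eq_S22 (hf : NicePotential f f' h) (hε : 0 < ε) (hz : z ≠ 0)
    (hz' : 0 ≤ z.im) (x : ℝ) :
    (ofCols (jMinus ε f f' h 0 z x) (jPlus ε f f' h 1 z x)).det = S22 ε f f' h z :=
  (hf.isJost_jMinus_zero hε hz hz').1.det_eq (hf.isJost_jPlus_one hε hz hz').1 x 0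

theorem NicePotential.det_m_eq_S22 (hf : NicePotential f f' h) (hε : 0 < ε) (hz : z ≠ 0)
    (hz' : 0 ≤ z.im) (x : ℝ) :
    (ofCols (mMinus ε f f' h 0 z x) (mPlus ε f f' h 1 z x)).det = S22 ε f f' h z := by
  rw [← phase_smul_jMinus, ← phase_smul_jPlus, det_ofCols_smul, phase_zero_mul_phase_one, one_mul,
    hf.det_j_eq_S22 hε hz hz']

theorem NicePotential.S11_neg (hf : NicePotential f f' h) (hε : 0 < ε) (hz : z ≠ 0)
    (hz' : 0 ≤ z.im) : S11 ε f f' h (-z) = S22 ε f f' h z := by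
  rw [S11, S22, hf.jPlus_zero_neg hε hz hz', hf.jMinus_one_neg hε hz hz']
  simp [det_ofCols]; ring

/-! Dependence on the spectral parameter. -/

theorem ne_zero_of_im_pos (hz : 0 < z.im) : z ≠ 0 := fun h0 => by simp [h0] at hz

theorem NicePotential.continuousOn_mPlus_one (hf : NicePotential f f' h) (hε : 0 < ε) (x : ℝ) :
    ContinuousOn (fun z => mPlus ε f f' h 1 z x) {z | 0 ≤ z.im ∧ z ≠ 0} :=
  (swap.continuous.comp_continuousOn (hf.reflect.continuousOn_mMinus_zero hε (-x))).congr
    fun _ hz => hf.mPlus_one_eq hε hz.2 hz.1 x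

theorem NicePotential.differentiableOn_mPlus_one (hf : NicePotential f f' h) (hε : 0 < ε)
    (x : ℝ) : DifferentiableOn ℂ (fun z => mPlus ε f f' h 1 z x) {z | 0 < z.im} := by
  refine ((swap : (Fin 2 → ℂ) →L[ℂ] (Fin 2 → ℂ)).differentiable.comp_differentiableOn
    (hf.reflect.differentiableOn_mMinus_zero hε (-x))).congr fun z hz => ?_
  exact hf.mPlus_one_eq hε (ne_zero_of_im_pos hz) (le_of_lt hz) x

theorem NicePotential.tendsto_mPlus_one_cobounded (hf : NicePotential f f' h) (hε : 0 < ε)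
    (x : ℝ) : Tendsto (fun z => mPlus ε f f' h 1 z x)
      (Bornology.cobounded ℂ ⊓ 𝓟 {z | 0 ≤ z.im}) (𝓝 (Pi.single 1 1)) := by
  have h1 := (swap.continuous.tendsto _).comp (hf.reflect.tendsto_mMinus_zero_cobounded hε (-x))
  rw [swap_single_zero] at h1
  have h2 : ∀ᶠ z : ℂ in Bornology.cobounded ℂ, 0 < ‖z‖ :=
    tendsto_norm_cobounded_atTop.eventually_gt_atTop 0
  refine h1.congr' ?_
  filter_upwards [h2.filter_mono inf_le_left, mem_inf_of_right (mem_principal_self _)] with z a b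
  exact (hf.mPlus_one_eq hε (norm_pos_iff.1 a) b x).symm

theorem NicePotential.continuousOn_S22 (hf : NicePotential f f' h) (hε : 0 < ε) :
    ContinuousOn (S22 ε f f' h) {z | 0 ≤ z.im ∧ z ≠ 0} :=
  (continuous_det_ofCols.comp_continuousOn ((hf.continuousOn_mMinus_zero hε 0).prodMk
    (hf.continuousOn_mPlus_one hε 0))).congr fun _ hz => (hf.det_m_eq_S22 hε hz.2 hz.1 0).symm

theorem NicePotential.differentiableOn_S22 (hf : NicePotential f f' h) (hε : 0 < ε) :
    DifferentiableOn ℂ (S22 ε f f' h) {z | 0 < z.im} := by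
  have h1 := differentiableOn_pi.1 (hf.differentiableOn_mMinus_zero hε 0)
  have h2 := differentiableOn_pi.1 (hf.differentiableOn_mPlus_one hε 0)
  refine (((h1 0).mul (h2 1)).sub ((h2 0).mul (h1 1))).congr fun z hz => ?_
  rw [← hf.det_m_eq_S22 hε (ne_zero_of_im_pos hz) (le_of_lt hz) 0, det_ofCols]
  rfl

theorem NicePotential.tendsto_S22_cobounded (hf : NicePotential f f' h) (hε : 0 < ε) :
    Tendsto (S22 ε f f' h) (Bornology.cobounded ℂ ⊓ 𝓟 {z | 0 ≤ z.im}) (𝓝 1) := by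
  have h1 := (continuous_det_ofCols.tendsto _).comp
    ((hf.tendsto_mMinus_zero_cobounded hε 0).prodMk_nhds (hf.tendsto_mPlus_one_cobounded hε 0))
  have h0 : (ofCols (Pi.single 0 1) (Pi.single 1 1)).det = 1 := by simp [det_ofCols]
  simp only [h0] at h1
  have h2 : ∀ᶠ z : ℂ in Bornology.cobounded ℂ, 0 < ‖z‖ :=
    tendsto_norm_cobounded_atTop.eventually_gt_atTop 0
  refine h1.congr' ?_
  filter_upwards [h2.filter_mono inf_le_left, mem_inf_of_right (mem_principal_self _)] with z a b
  exact hf.det_m_eq_S22 hε (norm_pos_iff.1 a) b 0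

/-! The limit `z → 0`. -/

/-- Integrability of f' gives the limit of f, and integrability of 1 - cos f then leaves only limits
in 2πℤ. -/
theorem cos_eq_one_of_tendsto_atBot (hf : NicePotential f f' h) :
    ∃ l, Tendsto f atBot (𝓝 l) ∧ Real.cos l = 1 := by
  have h1 := tendsto_limUnder_of_hasDerivAt_of_integrableOn_Iic (a := 0)
    (fun x _ => hf.hasDerivAt x) hf.integrable_deriv.integrableOn
  refine ⟨_, h1, ?_⟩
  have h2 := (Real.continuous_cos.tendsto _).comp h1
  have h3 := hf.integrable_one_sub_cos.integrableAtFilter atBot |>.eq_zero_of_tendsto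
    (fun s hs => by
      obtain ⟨a, ha⟩ := mem_atBot_sets.1 hs
      exact top_le_iff.1 (Real.volume_Iic (a := a) ▸ measure_mono fun x hx => ha x hx))
    (tendsto_const_nhds.sub h2)
  linarith

/-- The angle is a multiple of 2π, so the half-angle rotation is σ times the identity with σ =
cos(l/2) = ±1. -/
theorem halfRotation_mulVec_of_cos_eq_one {l : ℝ} (hl : Real.cos l = 1) :
    ∃ σ : ℂ, σ * σ = 1 ∧ ∀ v, σ • (halfRotation l).mulVec v = v := by
  have h1 : Real.sin (l / 2) ^ 2 = 0 := by
    have := Real.cos_two_mul' (l / 2)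
    have h2 := Real.sin_sq_add_cos_sq (l / 2)
    rw [mul_div_cancel₀ l two_ne_zero, hl] at this
    linarith
  have h2 : (Real.sin (l / 2) : ℂ) = 0 := by
    exact_mod_cast pow_eq_zero_iff two_ne_zero |>.1 h1
  have h3 : (Real.cos (l / 2) : ℂ) * (Real.cos (l / 2) : ℂ) = 1 := by
    have := Real.sin_sq_add_cos_sq (l / 2)
    rw [h1, zero_add, sq] at this
    exact_mod_cast this
  refine ⟨Real.cos (l / 2), h3, fun v => ?_⟩
  ext i
  rw [Pi.smul_apply, mulVec_apply_two, smul_eq_mul]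
  fin_cases i
  · simp only [halfRotation, h2, Fin.zero_eta, Matrix.of_apply, Matrix.cons_val', Matrix.cons_val_zero,
      Matrix.cons_val_one, Matrix.cons_val_fin_one]
    linear_combination v 0 * h3
  · simp only [halfRotation, h2, Fin.mk_one, Matrix.of_apply, Matrix.cons_val', Matrix.cons_val_zero,
      Matrix.cons_val_one, Matrix.cons_val_fin_one]
    linear_combination v 1 * h3

/-- E takes the same value at z and -1/z, so the phases agree. The only defect of the asymptotics is
the limiting half rotation, a sign that σ cancels. -/
theorem IsJost.gauge (hε : 0 < ε) (hz : z ≠ 0) (hf : ∀ x, HasDerivAt f (f' x) x)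
    {l : Filter ℝ} {a : ℝ} (hl : Tendsto f l (𝓝 a)) {σ : ℂ}
    (hσ : ∀ v, σ • (halfRotation a).mulVec v = v) {k : Fin 2} {w : ℝ → Fin 2 → ℂ}
    (hw : IsJost ε (fun x => -f x) (fun x => -f' x) h (-z⁻¹) k l w) :
    IsJost ε f f' h z k l (fun x => σ • (halfRotation (f x)).mulVec (w x)) := by
  refine ⟨(hw.1.gauge hε.ne' hz hf).smul σ, ?_⟩
  have hc : Continuous fun q : Matrix (Fin 2) (Fin 2) ℂ × (Fin 2 → ℂ) => σ • q.1.mulVec q.2 :=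
    (continuous_fst.matrix_mulVec continuous_snd).const_smul σ
  have h1 := (hc.tendsto _).comp
    (((continuous_halfRotation.tendsto a).comp hl).prodMk_nhds hw.2)
  simp only [hσ] at h1
  refine h1.congr fun x => ?_
  have : phase ε (-z⁻¹) k x = phase ε z k x := by rw [phase, phase, E_neg_inv]
  simp only [Function.comp_apply, this, Matrix.mulVec_smul]
  rw [smul_comm]

theorem im_neg_inv_nonneg (hz : 0 ≤ z.im) : 0 ≤ (-z⁻¹).im := by
  simp only [Complex.neg_im, Complex.inv_im, neg_div, neg_neg]
  exact div_nonneg hz (Complex.normSq_nonneg z)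

/-- The gauge transformation of the Jost solutions, with the same sign for all `z`. -/
theorem NicePotential.exists_gauge_mMinus (hf : NicePotential f f' h) (hε : 0 < ε) :
    ∃ σ : ℂ, σ * σ = 1 ∧ ∀ z : ℂ, z ≠ 0 → 0 ≤ z.im → ∀ x, mMinus ε f f' h 0 z x =
      σ • (halfRotation (f x)).mulVec
        (mMinus ε (fun x => -f x) (fun x => -f' x) h 0 (-z⁻¹) x) := by
  obtain ⟨l, hl, hl1⟩ := cos_eq_one_of_tendsto_atBot hf
  obtain ⟨σ, hσ, hσ'⟩ := halfRotation_mulVec_of_cos_eq_one hl1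
  refine ⟨σ, hσ, fun z hz hz' x => ?_⟩
  have h1 := (hf.neg.isJost_jMinus_zero hε (neg_ne_zero.2 (inv_ne_zero hz))
    (im_neg_inv_nonneg hz')).gauge hε hz hf.hasDerivAt hl hσ'
  have h2 := congrFun (hf.eq_jMinus_zero hε hz hz' h1) x
  have : phase ε (-z⁻¹) 0 x = phase ε z 0 x := by rw [phase, phase, E_neg_inv]
  rw [← phase_smul_jMinus, ← phase_smul_jMinus, ← h2, this, Matrix.mulVec_smul, smul_comm]

theorem NicePotential.exists_gauge_mPlus (hf : NicePotential f f' h) (hε : 0 < ε) :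
    ∃ σ : ℂ, σ * σ = 1 ∧ ∀ z : ℂ, z ≠ 0 → 0 ≤ z.im → ∀ x, mPlus ε f f' h 1 z x =
      σ • (halfRotation (f x)).mulVec
        (mPlus ε (fun x => -f x) (fun x => -f' x) h 1 (-z⁻¹) x) := by
  obtain ⟨l, hl, hl1⟩ := cos_eq_one_of_tendsto_atBot hf.reflect
  have hl' : Tendsto f atTop (𝓝 (-l)) := by
    have := (hl.comp tendsto_neg_atTop_atBot).neg
    simpa [Function.comp_def] using this
  obtain ⟨σ, hσ, hσ'⟩ := halfRotation_mulVec_of_cos_eq_one (l := -l) (by rwa [Real.cos_neg])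
  refine ⟨σ, hσ, fun z hz hz' x => ?_⟩
  have h1 := (hf.neg.isJost_jPlus_one hε (neg_ne_zero.2 (inv_ne_zero hz))
    (im_neg_inv_nonneg hz')).gauge hε hz hf.hasDerivAt hl' hσ'
  have h2 := congrFun (hf.eq_jPlus_one hε hz hz' h1) x
  have : phase ε (-z⁻¹) 1 x = phase ε z 1 x := by rw [phase, phase, E_neg_inv]
  rw [← phase_smul_jPlus, ← phase_smul_jPlus, ← h2, this, Matrix.mulVec_smul, smul_comm]

theorem tendsto_neg_inv_cobounded :
    Tendsto (fun z : ℂ => -z⁻¹) (𝓝[{z | 0 ≤ z.im ∧ z ≠ 0}] 0)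
      (Bornology.cobounded ℂ ⊓ 𝓟 {z | 0 ≤ z.im}) := by
  refine tendsto_inf.2 ⟨?_, tendsto_principal.2 ?_⟩
  · have h1 : Tendsto (fun z : ℂ => -z⁻¹) (𝓝[≠] 0) (Bornology.cobounded ℂ) :=
      tendsto_neg_cobounded.comp tendsto_inv₀_nhdsNE_zero
    exact h1.mono_left (nhdsWithin_mono _ fun z hz => hz.2)
  · filter_upwards [self_mem_nhdsWithin] with z hz
    exact im_neg_inv_nonneg hz.1

/-- As z → 0 in the closed upper half-plane, -1/z → ∞ there, where the column for the potential -f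
tends to e₁; only the gauge factor remains. -/
theorem NicePotential.exists_tendsto_mMinus_nhds_zero (hf : NicePotential f f' h) (hε : 0 < ε) :
    ∃ σ : ℂ, σ * σ = 1 ∧ ∀ x, Tendsto (fun z => mMinus ε f f' h 0 z x)
      (𝓝[{z | 0 ≤ z.im ∧ z ≠ 0}] 0) (𝓝 (σ • (halfRotation (f x)).mulVec (Pi.single 0 1))) := by
  obtain ⟨σ, hσ, h1⟩ := hf.exists_gauge_mMinus hε
  refine ⟨σ, hσ, fun x => ?_⟩
  have hc : Continuous fun v : Fin 2 → ℂ => σ • (halfRotation (f x)).mulVec v :=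
    (continuous_const.matrix_mulVec continuous_id).const_smul σ
  refine ((hc.tendsto _).comp ((hf.neg.tendsto_mMinus_zero_cobounded hε x).comp
    tendsto_neg_inv_cobounded)).congr' ?_
  filter_upwards [self_mem_nhdsWithin] with z hz
  exact (h1 z hz.2 hz.1 x).symm

theorem NicePotential.exists_tendsto_mPlus_nhds_zero (hf : NicePotential f f' h) (hε : 0 < ε) :
    ∃ σ : ℂ, σ * σ = 1 ∧ ∀ x, Tendsto (fun z => mPlus ε f f' h 1 z x)
      (𝓝[{z | 0 ≤ z.im ∧ z ≠ 0}] 0) (𝓝 (σ • (halfRotation (f x)).mulVec (Pi.single 1 1))) := by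
  obtain ⟨σ, hσ, h1⟩ := hf.exists_gauge_mPlus hε
  refine ⟨σ, hσ, fun x => ?_⟩
  have hc : Continuous fun v : Fin 2 → ℂ => σ • (halfRotation (f x)).mulVec v :=
    (continuous_const.matrix_mulVec continuous_id).const_smul σ
  refine ((hc.tendsto _).comp ((hf.neg.tendsto_mPlus_one_cobounded hε x).comp
    tendsto_neg_inv_cobounded)).congr' ?_
  filter_upwards [self_mem_nhdsWithin] with z hz
  exact (h1 z hz.2 hz.1 x).symm

theorem det_halfRotation (θ : ℝ) :
    (ofCols ((halfRotation θ).mulVec (Pi.single 0 1)) ((halfRotation θ).mulVec (Pi.single 1 1))).det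
      = 1 := by
  have h1 : (Real.sin (θ / 2) : ℂ) ^ 2 + (Real.cos (θ / 2) : ℂ) ^ 2 = 1 := by
    exact_mod_cast Real.sin_sq_add_cos_sq (θ / 2)
  simp only [det_ofCols, mulVec_apply_two]
  simp [halfRotation, -Complex.ofReal_cos, -Complex.ofReal_sin]
  linear_combination h1

/-- The upper half-plane part of `G` converges at `z = 0` to a signed rotation. -/
theorem NicePotential.exists_tendsto_nhds_zero (hf : NicePotential f f' h) (hε : 0 < ε) :
    ∃ σ τ : ℂ, σ * σ = 1 ∧ τ * τ = 1 ∧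
      Tendsto (S22 ε f f' h) (𝓝[{z | 0 ≤ z.im ∧ z ≠ 0}] 0) (𝓝 (σ * τ)) ∧
      ∀ x, Tendsto (fun z => ofCols ((S22 ε f f' h z)⁻¹ • mMinus ε f f' h 0 z x)
        (mPlus ε f f' h 1 z x)) (𝓝[{z | 0 ≤ z.im ∧ z ≠ 0}] 0) (𝓝 (τ • halfRotation (f x))) := by
  obtain ⟨σ, hσ, h1⟩ := hf.exists_tendsto_mMinus_nhds_zero hε
  obtain ⟨τ, hτ, h2⟩ := hf.exists_tendsto_mPlus_nhds_zero hε
  have h3 : Tendsto (S22 ε f f' h) (𝓝[{z | 0 ≤ z.im ∧ z ≠ 0}] 0) (𝓝 (σ * τ)) := by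
    have h4 := (continuous_det_ofCols.tendsto _).comp ((h1 0).prodMk_nhds (h2 0))
    simp only [det_ofCols_smul, det_halfRotation, mul_one] at h4
    refine h4.congr' ?_
    filter_upwards [self_mem_nhdsWithin] with z hz
    exact hf.det_m_eq_S22 hε hz.2 hz.1 0
  refine ⟨σ, τ, hσ, hτ, h3, fun x => ?_⟩
  have hne : σ * τ ≠ 0 := fun h0 => by
    have : (σ * σ) * (τ * τ) = 0 := by linear_combination σ * τ * h0
    rw [hσ, hτ] at this
    norm_num at this
  have h5 := (continuous_ofCols.tendsto _).comp (((h3.inv₀ hne).smul (h1 x)).prodMk_nhds (h2 x))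
  -- S₂₂ tends to στ = ±1, so dividing by it replaces the sign σ of the first column by τ. Both
  -- columns then carry the same sign and the limit is a multiple of a rotation.
  have h6 : (σ * τ)⁻¹ * σ = τ := by
    rw [inv_mul_eq_iff_eq_mul₀ hne]
    linear_combination (-σ) * hτ
  have h7 : ofCols ((σ * τ)⁻¹ • σ • (halfRotation (f x)).mulVec (Pi.single 0 1))
      (τ • (halfRotation (f x)).mulVec (Pi.single 1 1)) = τ • halfRotation (f x) := by
    rw [smul_smul, h6]
    ext i j
    fin_cases i <;> fin_cases j <;> simp [ofCols, -Matrix.cons_mulVec]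
  simp only [h7] at h5
  exact h5

end

/-! ### The matrix `G` solves the Riemann-Hilbert problem -/

/-- The transposed adjugate of a `2 × 2` matrix. -/
def flip (M : Matrix (Fin 2) (Fin 2) ℂ) : Matrix (Fin 2) (Fin 2) ℂ :=
  !![M 1 1, -M 1 0; -M 0 1, M 0 0]

theorem continuous_flip : Continuous flip := by
  refine continuous_matrix fun i j => ?_
  fin_cases i <;> fin_cases j <;> simp [flip] <;> fun_prop

theorem flip_mul (A B : Matrix (Fin 2) (Fin 2) ℂ) : flip (A * B) = flip A * flip B := by
  ext i j
  fin_cases i <;> fin_cases j <;> simp [flip, Matrix.mul_apply, Fin.sum_univ_two] <;> ring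

theorem flip_smul (c : ℂ) (A : Matrix (Fin 2) (Fin 2) ℂ) : flip (c • A) = c • flip A := by
  ext i j
  fin_cases i <;> fin_cases j <;> simp [flip]

theorem flip_mul_transpose (A : Matrix (Fin 2) (Fin 2) ℂ) :
    flip A * A.transpose = A.det • 1 := by
  ext i j
  fin_cases i <;> fin_cases j <;>
    simp [flip, Matrix.mul_apply, Fin.sum_univ_two, Matrix.det_fin_two] <;> ring

/-- The upper half-plane part of `G`. -/
def upperG (ε : ℝ) (f f' h : ℝ → ℝ) (x : ℝ) (z : ℂ) : Matrix (Fin 2) (Fin 2) ℂ :=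
  ofCols ((S22 ε f f' h z)⁻¹ • mMinus ε f f' h 0 z x) (mPlus ε f f' h 1 z x)

section

variable {f f' h : ℝ → ℝ} {ε : ℝ} {z : ℂ}

theorem G_of_im_pos (x : ℝ) (hz : 0 < z.im) : G ε f f' h x z = upperG ε f f' h x z := by
  rw [G, if_pos hz, upperG]

/-- This makes the lower half-plane redundant: every property of G there is read off at -z through
`flip`. -/
theorem NicePotential.G_neg (hf : NicePotential f f' h) (hε : 0 < ε) (x : ℝ) (hz : 0 < z.im) :
    G ε f f' h x (-z) = flip (upperG ε f f' h x z) := by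
  have h1 : ¬ 0 < (-z).im := by simp only [Complex.neg_im]; linarith
  have h0 := ne_zero_of_im_pos hz
  rw [G, if_neg h1, upperG, hf.mPlus_zero_neg hε h0 hz.le, hf.mMinus_one_neg hε h0 hz.le,
    hf.S11_neg hε h0 hz.le]
  ext i j
  fin_cases i <;> fin_cases j <;> simp [ofCols, flip]

theorem NicePotential.jMinus_zero_conj (hf : NicePotential f f' h) (hε : 0 < ε) (hz : z ≠ 0)
    (hz' : 0 ≤ z.im) (x : ℝ) :
    jMinus ε f f' h 0 (-conj z) x = fun i => conj (jMinus ε f f' h 0 z x i) := by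
  have h1 := hf.eq_jMinus_zero hε (z := -conj z) (by simpa using hz) (by simpa using hz')
    (hf.isJost_jMinus_zero hε hz hz').map_conj
  rw [← h1]

theorem NicePotential.jPlus_one_conj (hf : NicePotential f f' h) (hε : 0 < ε) (hz : z ≠ 0)
    (hz' : 0 ≤ z.im) (x : ℝ) :
    jPlus ε f f' h 1 (-conj z) x = fun i => conj (jPlus ε f f' h 1 z x i) := by
  have h1 := hf.eq_jPlus_one hε (z := -conj z) (by simpa using hz) (by simpa using hz')
    (hf.isJost_jPlus_one hε hz hz').map_conj
  rw [← h1]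

theorem NicePotential.S22_conj (hf : NicePotential f f' h) (hε : 0 < ε) (hz : z ≠ 0)
    (hz' : 0 ≤ z.im) : S22 ε f f' h (-conj z) = conj (S22 ε f f' h z) := by
  rw [S22, S22, hf.jMinus_zero_conj hε hz hz', hf.jPlus_one_conj hε hz hz']
  simp [det_ofCols]

theorem NicePotential.upperG_conj (hf : NicePotential f f' h) (hε : 0 < ε) (hz : z ≠ 0)
    (hz' : 0 ≤ z.im) (x : ℝ) :
    upperG ε f f' h x (-conj z) = (upperG ε f f' h x z).map conj := by
  rw [upperG, upperG, hf.S22_conj hε hz hz', ← phase_smul_jMinus, ← phase_smul_jMinus,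
    ← phase_smul_jPlus, ← phase_smul_jPlus, hf.jMinus_zero_conj hε hz hz',
    hf.jPlus_one_conj hε hz hz', phase_neg_conj, phase_neg_conj]
  ext i j
  fin_cases i <;> fin_cases j <;> simp [ofCols]

theorem NicePotential.det_upperG (hf : NicePotential f f' h) (hε : 0 < ε) (hz : z ≠ 0)
    (hz' : 0 ≤ z.im) (hS : S22 ε f f' h z ≠ 0) (x : ℝ) : (upperG ε f f' h x z).det = 1 := by
  have h1 := hf.det_m_eq_S22 hε hz hz' x
  rw [upperG, ← one_smul ℂ (mPlus ε f f' h 1 z x), det_ofCols_smul, h1, mul_one,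
    inv_mul_cancel₀ hS]

/-! The eigenvalues and the domain. -/

theorem neg_mem_domain {Z : Set ℂ} : -z ∈ domain Z ↔ z ∈ domain Z := by
  simp only [domain, poles, mem_ofPred_eq, Complex.neg_im, ne_eq, neg_eq_zero, map_neg, neg_neg]
  tauto

/-- The set of eigenvalues records only the closed first quadrant. The symmetry of S₂₂ under z ↦ -z̄
recovers the second quadrant, and the other two members of a quartet lie in the lower half-plane. -/
theorem NicePotential.mem_domain_iff (hf : NicePotential f f' h) (hε : 0 < ε) (hz : 0 < z.im) :
    z ∈ domain (eigenvalues ε f f' h) ↔ S22 ε f f' h z ≠ 0 := by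
  have hc := hf.S22_conj hε (ne_zero_of_im_pos hz) hz.le
  simp only [domain, poles, eigenvalues, mem_ofPred_eq, Complex.neg_im, Complex.conj_im,
    Complex.neg_re, Complex.conj_re, neg_neg, hc, map_eq_zero]
  constructor
  · rintro ⟨-, h2⟩ h3
    refine h2 ?_
    rcases le_total 0 z.re with h4 | h4
    · exact Or.inl ⟨hz, h4, h3⟩
    · exact Or.inr (Or.inl ⟨hz, by linarith, h3⟩)
  · intro h1
    refine ⟨hz.ne', ?_⟩
    rintro (h2 | h2 | h2 | h2)
    · exact h1 h2.2.2
    · exact h1 h2.2.2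
    · linarith [h2.1]
    · linarith [h2.1]

/-! The boundary values. -/

/-- The continuous extension of `upperG` to the closed upper half-plane, with the value `M`
at `z = 0`. -/
def closedG (ε : ℝ) (f f' h : ℝ → ℝ) (x : ℝ) (M : Matrix (Fin 2) (Fin 2) ℂ) (z : ℂ) :
    Matrix (Fin 2) (Fin 2) ℂ := if z = 0 then M else upperG ε f f' h x z

theorem NicePotential.continuousWithinAt_upperG (hf : NicePotential f f' h) (hε : 0 < ε)
    (hz : z ≠ 0) (hz' : 0 ≤ z.im) (hS : S22 ε f f' h z ≠ 0) (x : ℝ) :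
    ContinuousWithinAt (upperG ε f f' h x) {z | 0 ≤ z.im ∧ z ≠ 0} z := by
  have h1 := hf.continuousOn_mMinus_zero hε x z ⟨hz', hz⟩
  have h2 := hf.continuousOn_mPlus_one hε x z ⟨hz', hz⟩
  have h3 := hf.continuousOn_S22 hε z ⟨hz', hz⟩
  exact continuous_ofCols.continuousAt.comp_continuousWithinAt (((h3.inv₀ hS).smul h1).prodMk h2)

theorem continuousWithinAt_closedG {x : ℝ} {M : Matrix (Fin 2) (Fin 2) ℂ}
    (h0 : Tendsto (upperG ε f f' h x) (𝓝[{z | 0 ≤ z.im ∧ z ≠ 0}] 0) (𝓝 M))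
    (hz : z ≠ 0 → ContinuousWithinAt (upperG ε f f' h x) {z | 0 ≤ z.im ∧ z ≠ 0} z) :
    ContinuousWithinAt (closedG ε f f' h x M) {z | 0 ≤ z.im} z := by
  by_cases hz0 : z = 0
  · subst hz0
    have h1 : {z : ℂ | 0 ≤ z.im} = insert 0 {z : ℂ | 0 ≤ z.im ∧ z ≠ 0} := by
      ext w
      simp only [mem_ofPred_eq, mem_insert_iff]
      by_cases hw : w = 0 <;> simp [hw]
    rw [h1, continuousWithinAt_insert_self]
    have h2 : closedG ε f f' h x M 0 = M := if_pos rfl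
    rw [ContinuousWithinAt, h2]
    refine h0.congr' ?_
    filter_upwards [self_mem_nhdsWithin] with w hw
    rw [closedG, if_neg hw.2]
  · have h1 : ContinuousWithinAt (closedG ε f f' h x M) {z | 0 ≤ z.im ∧ z ≠ 0} z :=
      (hz hz0).congr (fun w hw => by rw [closedG, if_neg hw.2]) (by rw [closedG, if_neg hz0])
    refine h1.mono_of_mem_nhdsWithin ?_
    filter_upwards [self_mem_nhdsWithin, mem_nhdsWithin_of_mem_nhds (isOpen_ne.mem_nhds hz0)]
      with w h2 h3
    exact ⟨h2, h3⟩

/-! Relations on the real axis. -/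

theorem NicePotential.jMinus_one_real (hf : NicePotential f f' h) (hε : 0 < ε) {s : ℝ} (hs : s ≠ 0)
    (x : ℝ) : jMinus ε f f' h 1 s x = rot fun i => conj (jMinus ε f f' h 0 s x i) := by
  have h1 := hf.jMinus_one_neg hε (z := -(s : ℂ)) (by simpa using hs) (by simp) x
  have h2 := hf.jMinus_zero_conj hε (z := (s : ℂ)) (by simpa using hs) (by simp) x
  rw [neg_neg] at h1
  rw [Complex.conj_ofReal] at h2
  rw [h1, h2]

theorem NicePotential.jPlus_zero_real (hf : NicePotential f f' h) (hε : 0 < ε) {s : ℝ} (hs : s ≠ 0)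
    (x : ℝ) : jPlus ε f f' h 0 s x = rot.symm fun i => conj (jPlus ε f f' h 1 s x i) := by
  have h1 := hf.jPlus_zero_neg hε (z := -(s : ℂ)) (by simpa using hs) (by simp) x
  have h2 := hf.jPlus_one_conj hε (z := (s : ℂ)) (by simpa using hs) (by simp) x
  rw [neg_neg] at h1
  rw [Complex.conj_ofReal] at h2
  rw [h1, h2]

/-- On the real axis j₂⁻ is the rotated conjugate of j₁⁻, so the relation det J⁻ = 1 says that j₁⁻
is a unit vector. -/
theorem NicePotential.norm_jMinus_real (hf : NicePotential f f' h) (hε : 0 < ε) {s : ℝ}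
    (hs : s ≠ 0) (x : ℝ) : jMinus ε f f' h 0 s x 0 * conj (jMinus ε f f' h 0 s x 0) +
      jMinus ε f f' h 0 s x 1 * conj (jMinus ε f f' h 0 s x 1) = 1 := by
  have hs' : (s : ℂ) ≠ 0 := by exact_mod_cast hs
  have h0 := hf.isJost_jMinus_zero hε hs' (by simp)
  have h1 := hf.isJost_jMinus_one hε hs' (by simp)
  have h2 := h0.1.det_eq_of_tendsto h1.1 h0.2 h1.2 x
  rw [hf.jMinus_one_real hε hs, det_ofCols] at h2
  simp only [rot_apply, Matrix.cons_val_zero, Matrix.cons_val_one, Matrix.cons_val_fin_one] at h2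
  linear_combination h2

theorem NicePotential.norm_jPlus_real (hf : NicePotential f f' h) (hε : 0 < ε) {s : ℝ}
    (hs : s ≠ 0) (x : ℝ) : jPlus ε f f' h 1 s x 0 * conj (jPlus ε f f' h 1 s x 0) +
      jPlus ε f f' h 1 s x 1 * conj (jPlus ε f f' h 1 s x 1) = 1 := by
  have hs' : (s : ℂ) ≠ 0 := by exact_mod_cast hs
  have h0 := hf.isJost_jPlus_zero hε hs' (by simp)
  have h1 := hf.isJost_jPlus_one hε hs' (by simp)
  have h2 := h0.1.det_eq_of_tendsto h1.1 h0.2 h1.2 x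
  rw [hf.jPlus_zero_real hε hs, det_ofCols] at h2
  simp only [rot_symm_apply, Matrix.cons_val_zero, Matrix.cons_val_one,
    Matrix.cons_val_fin_one] at h2
  linear_combination h2

theorem NicePotential.scatteringMatrix_eq (hf : NicePotential f f' h) (hε : 0 < ε) {s : ℝ}
    (hs : s ≠ 0) : scatteringMatrix ε f f' h s =
      (ofCols (jMinus ε f f' h 0 s 0) (jMinus ε f f' h 1 s 0)).adjugate *
        ofCols (jPlus ε f f' h 0 s 0) (jPlus ε f f' h 1 s 0) := by
  have hs' : (s : ℂ) ≠ 0 := by exact_mod_cast hs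
  have h0 := hf.isJost_jMinus_zero hε hs' (by simp)
  have h1 := hf.isJost_jMinus_one hε hs' (by simp)
  have h2 := h0.1.det_eq_of_tendsto h1.1 h0.2 h1.2 0
  rw [scatteringMatrix, Matrix.inv_def, h2, Ring.inverse_one, one_smul]

theorem NicePotential.scatteringMatrix_one_one (hf : NicePotential f f' h) (hε : 0 < ε) {s : ℝ}
    (hs : s ≠ 0) : scatteringMatrix ε f f' h s 1 1 = S22 ε f f' h s := by
  rw [hf.scatteringMatrix_eq hε hs, S22, Matrix.adjugate_fin_two, det_ofCols]
  simp [ofCols, Matrix.mul_apply, Fin.sum_univ_two]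
  ring

theorem NicePotential.scatteringMatrix_one_zero (hf : NicePotential f f' h) (hε : 0 < ε) {s : ℝ}
    (hs : s ≠ 0) (x : ℝ) : scatteringMatrix ε f f' h s 1 0 =
      (ofCols (jMinus ε f f' h 0 s x) (jPlus ε f f' h 0 s x)).det := by
  have hs' : (s : ℂ) ≠ 0 := by exact_mod_cast hs
  rw [(hf.isJost_jMinus_zero hε hs' (by simp)).1.det_eq
    (hf.isJost_jPlus_zero hε hs' (by simp)).1 x 0, hf.scatteringMatrix_eq hε hs,
    Matrix.adjugate_fin_two, det_ofCols]
  simp [ofCols, Matrix.mul_apply, Fin.sum_univ_two]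
  ring

/-- The jump relation on the real axis, in terms of `upperG`. -/
theorem NicePotential.jump_relation (hf : NicePotential f f' h) (hε : 0 < ε) {s : ℝ} (hs : s ≠ 0)
    (hS : S22 ε f f' h s ≠ 0) (x : ℝ) :
    upperG ε f f' h x s = flip ((upperG ε f f' h x s).map conj) *
      !![1 + reflection ε f f' h s * conj (reflection ε f f' h s),
        -(conj (reflection ε f f' h s) * (phase ε s 1 x * phase ε s 1 x));
        -(reflection ε f f' h s * (phase ε s 0 x * phase ε s 0 x)), 1] := by
  have hs' : (s : ℂ) ≠ 0 := by exact_mod_cast hs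
  have hρ : reflection ε f f' h s =
      scatteringMatrix ε f f' h s 1 0 / S22 ε f f' h s := by
    rw [reflection, hf.scatteringMatrix_one_one hε hs]
  have h10 := hf.scatteringMatrix_one_zero hε hs x
  rw [hf.jPlus_zero_real hε hs, det_ofCols] at h10
  have h22 := hf.det_j_eq_S22 hε hs' (by simp) x
  rw [det_ofCols] at h22
  have ha := hf.norm_jMinus_real hε hs x
  have hb := hf.norm_jPlus_real hε hs x
  have hp := phase_zero_mul_phase_one ε s x
  have hpc : conj (phase ε s 0 x) = phase ε s 1 x := by
    rw [← phase_neg_conj, Complex.conj_ofReal, phase_neg']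
  have hpc' : conj (phase ε s 1 x) = phase ε s 0 x := by
    rw [← hpc, Complex.conj_conj]
  have hSc : conj (S22 ε f f' h s) ≠ 0 := by simpa using hS
  simp only [rot_symm_apply, Matrix.cons_val_zero, Matrix.cons_val_one,
    Matrix.cons_val_fin_one] at h10
  have h10c := congrArg conj h10
  have h22c := congrArg conj h22
  simp only [map_sub, map_mul, map_neg, Complex.conj_conj] at h10c h22c
  have hdet := congrArg conj (hf.det_upperG hε hs' (by simp) hS x)
  -- The jump matrix is conj(G)ᵀ G for G = `upperG` at s. Then flip(conj G) conj(G)ᵀ = det(conj G) =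
  -- 1 gives the claim.
  suffices h1 : !![1 + reflection ε f f' h s * conj (reflection ε f f' h s),
        -(conj (reflection ε f f' h s) * (phase ε s 1 x * phase ε s 1 x));
        -(reflection ε f f' h s * (phase ε s 0 x * phase ε s 0 x)), 1] =
      ((upperG ε f f' h x s).map conj).transpose * upperG ε f f' h x s by
    rw [h1, ← mul_assoc, flip_mul_transpose, ← RingHom.mapMatrix_apply, ← RingHom.map_det,
      hdet, map_one, one_smul, one_mul]
  rw [hρ, upperG, ← phase_smul_jMinus, ← phase_smul_jPlus]
  simp only [map_div₀]
  set a0 := jMinus ε f f' h 0 s x 0 with ha0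
  set a1 := jMinus ε f f' h 0 s x 1 with ha1
  set b0 := jPlus ε f f' h 1 s x 0 with hb0
  set b1 := jPlus ε f f' h 1 s x 1 with hb1
  set p0 := phase ε s 0 x
  set p1 := phase ε s 1 x
  set S := S22 ε f f' h s
  set r := scatteringMatrix ε f f' h s 1 0
  -- With a = j₁⁻ and b = j₂⁺ this is Lagrange's identity |r|² + |S|² = |a|²|b|² with |b| = 1,
  -- because S = det(a, b) and r is minus the Hermitian product of a and b.
  have e00 : 1 + r / S * (conj r / conj S) =
      (conj S)⁻¹ * (p1 * conj a0) * (S⁻¹ * (p0 * a0)) +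
        (conj S)⁻¹ * (p1 * conj a1) * (S⁻¹ * (p0 * a1)) := by
    field_simp
    rw [h10c, h10, ← h22c, ← h22]
    linear_combination (a0 * conj a0 + a1 * conj a1) * hb - (a0 * conj a0 + a1 * conj a1) * hp
  have e01 : -(conj r / conj S * (p1 * p1)) =
      (conj S)⁻¹ * (p1 * conj a0) * (p1 * b0) + (conj S)⁻¹ * (p1 * conj a1) * (p1 * b1) := by
    field_simp
    rw [h10c]
    ring
  have e10 : -(r / S * (p0 * p0)) =
      p0 * conj b0 * (S⁻¹ * (p0 * a0)) + p0 * conj b1 * (S⁻¹ * (p0 * a1)) := by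
    field_simp
    rw [h10]
    ring
  have e11 : 1 = p0 * conj b0 * (p1 * b0) + p0 * conj b1 * (p1 * b1) := by
    linear_combination -hp - p0 * p1 * hb
  ext i j
  fin_cases i <;> fin_cases j <;>
    simp [ofCols, Matrix.mul_apply, Fin.sum_univ_two, hpc, hpc', -mul_neg] <;>
    first | exact e00 | exact e01 | exact e10 | exact e11

end

/-! ### Poles and residues -/

/-- `F` has at most a simple pole at `z`. -/
def AtMostSimplePole (F : ℂ → ℂ) (z : ℂ) : Prop :=
  ∃ g : ℂ → ℂ, AnalyticAt ℂ g z ∧ F =ᶠ[𝓝[≠] z] fun w => (w - z)⁻¹ * g w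

theorem AtMostSimplePole.meromorphic {F : ℂ → ℂ} {z : ℂ} (hF : AtMostSimplePole F z) :
    MeromorphicAt F z ∧ ((-1 : ℤ) : WithTop ℤ) ≤ meromorphicOrderAt F z := by
  obtain ⟨g, hg, h1⟩ := hF
  have h2 : MeromorphicAt (fun w : ℂ => (w - z)⁻¹) z := by fun_prop
  refine ⟨(h2.mul hg.meromorphicAt).congr h1.symm, ?_⟩
  have h3 : (fun w => (w - z)⁻¹ * g w) = (fun w : ℂ => (w - z) ^ (-1 : ℤ)) * g := by
    ext w
    simp
  rw [meromorphicOrderAt_congr h1, h3, meromorphicOrderAt_mul (by fun_prop) hg.meromorphicAt,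
    fun_meromorphicOrderAt_zpow_id_sub_const]
  exact le_add_of_nonneg_right hg.meromorphicOrderAt_nonneg

theorem AnalyticAt.atMostSimplePole {F : ℂ → ℂ} {z : ℂ} (hF : AnalyticAt ℂ F z) :
    AtMostSimplePole F z := by
  refine ⟨fun w => (w - z) * F w, by fun_prop, ?_⟩
  filter_upwards [self_mem_nhdsWithin] with w hw
  rw [inv_mul_cancel_left₀ (sub_ne_zero.2 hw)]

theorem AtMostSimplePole.mul_analyticAt {F g : ℂ → ℂ} {z : ℂ} (hF : AtMostSimplePole F z)
    (hg : AnalyticAt ℂ g z) : AtMostSimplePole (fun w => F w * g w) z := by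
  obtain ⟨k, hk, h1⟩ := hF
  refine ⟨fun w => k w * g w, hk.mul hg, ?_⟩
  filter_upwards [h1] with w hw
  rw [hw, mul_assoc]

theorem AtMostSimplePole.congr {F F' : ℂ → ℂ} {z : ℂ} (hF : AtMostSimplePole F z)
    (h : F =ᶠ[𝓝[≠] z] F') : AtMostSimplePole F' z := by
  obtain ⟨k, hk, h1⟩ := hF
  exact ⟨k, hk, h.symm.trans h1⟩

theorem tendsto_neg_nhdsNE (z : ℂ) : Tendsto (fun w : ℂ => -w) (𝓝[≠] (-z)) (𝓝[≠] z) := by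
  refine tendsto_nhdsWithin_iff.2 ⟨?_, ?_⟩
  · have h1 : Tendsto (fun w : ℂ => -w) (𝓝 (-z)) (𝓝 (- -z)) := tendsto_id.neg
    rw [neg_neg] at h1
    exact h1.mono_left nhdsWithin_le_nhds
  · filter_upwards [self_mem_nhdsWithin] with w hw h0
    exact hw (by rw [← h0, neg_neg]; rfl)

theorem tendsto_neg_conj_nhdsNE (z : ℂ) :
    Tendsto (fun w : ℂ => -conj w) (𝓝[≠] (-conj z)) (𝓝[≠] z) := by
  refine tendsto_nhdsWithin_iff.2 ⟨?_, ?_⟩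
  · have h0 : Continuous fun w : ℂ => -conj w := Complex.continuous_conj.neg
    have h1 := h0.tendsto (-conj z)
    simp only [map_neg, Complex.conj_conj, neg_neg] at h1
    exact h1.mono_left nhdsWithin_le_nhds
  · filter_upwards [self_mem_nhdsWithin] with w hw h0
    exact hw (by rw [← h0]; simp)

theorem AtMostSimplePole.neg_comp {F : ℂ → ℂ} {z : ℂ} (hF : AtMostSimplePole F (-z)) (c : ℂ) :
    AtMostSimplePole (fun w => c * F (-w)) z := by
  obtain ⟨g, hg, h1⟩ := hF
  have h2 : AnalyticAt ℂ (fun w => g (-w)) z :=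
    AnalyticAt.fun_comp hg (analyticAt_id.neg : AnalyticAt ℂ (fun w : ℂ => -w) z)
  refine ⟨fun w => -c * g (-w), by fun_prop, ?_⟩
  have h3 := tendsto_neg_nhdsNE (-z)
  rw [neg_neg] at h3
  filter_upwards [h3.eventually h1] with w hw
  rw [hw, show -w - -z = -(w - z) by ring, inv_neg]
  ring

/-- Factor S(w) = (w - z) · `dslope S z w`, whose second factor is analytic with the nonzero value
S'(z) at z. -/
theorem atMostSimplePole_inv {S : ℂ → ℂ} {z : ℂ} (hS : ∀ᶠ w in 𝓝 z, DifferentiableAt ℂ S w)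
    (hz : S z = 0) (hd : deriv S z ≠ 0) : AtMostSimplePole (fun w => (S w)⁻¹) z := by
  obtain ⟨s, hs, h1⟩ := Metric.eventually_nhds_iff_ball.1 hS
  have hb : DifferentiableOn ℂ S (Metric.ball z s) := fun w hw => (h1 w hw).differentiableWithinAt
  have h2 : DifferentiableOn ℂ (dslope S z) (Metric.ball z s) :=
    (Complex.differentiableOn_dslope (Metric.ball_mem_nhds z hs)).2 hb
  have h3 : AnalyticAt ℂ (dslope S z) z := h2.analyticAt (Metric.ball_mem_nhds z hs)
  refine ⟨fun w => (dslope S z w)⁻¹, h3.inv (by rwa [dslope_same]), ?_⟩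
  filter_upwards [self_mem_nhdsWithin] with w hw
  have h4 := sub_smul_dslope S z w
  rw [hz, sub_zero, smul_eq_mul] at h4
  rw [← h4, mul_inv]

theorem ResidueCondition.congr {H H' : ℂ → Matrix (Fin 2) (Fin 2) ℂ} {w : ℂ}
    {C : Matrix (Fin 2) (Fin 2) ℂ} (hH : ResidueCondition H w C) (h : H =ᶠ[𝓝[≠] w] H') :
    ResidueCondition H' w C := by
  obtain ⟨R, h1, h2⟩ := hH
  refine ⟨R, h1.congr' ?_, h2.congr' ?_⟩ <;> filter_upwards [h] with z hz <;> rw [hz]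

/-- The sign in front of flip C comes from w - z changing sign under negation; the same happens for
the reflection in the imaginary axis below. -/
theorem ResidueCondition.neg {H H' : ℂ → Matrix (Fin 2) (Fin 2) ℂ} {w : ℂ}
    {C : Matrix (Fin 2) (Fin 2) ℂ} (hH : ResidueCondition H w C)
    (h : ∀ᶠ z in 𝓝[≠] w, H' (-z) = flip (H z)) : ResidueCondition H' (-w) (-flip C) := by
  obtain ⟨R, h1, h2⟩ := hH
  have h3 := (tendsto_neg_nhdsNE w).eventually h
  refine ⟨-flip R, ?_, ?_⟩
  · refine ((continuous_flip.tendsto _).comp (h1.comp (tendsto_neg_nhdsNE w))).neg.congr' ?_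
    filter_upwards [h3] with z hz
    rw [neg_neg] at hz
    rw [hz, Function.comp_apply, Function.comp_apply, flip_smul, ← neg_smul]
    congr 1
    ring
  · refine ((continuous_flip.tendsto _).comp (h2.comp (tendsto_neg_nhdsNE w))).neg.congr' ?_
    filter_upwards [h3] with z hz
    rw [neg_neg] at hz
    rw [hz, Function.comp_apply, Function.comp_apply, flip_mul, mul_neg]

theorem continuous_map_conj :
    Continuous fun M : Matrix (Fin 2) (Fin 2) ℂ => M.map conj :=
  continuous_id.matrix_map Complex.continuous_conj

theorem ResidueCondition.neg_conj {H H' : ℂ → Matrix (Fin 2) (Fin 2) ℂ} {w : ℂ}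
    {C : Matrix (Fin 2) (Fin 2) ℂ} (hH : ResidueCondition H w C)
    (h : ∀ᶠ z in 𝓝[≠] w, H' (-conj z) = (H z).map conj) :
    ResidueCondition H' (-conj w) (-C.map conj) := by
  obtain ⟨R, h1, h2⟩ := hH
  have h3 := (tendsto_neg_conj_nhdsNE w).eventually h
  refine ⟨-R.map conj, ?_, ?_⟩
  · refine ((continuous_map_conj.tendsto _).comp
      (h1.comp (tendsto_neg_conj_nhdsNE w))).neg.congr' ?_
    filter_upwards [h3] with z hz
    simp only [map_neg, Complex.conj_conj, neg_neg] at hz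
    rw [hz, Function.comp_apply, Function.comp_apply]
    ext i j
    simp
    ring
  · refine ((continuous_map_conj.tendsto _).comp
      (h2.comp (tendsto_neg_conj_nhdsNE w))).neg.congr' ?_
    filter_upwards [h3] with z hz
    simp only [map_neg, Complex.conj_conj, neg_neg] at hz
    rw [hz, Function.comp_apply, Function.comp_apply, Matrix.map_mul, mul_neg]

/-! ### Proportionality of the Jost solutions at an eigenvalue -/

section

variable {f f' h : ℝ → ℝ} {ε : ℝ} {z : ℂ}

theorem NicePotential.continuous_lax (hf : NicePotential f f' h) (ε : ℝ) (z : ℂ) :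
    Continuous (lax ε f f' h z) :=
  continuous_const.add (hf.continuous_Q ε z)

/-- Uniqueness for a linear differential equation. The coefficient is only continuous, so its
Lipschitz constant is taken on a bounded interval containing both points. -/
theorem NicePotential.solvesLax_eq_zero (hf : NicePotential f f' h) {w : ℝ → Fin 2 → ℂ}
    (hw : SolvesLax ε f f' h z w) {x₀ : ℝ} (h0 : w x₀ = 0) (x : ℝ) : w x = 0 := by
  set R : ℝ := |x₀| + |x| + 1 with hR
  have hx : x ∈ Ioo (-R) R := abs_lt.1 (by rw [hR]; linarith [abs_nonneg x₀])
  have hx₀ : x₀ ∈ Ioo (-R) R := abs_lt.1 (by rw [hR]; linarith [abs_nonneg x])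
  obtain ⟨K, hK⟩ := (isCompact_Icc (a := -R) (b := R)).exists_bound_of_continuousOn
    (f := fun x i j => lax ε f f' h z x i j) (hf.continuous_lax ε z).continuousOn
  set c : ℂ := 1 / (4 * Complex.I * ε)
  have hL : ∀ y ∈ Ioo (-R) R, LipschitzOnWith (‖c‖ * (2 * |K|)).toNNReal
      (fun v : Fin 2 → ℂ => c • (lax ε f f' h z y).mulVec v) univ := fun y hy => by
    refine (LipschitzWith.of_dist_le_mul fun v v' => ?_).lipschitzOnWith
    rw [dist_eq_norm, ← smul_sub, ← Matrix.mulVec_sub, norm_smul, dist_eq_norm,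
      Real.coe_toNNReal _ (by positivity), mul_assoc]
    refine mul_le_mul_of_nonneg_left (norm_mulVec_le (fun i j => ?_) _) (norm_nonneg _)
    exact (((norm_le_pi_norm _ j).trans (norm_le_pi_norm _ i)).trans
      (hK y (Ioo_subset_Icc_self hy))).trans (le_abs_self K)
  exact ODE_solution_unique_of_mem_Ioo (v := fun y v => c • (lax ε f f' h z y).mulVec v)
    (s := fun _ => univ) (g := fun _ => 0) hL hx₀ (fun y _ => ⟨hw y, mem_univ _⟩)
    (fun y _ => ⟨by simpa using hasDerivAt_const y (0 : Fin 2 → ℂ), mem_univ _⟩) h0 hx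

theorem exists_eq_smul_of_det_eq_zero {v w : Fin 2 → ℂ} (h0 : (ofCols v w).det = 0) (hw : w ≠ 0) :
    ∃ η : ℂ, v = η • w := by
  rw [det_ofCols] at h0
  by_cases h1 : w 0 = 0
  · have h2 : w 1 ≠ 0 := fun h2 => hw (by ext i; fin_cases i <;> simp [h1, h2])
    have h3 : v 0 = 0 := by simpa [h1, h2] using h0
    refine ⟨v 1 / w 1, ?_⟩
    ext i
    fin_cases i
    · simp [h1, h3]
    · simp [h2]
  · refine ⟨v 0 / w 0, ?_⟩
    ext i
    fin_cases i
    · simp [h1]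
    · simp only [Fin.mk_one, Pi.smul_apply, smul_eq_mul]
      field_simp
      linear_combination -h0

/-- At a zero of S₂₂ the two solutions are dependent at x = 0, where j₂⁺ cannot vanish in view of
its asymptotics. Uniqueness for the differential equation propagates the dependence to all x, so the
chosen constant has its defining property. -/
theorem NicePotential.jMinus_eq_smul (hf : NicePotential f f' h) (hε : 0 < ε) (hz : 0 < z.im)
    (hS : S22 ε f f' h z = 0) (x : ℝ) :
    jMinus ε f f' h 0 z x = proportionality ε f f' h z • jPlus ε f f' h 1 z x := by
  have hz0 := ne_zero_of_im_pos hz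
  have h1 := hf.isJost_jPlus_one hε hz0 hz.le
  have h2 := hf.isJost_jMinus_zero hε hz0 hz.le
  have h3 : jPlus ε f f' h 1 z 0 ≠ 0 := fun h0 => by
    have h4 : (fun x => phase ε z 1 x • jPlus ε f f' h 1 z x) = fun _ => 0 := by
      funext x
      rw [hf.solvesLax_eq_zero h1.1 h0, smul_zero]
    have h5 := h1.2
    rw [h4] at h5
    have h6 := congrFun (tendsto_nhds_unique h5 tendsto_const_nhds) 1
    simp at h6
  obtain ⟨η, hη⟩ := exists_eq_smul_of_det_eq_zero hS h3
  have h4 : ∃ η : ℂ, ∀ x, jMinus ε f f' h 0 z x = η • jPlus ε f f' h 1 z x := by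
    refine ⟨η, fun x => sub_eq_zero.1 ?_⟩
    refine hf.solvesLax_eq_zero (ε := ε) (z := z) (w := fun x => jMinus ε f f' h 0 z x - η • jPlus ε f f' h 1 z x)
      (fun y => ?_) (sub_eq_zero.2 hη) x
    refine ((h2.1 y).sub (h1.1.smul η y)).congr_deriv ?_
    rw [← smul_sub, Matrix.mulVec_sub]
  exact Classical.epsilon_spec h4 x

/-! ### The Riemann-Hilbert problem for `G` -/

theorem isOpen_upperHalfPlane : IsOpen {z : ℂ | 0 < z.im} :=
  isOpen_lt continuous_const Complex.continuous_im

theorem NicePotential.analyticAt_upperG (hf : NicePotential f f' h) (hε : 0 < ε) (hz : 0 < z.im)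
    (hS : S22 ε f f' h z ≠ 0) (x : ℝ) (i j : Fin 2) :
    AnalyticAt ℂ (fun w => upperG ε f f' h x w i j) z := by
  have ho := isOpen_upperHalfPlane.mem_nhds hz
  have h0 := (hf.differentiableOn_S22 hε).analyticAt ho
  have h1 := fun i => (differentiableOn_pi.1 (hf.differentiableOn_mMinus_zero hε x) i).analyticAt ho
  have h2 := fun i => (differentiableOn_pi.1 (hf.differentiableOn_mPlus_one hε x) i).analyticAt ho
  fin_cases i <;> fin_cases j
  · exact (h0.inv hS).mul (h1 0)
  · exact h2 0
  · exact (h0.inv hS).mul (h1 1)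
  · exact h2 1

theorem NicePotential.atMostSimplePole_upperG (hf : NicePotential f f' h) (hε : 0 < ε)
    (hz : 0 < z.im) (hS : S22 ε f f' h z = 0 → deriv (S22 ε f f' h) z ≠ 0) (x : ℝ) (i j : Fin 2) :
    AtMostSimplePole (fun w => upperG ε f f' h x w i j) z := by
  by_cases h0 : S22 ε f f' h z = 0
  swap
  · exact AnalyticAt.atMostSimplePole (hf.analyticAt_upperG hε hz h0 x i j)
  have ho := isOpen_upperHalfPlane.mem_nhds hz
  have h1 := fun i => (differentiableOn_pi.1 (hf.differentiableOn_mMinus_zero hε x) i).analyticAt ho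
  have h2 := fun i => (differentiableOn_pi.1 (hf.differentiableOn_mPlus_one hε x) i).analyticAt ho
  have h3 := atMostSimplePole_inv ((hf.differentiableOn_S22 hε).eventually_differentiableAt ho) h0
    (hS h0)
  fin_cases i <;> fin_cases j
  · exact h3.mul_analyticAt (h1 0)
  · exact AnalyticAt.atMostSimplePole (h2 0)
  · exact h3.mul_analyticAt (h1 1)
  · exact AnalyticAt.atMostSimplePole (h2 1)

theorem NicePotential.G_eventuallyEq (x : ℝ) (hz : 0 < z.im) :
    G ε f f' h x =ᶠ[𝓝 z] upperG ε f f' h x := by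
  filter_upwards [isOpen_upperHalfPlane.mem_nhds hz] with w hw
  exact G_of_im_pos x hw

theorem NicePotential.G_eventuallyEq_flip (hf : NicePotential f f' h) (hε : 0 < ε) (x : ℝ)
    (hz : z.im < 0) : G ε f f' h x =ᶠ[𝓝 z] fun w => flip (upperG ε f f' h x (-w)) := by
  filter_upwards [(isOpen_lt Complex.continuous_im continuous_const).mem_nhds hz] with w hw
  have h1 := hf.G_neg hε x (z := -w) (by simpa using hw)
  rwa [neg_neg] at h1

theorem flip_apply (M : Matrix (Fin 2) (Fin 2) ℂ) (i j : Fin 2) :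
    flip M i j = (if i = j then 1 else -1) * M (1 - i) (1 - j) := by
  fin_cases i <;> fin_cases j <;> simp [flip]

/-- The residue of 1/S₂₂ is 1/S₂₂', and m₁⁻ is proportional to m₂⁺ at the eigenvalue. The squared
phase arises because the two columns are normalized with inverse phases. -/
theorem NicePotential.residue_upperG (hf : NicePotential f f' h) (hε : 0 < ε) (hz : 0 < z.im)
    (hS : S22 ε f f' h z = 0) (hd : deriv (S22 ε f f' h) z ≠ 0) (x : ℝ) :
    ResidueCondition (upperG ε f f' h x) z
      !![0, 0; modifiedProportionality ε f f' h z * (phase ε z 0 x * phase ε z 0 x), 0] := by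
  set c := modifiedProportionality ε f f' h z * (phase ε z 0 x * phase ε z 0 x) with hc
  have ho := isOpen_upperHalfPlane.mem_nhds hz
  have h1 := ((hf.differentiableOn_mMinus_zero hε x).continuousOn.continuousAt ho).tendsto.mono_left
    (nhdsWithin_le_nhds (s := {z}ᶜ))
  have h2 := ((hf.differentiableOn_mPlus_one hε x).continuousOn.continuousAt ho).tendsto.mono_left
    (nhdsWithin_le_nhds (s := {z}ᶜ))
  have h3 : Tendsto (fun w => (w - z) * (S22 ε f f' h w)⁻¹) (𝓝[≠] z)
      (𝓝 (deriv (S22 ε f f' h) z)⁻¹) := by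
    have h4 := ((hf.differentiableOn_S22 hε).differentiableAt ho).hasDerivAt
    refine (h4.tendsto_slope.inv₀ hd).congr fun w => ?_
    rw [slope_def_field, hS, sub_zero, inv_div, div_eq_mul_inv]
  have h5 : (deriv (S22 ε f f' h) z)⁻¹ • mMinus ε f f' h 0 z x = c • mPlus ε f f' h 1 z x := by
    have hp := phase_zero_mul_phase_one ε z x
    rw [← phase_smul_jMinus, ← phase_smul_jPlus, hf.jMinus_eq_smul hε hz hS, hc,
      modifiedProportionality, smul_smul, smul_smul, smul_smul]
    congr 1
    rw [div_eq_mul_inv]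
    linear_combination (-proportionality ε f f' h z * (deriv (S22 ε f f' h) z)⁻¹ *
      phase ε z 0 x) * hp
  refine ⟨ofCols (c • mPlus ε f f' h 1 z x) 0, ?_, ?_⟩
  · have h6 : Tendsto (fun w => w - z) (𝓝[≠] z) (𝓝 0) := by
      have : Continuous fun w : ℂ => w - z := by fun_prop
      exact (by simpa using this.tendsto z : Tendsto (fun w => w - z) (𝓝 z) (𝓝 0)).mono_left
        nhdsWithin_le_nhds
    have h7 := (continuous_ofCols.tendsto _).comp ((h3.smul h1).prodMk_nhds (h6.smul h2))
    rw [h5, zero_smul] at h7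
    refine h7.congr fun w => ?_
    ext i j
    fin_cases i <;> fin_cases j <;> simp [upperG, ofCols, mul_assoc]
  · have h7 := (continuous_ofCols.tendsto _).comp ((h2.const_smul c).prodMk_nhds
      (tendsto_const_nhds (x := (0 : Fin 2 → ℂ))))
    refine h7.congr fun w => ?_
    ext i j
    fin_cases i <;> fin_cases j <;>
      simp [upperG, ofCols, Matrix.mul_apply, Fin.sum_univ_two, mul_comm c]

theorem NicePotential.tendsto_upperG_cobounded (hf : NicePotential f f' h) (hε : 0 < ε) (x : ℝ) :
    Tendsto (upperG ε f f' h x) (Bornology.cobounded ℂ ⊓ 𝓟 {z | 0 ≤ z.im}) (𝓝 1) := by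
  have h1 := (continuous_ofCols.tendsto _).comp ((((hf.tendsto_S22_cobounded hε).inv₀
    one_ne_zero).smul (hf.tendsto_mMinus_zero_cobounded hε x)).prodMk_nhds
      (hf.tendsto_mPlus_one_cobounded hε x))
  have h2 : ofCols ((1 : ℂ)⁻¹ • Pi.single 0 1) (Pi.single 1 1) = 1 := by
    ext i j
    fin_cases i <;> fin_cases j <;> simp [ofCols]
  rw [h2] at h1
  exact h1

theorem flip_one : flip 1 = 1 := by
  ext i j
  fin_cases i <;> fin_cases j <;> simp [flip]

theorem flip_halfRotation (θ : ℝ) : flip (halfRotation θ) = halfRotation θ := by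
  ext i j
  fin_cases i <;> fin_cases j <;> simp [flip, halfRotation]

theorem phase_zero_sq_mul_exp (ε : ℝ) (z : ℂ) (x t : ℝ) (c : ℂ) :
    c * Complex.exp (2 * Complex.I * (D z * t) / ε) * (phase ε z 0 x * phase ε z 0 x) =
      c * Complex.exp (2 * Complex.I * (E z * x + D z * t) / ε) := by
  rw [phase, ← Complex.exp_add, mul_assoc, ← Complex.exp_add]
  congr 2
  simp only [sgn, Matrix.cons_val_zero]
  ring

theorem conj_exp_of_real (ε s x t : ℝ) :
    conj (Complex.exp (2 * Complex.I * (E s * x + D s * t) / ε)) =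
      Complex.exp (-(2 * Complex.I * (E s * x + D s * t)) / ε) := by
  rw [← Complex.exp_conj]
  congr 1
  simp [E, D, map_ofNat]

/-- For real s the x- and t-exponentials have modulus 1, so a time factor can be moved between ρ and
the exponential without changing |ρ|². -/
theorem jump_eq (ε : ℝ) (ρ : ℝ → ℂ) (x t : ℝ) {s : ℝ} (hs : s ≠ 0) {r : ℂ}
    (hr : ρ s * Complex.exp (2 * Complex.I * (D s * t) / ε) = r) :
    jump ε ρ x t s = !![1 + r * conj r, -(conj r * (phase ε s 1 x * phase ε s 1 x));
      -(r * (phase ε s 0 x * phase ε s 0 x)), 1] := by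
  have h1 := phase_zero_sq_mul_exp ε s x t (ρ s)
  rw [hr] at h1
  have hp := phase_zero_mul_phase_one ε s x
  have hpc : conj (phase ε s 0 x) = phase ε s 1 x := by
    rw [← phase_neg_conj, Complex.conj_ofReal, phase_neg']
  have h2 := congrArg conj h1
  simp only [map_mul, hpc, conj_exp_of_real] at h2
  have h3 : (‖ρ s‖ : ℂ) ^ 2 = r * conj r := by
    rw [Complex.mul_conj']
    congr 2
    have h4 : ‖r * (phase ε s 0 x * phase ε s 0 x)‖ = ‖r‖ := by
      have h5 : ‖phase ε s 0 x‖ = 1 := by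
        have h6 : ‖phase ε s 0 x‖ * ‖phase ε s 0 x‖ = 1 := by
          have h7 := congrArg norm hp
          rwa [← hpc, norm_mul, RCLike.norm_conj, norm_one] at h7
        nlinarith [norm_nonneg (phase ε s 0 x)]
      rw [norm_mul, norm_mul, h5, mul_one, mul_one]
    have h8 : ‖Complex.exp (2 * Complex.I * (E s * x + D s * t) / ε)‖ = 1 := by
      have h9 : 2 * Complex.I * (E s * x + D s * t) / ε =
          ((2 * ((s - s⁻¹) / 4 * x + (s + s⁻¹) / 4 * t) / ε : ℝ) : ℂ) * Complex.I := by
        simp only [E, D]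
        push_cast
        ring
      rw [h9, Complex.norm_exp_ofReal_mul_I]
    rw [← h4, h1, norm_mul, h8, mul_one]
  rw [jump, if_neg hs, h1, h2, h3]

/-- `G` at time `t` solves the Riemann-Hilbert problem with data which differ from the scattering
data at time `t` by the factor `exp(2iDt/ε)`. -/
theorem NicePotential.solvesRHP (hf : NicePotential f f' h) (hε : 0 < ε)
    (hsimple : ∀ z : ℂ, 0 < z.im → S22 ε f f' h z = 0 → deriv (S22 ε f f' h) z ≠ 0)
    (hreal : ∀ s : ℝ, s ≠ 0 → S22 ε f f' h s ≠ 0) {ρ : ℝ → ℂ} {Z : Set ℂ} {c₀ : ℂ → ℂ} {t : ℝ}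
    (hZ : Z = eigenvalues ε f f' h)
    (hρ : ∀ s : ℝ, s ≠ 0 →
      ρ s * Complex.exp (2 * Complex.I * (D s * t) / ε) = reflection ε f f' h s)
    (hc : ∀ z ∈ Z, c₀ z * Complex.exp (2 * Complex.I * (D z * t) / ε) =
      modifiedProportionality ε f f' h z) (x : ℝ) :
    SolvesRHP ε ρ Z c₀ x t (G ε f f' h x) := by
  subst hZ
  refine ⟨?_, ?_, ?_, ?_, ?_⟩
  · have h1 : cocompact ℂ ⊓ 𝓟 (domain (eigenvalues ε f f' h)) ≤
        (Bornology.cobounded ℂ ⊓ 𝓟 {z | 0 < z.im}) ⊔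
          (Bornology.cobounded ℂ ⊓ 𝓟 {z | z.im < 0}) := by
      rw [← inf_sup_left, sup_principal, Metric.cobounded_eq_cocompact]
      refine inf_le_inf_left _ (principal_mono.2 fun z hz => ?_)
      rcases lt_or_gt_of_ne hz.1 with h2 | h2
      · exact Or.inr h2
      · exact Or.inl h2
    refine Tendsto.mono_left ?_ h1
    have h2 := hf.tendsto_upperG_cobounded hε x
    refine tendsto_sup.2 ⟨?_, ?_⟩
    · refine (h2.mono_left (inf_le_inf_left _ (principal_mono.2 fun z hz => (le_of_lt hz : (0 : ℝ) ≤ z.im)))).congr' ?_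
      filter_upwards [mem_inf_of_right (mem_principal_self _)] with z hz
      exact (G_of_im_pos x hz).symm
    · have h3 : Tendsto (fun z : ℂ => -z) (Bornology.cobounded ℂ ⊓ 𝓟 {z | z.im < 0})
          (Bornology.cobounded ℂ ⊓ 𝓟 {z | 0 ≤ z.im}) := by
        refine tendsto_inf.2 ⟨tendsto_neg_cobounded.mono_left inf_le_left,
          tendsto_principal.2 ?_⟩
        filter_upwards [mem_inf_of_right (mem_principal_self _)] with z hz
        have hz : z.im < 0 := hz
        change 0 ≤ (-z).im
        simpa using hz.le
      have h4 := (continuous_flip.tendsto _).comp (h2.comp h3)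
      rw [flip_one] at h4
      refine h4.congr' ?_
      filter_upwards [mem_inf_of_right (mem_principal_self _)] with z hz
      have hz : z.im < 0 := hz
      exact (hf.G_eventuallyEq_flip hε x hz).eq_of_nhds.symm
  · intro z hz i j
    rcases lt_or_gt_of_ne hz.1 with h1 | h1
    · have h2 : 0 < (-z).im := by simpa using h1
      have h3 := hf.analyticAt_upperG hε h2 ((hf.mem_domain_iff hε h2).1 (neg_mem_domain.2 hz)) x
        (1 - i) (1 - j)
      have h4 : AnalyticAt ℂ (fun w => upperG ε f f' h x (-w) (1 - i) (1 - j)) z :=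
        AnalyticAt.fun_comp h3 (analyticAt_id.neg : AnalyticAt ℂ (fun w : ℂ => -w) z)
      refine ((analyticAt_const (v := if i = j then 1 else -1)).mul h4).congr ?_
      filter_upwards [hf.G_eventuallyEq_flip hε x h1] with w hw
      rw [hw, flip_apply]
      rfl
    · refine (hf.analyticAt_upperG hε h1 ((hf.mem_domain_iff hε h1).1 hz) x i j).congr ?_
      filter_upwards [NicePotential.G_eventuallyEq x h1] with w hw
      rw [hw]
  · intro z hz i j
    refine AtMostSimplePole.meromorphic ?_
    rcases lt_or_gt_of_ne hz with h1 | h1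
    · have h2 : 0 < (-z).im := by simpa using h1
      refine ((hf.atMostSimplePole_upperG hε h2 (hsimple _ h2) x (1 - i) (1 - j)).neg_comp
        (if i = j then 1 else -1)).congr ?_
      filter_upwards [(hf.G_eventuallyEq_flip hε x h1).filter_mono nhdsWithin_le_nhds] with w hw
      rw [hw, flip_apply]
    · refine (hf.atMostSimplePole_upperG hε h1 (hsimple _ h1) x i j).congr ?_
      filter_upwards [(NicePotential.G_eventuallyEq x h1).filter_mono nhdsWithin_le_nhds] with w hw
      rw [hw]
  · intro z hz
    have hneg : ∀ w : ℂ, 0 < w.im → ∀ᶠ ζ in 𝓝[≠] w,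
        G ε f f' h x (-ζ) = flip (G ε f f' h x ζ) := fun w hw => by
      filter_upwards [mem_nhdsWithin_of_mem_nhds (isOpen_upperHalfPlane.mem_nhds hw)] with ζ hζ
      rw [hf.G_neg hε x hζ, G_of_im_pos x hζ]
    have hconj : ∀ᶠ ζ in 𝓝[≠] z,
        G ε f f' h x (-conj ζ) = (G ε f f' h x ζ).map conj := by
      filter_upwards [mem_nhdsWithin_of_mem_nhds (isOpen_upperHalfPlane.mem_nhds hz.1)] with ζ hζ
      have hζ : 0 < ζ.im := hζ
      rw [G_of_im_pos x hζ, G_of_im_pos x (by simpa using hζ),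
        hf.upperG_conj hε (ne_zero_of_im_pos hζ) hζ.le]
    -- One residue is computed; the symmetries z ↦ -z, z ↦ -z̄ and their composition give the other
    -- three. On the imaginary axis z = -z̄, and both resulting conditions at that point hold.
    have h1 := (hf.residue_upperG hε hz.1 hz.2.2 (hsimple z hz.1 hz.2.2) x).congr
      ((NicePotential.G_eventuallyEq x hz.1).symm.filter_mono nhdsWithin_le_nhds)
    rw [← hc z hz, phase_zero_sq_mul_exp] at h1
    change ResidueCondition _ z !![0, 0; residueConst ε c₀ x t z, 0] at h1
    have h2 := h1.neg (hneg z hz.1)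
    have h3 := h1.neg_conj hconj
    have h4 := h3.neg (hneg (-conj z) (by simpa using hz.1))
    rw [neg_neg] at h4
    refine ⟨h1, ?_, ?_, ?_⟩
    · convert h3 using 1
      ext i j
      fin_cases i <;> fin_cases j <;> simp
    · convert h2 using 1
      ext i j
      fin_cases i <;> fin_cases j <;> simp [flip]
    · convert h4 using 1
      ext i j
      fin_cases i <;> fin_cases j <;> simp [flip]
  -- The upper boundary values, with the limiting rotation inserted at z = 0, form one continuous
  -- function. The lower ones are its `flip` at -s. Rotations are fixed by `flip`, so the two agree
  -- at s = 0.
  · obtain ⟨σ, τ, hσ, hτ, -, h0⟩ := hf.exists_tendsto_nhds_zero hε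
    set M := τ • halfRotation (f x) with hM
    have hc1 : ∀ s : ℝ, ContinuousWithinAt (closedG ε f f' h x M) {z | 0 ≤ z.im} s := fun s =>
      continuousWithinAt_closedG (h0 x) fun hs =>
        hf.continuousWithinAt_upperG hε hs (by simp) (hreal s (by exact_mod_cast hs)) x
    have hc2 : Continuous fun s : ℝ => closedG ε f f' h x M s :=
      continuous_iff_continuousAt.2 fun s => by
        have h1 : Tendsto (fun s : ℝ => (s : ℂ)) (𝓝 s) (𝓝[{z | 0 ≤ z.im}] (s : ℂ)) :=
          tendsto_nhdsWithin_iff.2 ⟨Complex.continuous_ofReal.tendsto s,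
            Eventually.of_forall fun r => (Complex.ofReal_im r).ge⟩
        exact Tendsto.comp (hc1 s) h1
    refine ⟨fun s => closedG ε f f' h x M s, fun s => flip (closedG ε f f' h x M ((-s : ℝ) : ℂ)),
      hc2, continuous_flip.comp (hc2.comp continuous_neg), fun s => ?_, fun s => ?_, fun s => ?_⟩
    · have h1 : {z : ℂ | 0 < z.im} ∩ domain (eigenvalues ε f f' h) ⊆ {z : ℂ | 0 ≤ z.im} :=
        fun z hz => (le_of_lt hz.1 : (0 : ℝ) ≤ z.im)
      refine Tendsto.congr' ?_ ((hc1 s).tendsto.mono_left (nhdsWithin_mono _ h1))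
      filter_upwards [self_mem_nhdsWithin] with z hz
      rw [G_of_im_pos x hz.1, closedG, if_neg (ne_zero_of_im_pos hz.1)]
    · have h2 : Tendsto (fun z : ℂ => -z) (𝓝[{z | z.im < 0} ∩ domain (eigenvalues ε f f' h)] s)
          (𝓝[{z | 0 ≤ z.im}] ((-s : ℝ) : ℂ)) := by
        refine tendsto_nhdsWithin_iff.2 ⟨?_, ?_⟩
        · have h3 : Tendsto (fun z : ℂ => -z) (𝓝 (s : ℂ)) (𝓝 (-(s : ℂ))) := tendsto_id.neg
          rw [← Complex.ofReal_neg] at h3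
          exact h3.mono_left nhdsWithin_le_nhds
        · filter_upwards [self_mem_nhdsWithin] with z hz
          have hz : z.im < 0 := hz.1
          change 0 ≤ (-z).im
          simpa using hz.le
      refine ((continuous_flip.tendsto _).comp ((hc1 (-s)).tendsto.comp h2)).congr' ?_
      filter_upwards [self_mem_nhdsWithin] with z hz
      have hz' : z.im < 0 := hz.1
      have hz0 : -z ≠ 0 := fun h0 => by
        rw [neg_eq_zero] at h0
        simp [h0] at hz'
      rw [(hf.G_eventuallyEq_flip hε x hz').eq_of_nhds, Function.comp_apply, Function.comp_apply,
        closedG, if_neg hz0]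
    · by_cases hs : s = 0
      · subst hs
        simp only [Complex.ofReal_zero, neg_zero, closedG, if_true, jump, mul_one]
        rw [hM, flip_smul, flip_halfRotation]
      · have hs' : (s : ℂ) ≠ 0 := by exact_mod_cast hs
        have hs2 : ((-s : ℝ) : ℂ) ≠ 0 := by exact_mod_cast neg_ne_zero.2 hs
        have h1 := hf.upperG_conj hε hs' (by simp) x
        rw [Complex.conj_ofReal, ← Complex.ofReal_neg] at h1
        simp only [closedG, if_neg hs', if_neg hs2]
        rw [h1, jump_eq ε ρ x t hs (hρ s hs)]
        exact hf.jump_relation hε hs (hreal s hs) x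

end

/-! ### A Liouville theorem for functions defined off the real axis and isolated points -/

/-- Painlevé's theorem by Morera. Cauchy's theorem for a rectangle needs continuity up to the
boundary but differentiability only inside, so it holds for rectangles with one side on the real
axis. An arbitrary wedge integral is assembled from two of these. -/
theorem differentiable_of_off_real {F : ℂ → ℂ} (hc : Continuous F)
    (hd : ∀ z : ℂ, z.im ≠ 0 → DifferentiableAt ℂ F z) : Differentiable ℂ F := by
  have h1 : ∀ a b c d : ℝ, c = 0 ∨ d = 0 →
      (∫ x : ℝ in a..b, F (x + c * Complex.I)) - (∫ x : ℝ in a..b, F (x + d * Complex.I)) +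
        Complex.I • (∫ y : ℝ in c..d, F (b + y * Complex.I)) -
        Complex.I • (∫ y : ℝ in c..d, F (a + y * Complex.I)) = 0 := by
    intro a b c d hcd
    have h2 := Complex.integral_boundary_rect_eq_zero_of_continuousOn_of_differentiableOn F
      (a + c * Complex.I) (b + d * Complex.I) hc.continuousOn fun z hz => by
        refine (hd z fun h0 => ?_).differentiableWithinAt
        have h3 := hz.2
        simp only [mem_preimage, h0] at h3
        simp at h3
        rcases hcd with rfl | rfl <;> rcases h3 with ⟨h3 | h3, h4 | h4⟩ <;> linarith
    simpa using h2
  have hcons : Complex.IsConservativeOn F univ := by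
    intro z w _
    rw [← add_eq_zero_iff_eq_neg, Complex.wedgeIntegral_add_wedgeIntegral_eq]
    have h2 := h1 z.re w.re z.im 0 (Or.inr rfl)
    have h3 := h1 z.re w.re 0 w.im (Or.inl rfl)
    have hi : ∀ a b c : ℝ, IntervalIntegrable (fun y : ℝ => F (a + y * Complex.I)) volume b c :=
      fun a b c => Continuous.intervalIntegrable (by fun_prop) _ _
    rw [← intervalIntegral.integral_add_adjacent_intervals (hi w.re z.im 0) (hi w.re 0 w.im),
      ← intervalIntegral.integral_add_adjacent_intervals (hi z.re z.im 0) (hi z.re 0 w.im)]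
    simp only [smul_eq_mul] at h2 h3 ⊢
    linear_combination h2 + h3
  exact differentiableOn_univ.1
    ((hcons.isExactOn_univ hc).differentiableOn isOpen_univ)

theorem dense_im_ne_zero : Dense {z : ℂ | z.im ≠ 0} := by
  refine Dense.preimage (s := {r : ℝ | r ≠ 0}) ?_ Complex.isOpenMap_im
  exact dense_compl_singleton 0

/-- Extend F by its limits to all of ℂ. Points missing off the axis are removable singularities, the
axis is crossed by `differentiable_of_off_real`, and Liouville's theorem applies because the limit
at infinity survives the extension. -/
theorem eq_const_of_tendsto {A : Set ℂ} {F : ℂ → ℂ} {c : ℂ} (hA : ∀ z ∈ A, z.im ≠ 0)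
    (hA' : ∀ w : ℂ, w.im ≠ 0 → ∀ᶠ z in 𝓝[≠] w, z ∈ A)
    (hlim : ∀ w, ∃ L, Tendsto F (𝓝[A] w) (𝓝 L)) (hd : ∀ z ∈ A, DifferentiableAt ℂ F z)
    (hinf : Tendsto F (cocompact ℂ ⊓ 𝓟 A) (𝓝 c)) {z : ℂ} (hz : z ∈ A) : F z = c := by
  have hopen : ∀ z ∈ A, A ∈ 𝓝 z := fun z hz => by
    have h1 := hA' z (hA z hz)
    rw [eventually_nhdsWithin_iff] at h1
    filter_upwards [h1] with w hw
    by_cases h0 : w = z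
    · rwa [h0]
    · exact hw h0
  have hdense : Dense A := by
    have h1 : {z : ℂ | z.im ≠ 0} ⊆ closure A := fun z hz => by
      have h2 := mem_closure_of_tendsto (tendsto_id.mono_left (nhdsWithin_le_nhds (s := {z}ᶜ)))
        (hA' z hz)
      exact h2
    intro z
    have h2 := closure_mono h1 (dense_im_ne_zero z)
    rwa [closure_closure] at h2
  set K := extendFrom A F with hK
  have hKc : Continuous K := continuous_extendFrom hdense hlim
  have hKA : ∀ z ∈ A, K z = F z := extendFrom_extends
    fun z hz => (hd z hz).continuousAt.continuousWithinAt
  have hKd : ∀ z ∈ A, DifferentiableAt ℂ K z := fun z hz => by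
    refine (hd z hz).congr_of_eventuallyEq ?_
    filter_upwards [hopen z hz] with w hw
    exact hKA w hw
  have hdiff : Differentiable ℂ K := by
    refine differentiable_of_off_real hKc fun z hz => ?_
    refine (Complex.analyticAt_of_differentiable_on_punctured_nhds_of_continuousAt ?_
      hKc.continuousAt).differentiableAt
    filter_upwards [hA' z hz] with w hw
    exact hKd w hw
  rw [← hKA z hz]
  refine hdiff.apply_eq_of_tendsto_cocompact z ?_
  -- Closed neighbourhoods are used because a value of the extension is only a limit of values of F.
  refine (closed_nhds_basis c).tendsto_right_iff.2 fun V hV => ?_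
  have h1 := hinf hV.1
  rw [mem_map, mem_inf_principal] at h1
  obtain ⟨C, hC, h2⟩ := mem_cocompact.1 h1
  filter_upwards [hC.compl_mem_cocompact] with w hw
  have : (𝓝[A] w).NeBot := mem_closure_iff_nhdsWithin_neBot.1 (hdense w)
  refine hV.2.mem_of_tendsto (tendsto_extendFrom (hlim w)) ?_
  filter_upwards [self_mem_nhdsWithin,
    mem_nhdsWithin_of_mem_nhds (hC.isClosed.isOpen_compl.mem_nhds hw)] with y h3 h4
  exact h2 h4 h3

/-! ### Uniqueness for the Riemann-Hilbert problem -/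

/-- The order of (z - w)F is positive, so that of F exceeds -1 and is therefore nonnegative. -/
theorem exists_tendsto_of_mul_tendsto_zero {F : ℂ → ℂ} {w : ℂ} (hF : MeromorphicAt F w)
    (h0 : Tendsto (fun z => (z - w) * F z) (𝓝[≠] w) (𝓝 0)) :
    ∃ L, Tendsto F (𝓝[≠] w) (𝓝 L) := by
  refine tendsto_nhds_of_meromorphicOrderAt_nonneg hF ?_
  have h1 : MeromorphicAt (fun z : ℂ => z - w) w := by fun_prop
  have h2 : 0 < meromorphicOrderAt ((fun z : ℂ => z - w) * F) w :=
    (tendsto_zero_iff_meromorphicOrderAt_pos (h1.mul hF)).1 h0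
  rw [meromorphicOrderAt_mul h1 hF, meromorphicOrderAt_id_sub_const] at h2
  cases h3 : meromorphicOrderAt F w with
  | top => simp
  | coe n =>
    rw [h3] at h2
    have h4 : (0 : ℤ) < 1 + n := by exact_mod_cast h2
    have h5 : (0 : ℤ) ≤ n := by omega
    exact_mod_cast h5

/-- Multiplication by `1 - C / (z - w)` removes the pole. -/
theorem ResidueCondition.exists_tendsto {H : ℂ → Matrix (Fin 2) (Fin 2) ℂ} {w : ℂ}
    {C : Matrix (Fin 2) (Fin 2) ℂ} (hH : ResidueCondition H w C)
    (hm : ∀ i j, MeromorphicAt (fun z => H z i j) w) :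
    ∃ L, Tendsto (fun z => H z * (1 - (z - w)⁻¹ • C)) (𝓝[≠] w) (𝓝 L) := by
  obtain ⟨R, h1, h2⟩ := hH
  have h3 : ∀ i j, ∃ L, Tendsto (fun z => (H z * (1 - (z - w)⁻¹ • C)) i j) (𝓝[≠] w) (𝓝 L) := by
    intro i j
    refine exists_tendsto_of_mul_tendsto_zero ?_ ?_
    · have h4 : (fun z => (H z * (1 - (z - w)⁻¹ • C)) i j) = fun z =>
          H z i j - (z - w)⁻¹ * (H z i 0 * C 0 j + H z i 1 * C 1 j) := by
        funext z
        rw [mul_sub, mul_one, Matrix.mul_smul, Matrix.sub_apply, Matrix.smul_apply,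
          Matrix.mul_apply, Fin.sum_univ_two, smul_eq_mul]
      rw [h4]
      have h5 := hm i j
      have h6 := hm i 0
      have h7 := hm i 1
      fun_prop
    -- Multiplied by z - w, the product becomes (z - w)H - HC, a difference of two expressions with
    -- the same limit by the residue condition.
    · have h4 := h1.sub h2
      rw [sub_self] at h4
      have h5 := ((continuous_apply_apply i j).tendsto _).comp h4
      refine h5.congr' ?_
      filter_upwards [self_mem_nhdsWithin] with z hz
      have hz : z - w ≠ 0 := sub_ne_zero.2 hz
      simp only [mul_sub, mul_one, Matrix.mul_smul, Matrix.sub_apply,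
        Matrix.smul_apply, smul_eq_mul]
      rw [mul_inv_cancel_left₀ hz]
      rfl
  choose L hL using h3
  exact ⟨L, tendsto_pi_nhds.2 fun i => tendsto_pi_nhds.2 fun j => hL i j⟩

/-- A common right factor of determinant 1 cancels. This serves both for the jump matrix and for the
factors that remove the poles. -/
theorem mul_adjugate_gauge {A B P : Matrix (Fin 2) (Fin 2) ℂ} (hP : P.det = 1) :
    A * P * (B * P).adjugate = A * B.adjugate := by
  rw [Matrix.adjugate_mul_distrib, mul_assoc, ← mul_assoc P, Matrix.mul_adjugate, hP, one_smul,
    one_mul]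

theorem det_jump (ε : ℝ) (ρ : ℝ → ℂ) (x t s : ℝ) : (jump ε ρ x t s).det = 1 := by
  rw [jump]
  split_ifs
  · simp
  · rw [Matrix.det_fin_two_of, ← Complex.mul_conj']
    have h1 : Complex.exp (-(2 * Complex.I * (E s * x + D s * t)) / ε) *
        Complex.exp (2 * Complex.I * (E s * x + D s * t) / ε) = 1 := by
      rw [← Complex.exp_add, ← Complex.exp_zero]
      congr 1
      ring
    linear_combination (-ρ s * conj (ρ s)) * h1

theorem ResidueCondition.exists_tendsto_mul_adjugate {H G : ℂ → Matrix (Fin 2) (Fin 2) ℂ} {w : ℂ}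
    {C : Matrix (Fin 2) (Fin 2) ℂ} (hH : ResidueCondition H w C) (hG : ResidueCondition G w C)
    (hHm : ∀ i j, MeromorphicAt (fun z => H z i j) w)
    (hGm : ∀ i j, MeromorphicAt (fun z => G z i j) w) (hC : ∀ a : ℂ, (1 - a • C).det = 1) :
    ∃ L, Tendsto (fun z => H z * (G z).adjugate) (𝓝[≠] w) (𝓝 L) := by
  obtain ⟨L, hL⟩ := hH.exists_tendsto hHm
  obtain ⟨L', hL'⟩ := hG.exists_tendsto hGm
  have h1 : Continuous fun q : Matrix (Fin 2) (Fin 2) ℂ × Matrix (Fin 2) (Fin 2) ℂ =>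
      q.1 * q.2.adjugate := continuous_fst.matrix_mul continuous_snd.matrix_adjugate
  refine ⟨_, ((h1.tendsto (L, L')).comp (hL.prodMk_nhds hL')).congr fun z => ?_⟩
  exact mul_adjugate_gauge (hC _)

/-- Two solutions of the Riemann-Hilbert problem with isolated poles agree if the second has
determinant `1`. -/
theorem SolvesRHP.eqOn {ε : ℝ} {ρ : ℝ → ℂ} {Z : Set ℂ} {c₀ : ℂ → ℂ} {x t : ℝ}
    {H G : ℂ → Matrix (Fin 2) (Fin 2) ℂ} (hH : SolvesRHP ε ρ Z c₀ x t H)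
    (hG : SolvesRHP ε ρ Z c₀ x t G) (hdet : ∀ z ∈ domain Z, (G z).det = 1)
    (hZ : ∀ w : ℂ, w.im ≠ 0 → ∀ᶠ z in 𝓝[≠] w, z ∈ domain Z) : EqOn H G (domain Z) := by
  have hcont : Continuous fun q : Matrix (Fin 2) (Fin 2) ℂ × Matrix (Fin 2) (Fin 2) ℂ =>
      q.1 * q.2.adjugate := continuous_fst.matrix_mul continuous_snd.matrix_adjugate
  set F : ℂ → Matrix (Fin 2) (Fin 2) ℂ := fun z => H z * (G z).adjugate with hF
  have hana : ∀ z ∈ domain Z, ∀ i j, DifferentiableAt ℂ (fun w => F w i j) z := by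
    intro z hz i j
    have h1 := fun i j => (hH.analytic z hz i j).differentiableAt
    have h2 := fun i j => (hG.analytic z hz i j).differentiableAt
    simp only [hF, Matrix.mul_apply, Fin.sum_univ_two, Matrix.adjugate_fin_two]
    fin_cases j
    · exact ((h1 _ _).mul (h2 1 1)).add ((h1 _ _).mul (h2 1 0).fun_neg)
    · exact ((h1 _ _).mul (h2 0 1).fun_neg).add ((h1 _ _).mul (h2 0 0))
  have hlim : ∀ w, ∃ L, Tendsto F (𝓝[domain Z] w) (𝓝 L) := by
    intro w
    by_cases hw : w.im = 0
    · obtain ⟨Hp, Hm, -, -, h1, h2, h3⟩ := hH.boundary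
      obtain ⟨Gp, Gm, -, -, h4, h5, h6⟩ := hG.boundary
      obtain ⟨s, rfl⟩ : ∃ s : ℝ, (s : ℂ) = w := ⟨w.re, by apply Complex.ext <;> simp [hw]⟩
      have h7 : domain Z = ({z | 0 < z.im} ∩ domain Z) ∪ ({z | z.im < 0} ∩ domain Z) := by
        rw [← union_inter_distrib_right, eq_comm, inter_eq_right]
        intro z hz
        rcases lt_or_gt_of_ne hz.1 with h | h
        · exact Or.inr h
        · exact Or.inl h
      refine ⟨Hp s * (Gp s).adjugate, ?_⟩
      rw [h7, nhdsWithin_union]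
      refine tendsto_sup.2 ⟨(hcont.tendsto _).comp ((h1 s).prodMk_nhds (h4 s)), ?_⟩
      -- The boundary values of H·adj(G) from the two sides coincide, since both factors are
      -- multiplied by the same V with det V = 1.
      rw [h3, h6, mul_adjugate_gauge (det_jump ..)]
      exact (hcont.tendsto _).comp ((h2 s).prodMk_nhds (h5 s))
    · by_cases hwd : w ∈ domain Z
      · refine ⟨F w, tendsto_pi_nhds.2 fun i => tendsto_pi_nhds.2 fun j => ?_⟩
        exact (hana w hwd i j).continuousAt.continuousWithinAt
      · have hpole : w ∈ poles Z := by
          by_contra h0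
          exact hwd ⟨hw, h0⟩
        have hle : 𝓝[domain Z] w ≤ 𝓝[≠] w := nhdsWithin_mono _ fun z hz h0 => hwd (by
          rw [mem_singleton_iff] at h0
          rwa [← h0])
        have hHm := fun i j => (hH.meromorphic w hw i j).1
        have hGm := fun i j => (hG.meromorphic w hw i j).1
        suffices h1 : ∃ L, Tendsto F (𝓝[≠] w) (𝓝 L) by
          obtain ⟨L, hL⟩ := h1
          exact ⟨L, hL.mono_left hle⟩
        -- One case for each member of a quartet. In all four, C is strictly triangular, so 1 - aC
        -- has determinant 1 for every a.
        rcases hpole with h1 | h1 | h1 | h1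
        · exact (hH.residue w h1).1.exists_tendsto_mul_adjugate (hG.residue w h1).1 hHm hGm
            fun a => by simp [Matrix.det_fin_two]
        · have h2 := (hH.residue _ h1).2.1
          have h3 := (hG.residue _ h1).2.1
          simp only [map_neg, Complex.conj_conj, neg_neg] at h2 h3
          exact h2.exists_tendsto_mul_adjugate h3 hHm hGm fun a => by simp [Matrix.det_fin_two]
        · have h2 := (hH.residue _ h1).2.2.1
          have h3 := (hG.residue _ h1).2.2.1
          simp only [neg_neg] at h2 h3
          exact h2.exists_tendsto_mul_adjugate h3 hHm hGm fun a => by simp [Matrix.det_fin_two]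
        · have h2 := (hH.residue _ h1).2.2.2
          have h3 := (hG.residue _ h1).2.2.2
          simp only [Complex.conj_conj] at h2 h3
          exact h2.exists_tendsto_mul_adjugate h3 hHm hGm fun a => by simp [Matrix.det_fin_two]
  have hinf : Tendsto F (cocompact ℂ ⊓ 𝓟 (domain Z)) (𝓝 1) := by
    have h1 := (hcont.tendsto _).comp (hH.normalization.prodMk_nhds hG.normalization)
    simp only [Matrix.adjugate_one, mul_one] at h1
    exact h1
  intro z hz
  have h1 : F z = 1 := by
    ext i j
    refine eq_const_of_tendsto (A := domain Z) (F := fun w => F w i j) (fun w hw => hw.1) hZ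
      (fun w => ?_) (fun w hw => hana w hw i j)
      (((continuous_apply_apply i j).tendsto _).comp hinf) hz
    obtain ⟨L, hL⟩ := hlim w
    exact ⟨L i j, ((continuous_apply_apply i j).tendsto _).comp hL⟩
  have h2 : F z * G z = H z := by
    rw [hF, mul_assoc, Matrix.adjugate_mul, hdet z hz, one_smul, mul_one]
  rw [← h2, h1, one_mul]

section

variable {f f' h : ℝ → ℝ} {ε : ℝ} {z : ℂ}

theorem det_flip (M : Matrix (Fin 2) (Fin 2) ℂ) : (flip M).det = M.det := by
  simp [flip, Matrix.det_fin_two]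
  ring

theorem NicePotential.det_G (hf : NicePotential f f' h) (hε : 0 < ε) (x : ℝ)
    (hz : z ∈ domain (eigenvalues ε f f' h)) : (G ε f f' h x z).det = 1 := by
  rcases lt_or_gt_of_ne hz.1 with h1 | h1
  · have h2 : 0 < (-z).im := by simpa using h1
    rw [(hf.G_eventuallyEq_flip hε x h1).eq_of_nhds, det_flip]
    exact hf.det_upperG hε (ne_zero_of_im_pos h2) h2.le
      ((hf.mem_domain_iff hε h2).1 (neg_mem_domain.2 hz)) x
  · rw [G_of_im_pos x h1]
    exact hf.det_upperG hε (ne_zero_of_im_pos h1) h1.le ((hf.mem_domain_iff hε h1).1 hz) x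

/-- A simple zero is isolated, so near any point off the real axis there is no other eigenvalue.
This includes the lower half-plane, by negation. -/
theorem NicePotential.eventually_mem_domain (hf : NicePotential f f' h) (hε : 0 < ε)
    (hsimple : ∀ z : ℂ, 0 < z.im → S22 ε f f' h z = 0 → deriv (S22 ε f f' h) z ≠ 0)
    (hz : z.im ≠ 0) : ∀ᶠ w in 𝓝[≠] z, w ∈ domain (eigenvalues ε f f' h) := by
  have h1 : ∀ z : ℂ, 0 < z.im → ∀ᶠ w in 𝓝[≠] z, w ∈ domain (eigenvalues ε f f' h) := by
    intro z hz
    have ho := isOpen_upperHalfPlane.mem_nhds hz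
    have hd := (hf.differentiableOn_S22 hε).differentiableAt ho
    have h2 : ∀ᶠ w in 𝓝[≠] z, S22 ε f f' h w ≠ 0 := by
      by_cases h0 : S22 ε f f' h z = 0
      · exact hd.hasDerivAt.eventually_ne (hsimple z hz h0)
      · exact (hd.continuousAt.eventually_ne h0).filter_mono nhdsWithin_le_nhds
    filter_upwards [h2, mem_nhdsWithin_of_mem_nhds ho] with w h3 h4
    exact (hf.mem_domain_iff hε h4).2 h3
  rcases lt_or_gt_of_ne hz with h2 | h2
  · have h3 := tendsto_neg_nhdsNE (-z)
    rw [neg_neg] at h3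
    filter_upwards [h3.eventually (h1 (-z) (by simpa using h2))] with w hw
    exact neg_mem_domain.1 hw
  · exact h1 z h2

end

/-! ### Weak derivatives -/

/-- Smooth functions with compact support. -/
def IsTest (φ : ℝ → ℝ) : Prop := ContDiff ℝ ∞ φ ∧ HasCompactSupport φ

theorem IsTest.continuous {φ : ℝ → ℝ} (hφ : IsTest φ) : Continuous φ := hφ.1.continuous

theorem IsTest.test_deriv {φ : ℝ → ℝ} (hφ : IsTest φ) : IsTest (deriv φ) :=
  ⟨(contDiff_infty_iff_deriv.1 hφ.1).2, hφ.2.deriv⟩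

theorem IsTest.hasDerivAt {φ : ℝ → ℝ} (hφ : IsTest φ) (x : ℝ) : HasDerivAt φ (deriv φ x) x :=
  (hφ.1.differentiable (by simp) x).hasDerivAt

theorem IsTest.integrable_mul {φ w : ℝ → ℝ} (hφ : IsTest φ) (hw : LocallyIntegrable w) :
    Integrable fun x => w x * φ x := by
  simpa only [smul_eq_mul, mul_comm] using
    hw.integrable_smul_left_of_hasCompactSupport hφ.continuous hφ.2

theorem IsTest.exists_bound {φ : ℝ → ℝ} (hφ : IsTest φ) :
    ∃ R : ℝ, 0 < R ∧ ∀ x, R ≤ |x| → φ x = 0 := by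
  obtain ⟨R, hR⟩ := hφ.2.isCompact.isBounded.subset_closedBall 0
  refine ⟨|R| + 1, by positivity, fun x hx => image_eq_zero_of_notMem_tsupport fun h0 => ?_⟩
  have h1 := hR h0
  rw [mem_closedBall_zero_iff, Real.norm_eq_abs] at h1
  linarith [le_abs_self R]

theorem IsTest.sub {φ ψ : ℝ → ℝ} (hφ : IsTest φ) (hψ : IsTest ψ) : IsTest (φ - ψ) :=
  ⟨hφ.1.sub hψ.1, hφ.2.sub hψ.2⟩

theorem IsTest.const_mul {φ : ℝ → ℝ} (hφ : IsTest φ) (c : ℝ) : IsTest fun x => c * φ x :=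
  ⟨contDiff_const.mul hφ.1, hφ.2.mul_left⟩

/-- Reflected translates of a test function. -/
theorem IsTest.comp_sub {φ : ℝ → ℝ} (hφ : IsTest φ) (x : ℝ) : IsTest fun y => φ (x - y) :=
  ⟨hφ.1.comp (contDiff_const.sub contDiff_id), hφ.2.comp_homeomorph (Homeomorph.subLeft x)⟩

/-- Integration by parts for absolutely continuous functions: the primitive of a locally integrable
g has derivative g almost everywhere by Lebesgue's differentiation theorem. -/
theorem integral_primitive_mul_deriv {g φ : ℝ → ℝ} (hg : LocallyIntegrable g) (hφ : IsTest φ) :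
    ∫ x, (∫ y in (0 : ℝ)..x, g y) * deriv φ x = -∫ x, g x * φ x := by
  obtain ⟨R, hR, h0⟩ := hφ.exists_bound
  obtain ⟨R', hR', h0'⟩ := hφ.test_deriv.exists_bound
  set S := max R R' with hS
  have hsupp : ∀ w ψ : ℝ → ℝ, (∀ x, S ≤ |x| → ψ x = 0) →
      ∫ x in (-S)..S, w x * ψ x = ∫ x, w x * ψ x := fun w ψ hψ => by
    refine intervalIntegral.integral_eq_integral_of_support_subset fun x hx => ?_
    have h1 : |x| < S := by
      by_contra! h2
      exact hx (by simp [hψ x h2])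
    exact ⟨(abs_lt.1 h1).1, (abs_lt.1 h1).2.le⟩
  have hφS : ∀ x, S ≤ |x| → φ x = 0 := fun x hx => h0 x ((le_max_left _ _).trans hx)
  have hφS' : ∀ x, S ≤ |x| → deriv φ x = 0 := fun x hx => h0' x ((le_max_right _ _).trans hx)
  have hSpos : 0 < S := lt_max_of_lt_left hR
  rw [← hsupp _ _ hφS', ← hsupp _ _ hφS]
  have hint : ∀ a b, IntervalIntegrable g volume a b := fun a b =>
    (hg.integrableOn_isCompact isCompact_uIcc).intervalIntegrable
  have hac := (hint (-S) S).absolutelyContinuousOnInterval_intervalIntegral (c := 0)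
    (by rw [uIcc_of_le (by linarith)]; exact ⟨by linarith, hSpos.le⟩)
  have hac' : AbsolutelyContinuousOnInterval φ (-S) S :=
    ((hφ.1.of_le (by exact_mod_cast le_top)).contDiffOn (n := 1)).absolutelyContinuousOnInterval
  rw [hac.integral_mul_deriv_eq_deriv_mul hac', hφS S (le_abs_self S),
    hφS (-S) (by rw [abs_neg]; exact le_abs_self S), mul_zero, mul_zero, sub_zero, zero_sub]
  congr 1
  refine intervalIntegral.integral_congr_ae ?_
  filter_upwards [LocallyIntegrable.ae_hasDerivAt_integral hg] with x hx _
  rw [(hx 0).deriv]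

theorem exists_isTest_integral_eq_one : ∃ η : ℝ → ℝ, IsTest η ∧ ∫ x, η x = 1 := by
  let b : ContDiffBump (0 : ℝ) := ⟨1, 2, one_pos, one_lt_two⟩
  exact ⟨b.normed volume, ⟨b.contDiff_normed, b.hasCompactSupport_normed⟩, b.integral_normed⟩

theorem IsTest.integrable {φ : ℝ → ℝ} (hφ : IsTest φ) : Integrable φ :=
  hφ.continuous.integrable_of_hasCompactSupport hφ.2

/-- The primitive starting to the left of the support is constant to the right of it, with value the
integral of k, which is 0. -/
theorem IsTest.exists_primitive {k : ℝ → ℝ} (hk : IsTest k) (h0 : ∫ x, k x = 0) :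
    ∃ Φ : ℝ → ℝ, IsTest Φ ∧ deriv Φ = k := by
  obtain ⟨R, hR, hk0⟩ := hk.exists_bound
  set Φ : ℝ → ℝ := fun x => ∫ y in (-R)..x, k y with hΦ
  have hd : ∀ x, HasDerivAt Φ (k x) x := fun x =>
    intervalIntegral.integral_hasDerivAt_right (hk.continuous.intervalIntegrable _ _)
      hk.continuous.stronglyMeasurable.stronglyMeasurableAtFilter hk.continuous.continuousAt
  have hd' : deriv Φ = k := funext fun x => (hd x).deriv
  have hzero : ∀ x, x ∉ Icc (-R) R → Φ x = 0 := by
    intro x hx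
    rw [mem_Icc, not_and_or, not_le, not_le] at hx
    rcases hx with hx | hx
    · have : ∀ y ∈ uIcc (-R) x, k y = 0 := fun y hy => by
        rw [uIcc_of_ge hx.le] at hy
        exact hk0 y (by rw [abs_of_neg (by linarith [hy.2])]; linarith [hy.2])
      rw [hΦ]
      exact (intervalIntegral.integral_congr this).trans (by simp)
    · rw [← h0]
      refine intervalIntegral.integral_eq_integral_of_support_subset fun y hy => ?_
      have h1 : |y| < R := by
        by_contra! h2
        exact hy (hk0 y h2)
      exact ⟨(abs_lt.1 h1).1, by linarith [(abs_lt.1 h1).2]⟩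
  refine ⟨Φ, ⟨contDiff_infty_iff_deriv.2 ⟨fun x => (hd x).differentiableAt, hd' ▸ hk.1⟩,
    HasCompactSupport.intro isCompact_Icc hzero⟩, hd'⟩

/-- The lemma of du Bois-Reymond. -/
theorem ae_eq_const_of_integral_mul_deriv {F : ℝ → ℝ} (hF : LocallyIntegrable F)
    (h : ∀ φ, IsTest φ → ∫ x, F x * deriv φ x = 0) : ∃ c : ℝ, F =ᵐ[volume] fun _ => c := by
  obtain ⟨η, hη, hη1⟩ := exists_isTest_integral_eq_one
  refine ⟨∫ x, F x * η x, ?_⟩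
  have h1 := ae_eq_zero_of_integral_contDiff_smul_eq_zero
    (hF.sub (locallyIntegrable_const (∫ x, F x * η x))) fun ψ hψ hψc => by
      have ht : IsTest ψ := ⟨hψ, hψc⟩
      -- Subtracting the multiple (∫ψ)η makes a test function mean-free, hence the derivative of a
      -- test function.
      obtain ⟨Φ, hΦ, hd⟩ := (ht.sub (hη.const_mul (∫ x, ψ x))).exists_primitive (by
        simp only [Pi.sub_apply]
        rw [integral_sub ht.integrable (hη.integrable.const_mul _), integral_const_mul, hη1,
          mul_one, sub_self])
      have h2 := h Φ hΦ
      have h3 : ∀ x, F x * deriv Φ x = F x * ψ x - (∫ x, ψ x) * (F x * η x) := fun x => by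
        rw [hd, Pi.sub_apply]
        ring
      simp only [h3] at h2
      rw [integral_sub (ht.integrable_mul hF) ((hη.integrable_mul hF).const_mul _),
        integral_const_mul] at h2
      have h4 : ∀ x, ψ x • (F - fun _ : ℝ => ∫ x, F x * η x) x =
          F x * ψ x - (∫ x, F x * η x) * ψ x := fun x => by
        simp only [Pi.sub_apply, smul_eq_mul]
        ring
      simp only [h4]
      rw [integral_sub (ht.integrable_mul hF) (ht.integrable.const_mul _), integral_const_mul]
      linarith
  filter_upwards [h1] with x hx
  simpa [sub_eq_zero] using hx

/-- A function with a locally integrable weak derivative is a.e. equal to a primitive of it. -/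
theorem HasWeakDeriv.exists_primitive {f g : ℝ → ℝ} (h : HasWeakDeriv f g) :
    ∃ c : ℝ, f =ᵐ[volume] fun x => c + ∫ y in (0 : ℝ)..x, g y := by
  obtain ⟨hf, hg, hfg⟩ := h
  have hint : ∀ a b, IntervalIntegrable g volume a b := fun a b =>
    (hg.integrableOn_isCompact isCompact_uIcc).intervalIntegrable
  have hG : Continuous fun x => ∫ y in (0 : ℝ)..x, g y := intervalIntegral.continuous_primitive hint 0
  obtain ⟨c, hc⟩ := ae_eq_const_of_integral_mul_deriv (hf.sub hG.locallyIntegrable) fun φ hφ => by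
    have h1 : ∀ x, (f - fun x => ∫ y in (0 : ℝ)..x, g y) x * deriv φ x =
        f x * deriv φ x - (∫ y in (0 : ℝ)..x, g y) * deriv φ x := fun x => by
      rw [Pi.sub_apply]
      ring
    simp only [h1]
    rw [integral_sub (hφ.test_deriv.integrable_mul hf)
      (hφ.test_deriv.integrable_mul hG.locallyIntegrable), hfg φ hφ.1 hφ.2,
      integral_primitive_mul_deriv hg hφ, sub_self]
  refine ⟨c, ?_⟩
  filter_upwards [hc] with x hx
  rw [← hx, Pi.sub_apply]
  ring

theorem continuous_primitive_of_locallyIntegrable {g : ℝ → ℝ} (hg : LocallyIntegrable g) (c : ℝ) :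
    Continuous fun x => c + ∫ y in (0 : ℝ)..x, g y :=
  continuous_const.add (intervalIntegral.continuous_primitive
    (fun _ _ => (hg.integrableOn_isCompact isCompact_uIcc).intervalIntegrable) 0)

/-! ### Mollification of weak solutions of transport equations -/

/-- The convolution of `w` with `φ`. -/
def mollify (φ w : ℝ → ℝ) (x : ℝ) : ℝ := ∫ y, w y * φ (x - y)

theorem hasDerivAt_mollify {φ w : ℝ → ℝ} (hφ : IsTest φ) (hw : LocallyIntegrable w) (x : ℝ) :
    HasDerivAt (mollify φ w) (mollify (deriv φ) w x) x :=
  hφ.2.hasDerivAt_convolution_right (ContinuousLinearMap.lsmul ℝ ℝ) hw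
    (hφ.1.of_le (by exact_mod_cast le_top)) x

/-- Test against φ(x - ·): differentiating it in y produces a minus sign, which cancels the one in
the definition of the weak derivative. -/
theorem HasWeakDeriv.mollify_deriv {f g φ : ℝ → ℝ} (h : HasWeakDeriv f g) (hφ : IsTest φ) (x : ℝ) :
    mollify (deriv φ) f x = mollify φ g x := by
  have h1 := h.2.2 _ (hφ.comp_sub x).1 (hφ.comp_sub x).2
  have h2 : ∀ y, deriv (fun y => φ (x - y)) y = -deriv φ (x - y) := fun y => by
    have h3 := ((hφ.hasDerivAt (x - y)).comp y ((hasDerivAt_id y).const_sub x)).deriv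
    rw [mul_neg_one] at h3
    exact h3
  simp only [h2, mul_neg, integral_neg, neg_inj] at h1
  exact h1

/-! ### Superpositions of translated test functions and their pairing on ℓ¹ -/

section Bound

variable {φ : ℝ → ℝ} {ι : Type*} {c : ι → ℝ}

theorem lp_one_summable (a : lp (fun _ : ι => ℝ) 1) : Summable fun i => |a i| := by
  have h1 := (lp.memℓp a).summable (by simp)
  simpa using h1

theorem lp_one_norm (a : lp (fun _ : ι => ℝ) 1) : ‖a‖ = ∑' i, |a i| := by
  rw [lp.norm_eq_tsum_rpow (by simp)]
  simp

/-- A superposition of reflected translates of `φ`. -/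
def superposition (φ : ℝ → ℝ) (c : ι → ℝ) (a : lp (fun _ : ι => ℝ) 1) (y : ℝ) : ℝ :=
  ∑' i, a i * φ (c i - y)

theorem IsTest.exists_le {φ : ℝ → ℝ} (hφ : IsTest φ) : ∃ M : ℝ, 0 ≤ M ∧ ∀ y, |φ y| ≤ M := by
  obtain ⟨M, hM⟩ := hφ.continuous.bounded_above_of_compact_support hφ.2
  exact ⟨M, (norm_nonneg _).trans (hM 0), hM⟩

theorem IsTest.summable_superposition (hφ : IsTest φ) (c : ι → ℝ) (a : lp (fun _ : ι => ℝ) 1)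
    (y : ℝ) : Summable fun i => a i * φ (c i - y) := by
  obtain ⟨M, -, hM⟩ := hφ.exists_le
  refine Summable.of_norm_bounded ((lp_one_summable a).mul_right M) fun i => ?_
  rw [norm_mul, Real.norm_eq_abs, Real.norm_eq_abs]
  exact mul_le_mul_of_nonneg_left (hM _) (abs_nonneg _)

theorem IsTest.superposition_add (hφ : IsTest φ) (c : ι → ℝ) (a b : lp (fun _ : ι => ℝ) 1)
    (y : ℝ) : superposition φ c (a + b) y = superposition φ c a y + superposition φ c b y := by
  rw [superposition, superposition, superposition,
    ← (hφ.summable_superposition c a y).tsum_add (hφ.summable_superposition c b y)]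
  exact tsum_congr fun i => by rw [lp.coeFn_add, Pi.add_apply, add_mul]

theorem superposition_smul (φ : ℝ → ℝ) (c : ι → ℝ) (r : ℝ) (a : lp (fun _ : ι => ℝ) 1)
    (y : ℝ) : superposition φ c (r • a) y = r * superposition φ c a y := by
  rw [superposition, superposition, ← tsum_mul_left]
  exact tsum_congr fun i => by rw [lp.coeFn_smul, Pi.smul_apply, smul_eq_mul, mul_assoc]

theorem superposition_single [DecidableEq ι] (φ : ℝ → ℝ) (c : ι → ℝ) (i : ι) (y : ℝ) :
    superposition φ c (lp.single 1 i 1) y = φ (c i - y) := by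
  rw [superposition, tsum_eq_single i]
  · simp
  · intro j hj
    simp [hj]

theorem abs_superposition_le {M : ℝ} (hM : ∀ y, |φ y| ≤ M) (c : ι → ℝ)
    (a : lp (fun _ : ι => ℝ) 1) (y : ℝ) : |superposition φ c a y| ≤ ‖a‖ * M := by
  have h1 : ∀ i, ‖a i * φ (c i - y)‖ ≤ |a i| * M := fun i => by
    rw [norm_mul, Real.norm_eq_abs, Real.norm_eq_abs]
    exact mul_le_mul_of_nonneg_left (hM _) (abs_nonneg _)
  have h2 := tsum_of_norm_bounded ((lp_one_summable a).mul_right M).hasSum h1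
  rwa [tsum_mul_right, ← lp_one_norm] at h2

theorem superposition_eq_zero {R S : ℝ} (hφ : ∀ x, R ≤ |x| → φ x = 0) (hc : ∀ i, |c i| ≤ S)
    (a : lp (fun _ : ι => ℝ) 1) {y : ℝ} (hy : R + S ≤ |y|) : superposition φ c a y = 0 := by
  refine (tsum_congr fun i => ?_).trans tsum_zero
  have h1 : |y| ≤ |c i - y| + |c i| := by
    have := abs_sub_abs_le_abs_sub y (c i)
    rw [abs_sub_comm] at this
    linarith
  rw [hφ _ (by linarith [hc i]), mul_zero]

/-- Bounded centres give compact support; summable coefficients together with bounded derivatives of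
φ allow differentiation term by term. -/
theorem IsTest.isTest_superposition (hφ : IsTest φ) {S : ℝ} (hc : ∀ i, |c i| ≤ S)
    (a : lp (fun _ : ι => ℝ) 1) : IsTest (superposition φ c a) := by
  obtain ⟨R, hR, hR0⟩ := hφ.exists_bound
  refine ⟨?_, HasCompactSupport.intro (isCompact_Icc (a := -(R + S)) (b := R + S)) fun y hy =>
    superposition_eq_zero hR0 hc a ?_⟩
  · have hb : ∀ k : ℕ, ∃ M : ℝ, ∀ y, ‖iteratedFDeriv ℝ k φ y‖ ≤ M := fun k =>
      (hφ.1.continuous_iteratedFDeriv (m := k) (by exact_mod_cast le_top)).bounded_above_of_compact_support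
        (hφ.2.iteratedFDeriv k)
    choose M hM using hb
    refine contDiff_tsum (v := fun k i => |a i| * M k)
      (fun i => contDiff_const.mul (hφ.comp_sub (c i)).1)
      (fun k _ => (lp_one_summable a).mul_right (M k)) fun k i y _ => ?_
    have h1 : ContDiffAt ℝ k (fun y => φ (c i - y)) y :=
      ((hφ.comp_sub (c i)).1.of_le (by exact_mod_cast le_top)).contDiffAt
    rw [norm_iteratedFDeriv_eq_norm_iteratedDeriv, iteratedDeriv_const_mul _ h1,
      iteratedDeriv_comp_const_sub, norm_mul, norm_smul, norm_pow, norm_neg, norm_one, one_pow,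
      one_mul, ← norm_iteratedFDeriv_eq_norm_iteratedDeriv, Real.norm_eq_abs]
    exact mul_le_mul_of_nonneg_left (hM k _) (abs_nonneg _)
  · by_contra! h
    exact hy (abs_le.1 h.le)

/-- The pairing of `w` with superpositions of reflected translates of `φ`. -/
def pairing {w : ℝ → ℝ} (hφ : IsTest φ) {S : ℝ} (hc : ∀ i, |c i| ≤ S) (hw : LocallyIntegrable w) :
    lp (fun _ : ι => ℝ) 1 →L[ℝ] ℝ :=
  LinearMap.mkContinuousOfExistsBound
    { toFun := fun a => ∫ y, w y * superposition φ c a y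
      map_add' := fun a b => by
        rw [← integral_add ((hφ.isTest_superposition hc a).integrable_mul hw)
          ((hφ.isTest_superposition hc b).integrable_mul hw)]
        exact integral_congr_ae (Eventually.of_forall fun y => by
          simp only [hφ.superposition_add, mul_add])
      map_smul' := fun r a => by
        rw [RingHom.id_apply, smul_eq_mul, ← integral_const_mul]
        exact integral_congr_ae (Eventually.of_forall fun y => by
          simp only [superposition_smul]
          ring) } <| by
    obtain ⟨R, hR, hR0⟩ := hφ.exists_bound
    obtain ⟨M, hM0, hM⟩ := hφ.exists_le
    set K := Icc (-(R + S)) (R + S) with hK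
    refine ⟨M * ∫ y in K, |w y|, fun a => ?_⟩
    have h1 : IntegrableOn (fun y => |w y| * (‖a‖ * M)) K :=
      ((hw.integrableOn_isCompact isCompact_Icc).norm).mul_const _
    have h2 := norm_integral_le_of_norm_le (f := fun y => w y * superposition φ c a y)
      (h1.integrable_indicator measurableSet_Icc) (Eventually.of_forall fun y => by
        by_cases hy : y ∈ K
        · rw [indicator_of_mem hy, norm_mul, Real.norm_eq_abs, Real.norm_eq_abs]
          exact mul_le_mul_of_nonneg_left (abs_superposition_le hM c a y) (abs_nonneg _)
        · rw [indicator_of_notMem hy, superposition_eq_zero hR0 hc a, mul_zero, norm_zero]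
          by_contra! h
          exact hy (abs_le.1 h.le))
    rw [integral_indicator measurableSet_Icc, integral_mul_const] at h2
    refine h2.trans (le_of_eq ?_)
    ring

end Bound

/-! ### Joint bounds and joint continuity of mollifications in space and time -/

section Transport

variable {v vt vx : ℝ → ℝ → ℝ} {φ : ℝ → ℝ}

/-- Regularity in time is known for one test function at a time, so a bound uniform in the
translation parameter is not immediate. Pairing with ℓ¹ superpositions of all translates gives, for
each time, a functional on a Banach space. These functionals are pointwise bounded because each
superposition is itself a test function, so Banach–Steinhaus bounds them uniformly, and unit vectors
recover single translates. -/
theorem HasWeakTimeDeriv.mollify_bounded (hv : HasWeakTimeDeriv v vt)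
    (hloc : ∀ t, 0 ≤ t → LocallyIntegrable fun y => v y t) (hφ : IsTest φ) (S T : ℝ) :
    ∃ C : ℝ, ∀ x, |x| ≤ S → ∀ s, 0 ≤ s → s ≤ T → |mollify φ (fun y => v y s) x| ≤ C := by
  classical
  let c : {x : ℝ // |x| ≤ S} → ℝ := Subtype.val
  have hc : ∀ i, |c i| ≤ S := fun i => i.2
  obtain ⟨C, hC⟩ := banach_steinhaus
    (g := fun s : Icc (0 : ℝ) T => pairing hφ hc (hloc s s.2.1)) fun a => by
      have ht := hφ.isTest_superposition hc a
      have h1 : ContinuousOn (fun s => ∫ y, v y s * superposition φ c a y) (Icc 0 T) :=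
        fun s hs => ((hv _ ht.1 ht.2 s hs.1).continuousWithinAt).mono fun r hr => hr.1
      obtain ⟨B, hB⟩ := isCompact_Icc.exists_bound_of_continuousOn h1
      exact ⟨B, fun s => hB s s.2⟩
  refine ⟨C, fun x hx s hs hs' => ?_⟩
  have h2 := (pairing hφ hc (hloc s hs)).le_of_opNorm_le (hC ⟨s, hs, hs'⟩) (lp.single 1 ⟨x, hx⟩ 1)
  rw [lp.norm_single (by simp), norm_one, mul_one] at h2
  have h3 : pairing hφ hc (hloc s hs) (lp.single 1 ⟨x, hx⟩ 1) = mollify φ (fun y => v y s) x :=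
    integral_congr_ae (Eventually.of_forall fun y => by
      simp only [superposition_single, c])
  rwa [h3] at h2

/-- Continuity in time holds at fixed x. Boundedness of the mollification by φ' makes the
x-dependence Lipschitz uniformly for nearby times, and the two combine. -/
theorem HasWeakTimeDeriv.continuousOn_mollify (hv : HasWeakTimeDeriv v vt)
    (hloc : ∀ t, 0 ≤ t → LocallyIntegrable fun y => v y t) (hφ : IsTest φ) :
    ContinuousOn (fun q : ℝ × ℝ => mollify φ (fun y => v y q.2) q.1) (univ ×ˢ Ici 0) := by
  rintro ⟨x, s⟩ ⟨-, hs⟩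
  have hs : 0 ≤ s := hs
  obtain ⟨C, hC⟩ := hv.mollify_bounded hloc hφ.test_deriv (|x| + 1) (s + 1)
  have h1 := (hv _ (hφ.comp_sub x).1 (hφ.comp_sub x).2 s hs).continuousWithinAt
  have h2 : Tendsto (fun q : ℝ × ℝ => mollify φ (fun y => v y q.2) x) (𝓝[univ ×ˢ Ici 0] (x, s))
      (𝓝 (mollify φ (fun y => v y s) x)) := by
    refine h1.tendsto.comp (tendsto_nhdsWithin_iff.2 ⟨?_, ?_⟩)
    · exact (continuous_snd.tendsto (x, s)).mono_left nhdsWithin_le_nhds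
    · filter_upwards [self_mem_nhdsWithin] with q hq
      exact hq.2
  have h3 : Tendsto (fun q : ℝ × ℝ => C * |q.1 - x|) (𝓝[univ ×ˢ Ici 0] (x, s)) (𝓝 0) := by
    have : Continuous fun q : ℝ × ℝ => C * |q.1 - x| := by fun_prop
    simpa using (this.tendsto (x, s)).mono_left nhdsWithin_le_nhds
  refine tendsto_of_tendsto_of_dist h2 (squeeze_zero' (Eventually.of_forall fun _ => dist_nonneg)
    ?_ h3)
  have h4 : ∀ᶠ q : ℝ × ℝ in 𝓝 (x, s), |q.1 - x| < 1 ∧ q.2 < s + 1 := by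
    refine Eventually.and ?_ ?_
    · have : Continuous fun q : ℝ × ℝ => |q.1 - x| := by fun_prop
      exact this.continuousAt.eventually_lt_const (by simp)
    · exact continuous_snd.continuousAt.eventually_lt_const (by simp)
  filter_upwards [self_mem_nhdsWithin, mem_nhdsWithin_of_mem_nhds h4] with q hq hq'
  have hq2 : 0 ≤ q.2 := hq.2
  rw [dist_comm, dist_eq_norm]
  refine (convex_Icc (x - 1) (x + 1)).norm_image_sub_le_of_norm_hasDerivWithin_le
    (fun y _ => (hasDerivAt_mollify hφ (hloc q.2 hq2) y).hasDerivWithinAt)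
    (fun y hy => hC y ?_ q.2 hq2 hq'.2.le) ⟨by linarith, by linarith⟩ ?_
  · have h5 : |y - x| ≤ 1 := abs_le.2 ⟨by linarith [hy.1], by linarith [hy.2]⟩
    have h6 := abs_sub_abs_le_abs_sub y x
    linarith
  · have h5 := abs_lt.1 hq'.1
    exact ⟨by linarith, by linarith⟩

end Transport

/-! ### Differentiation of mollifications along characteristics -/

section Transport

variable {v vt vx w g : ℝ → ℝ → ℝ} {φ : ℝ → ℝ}

/-- The increment along the line is split at the fixed point x₀ = x + cs: the time derivative at x₀
is given, and the spatial increment is controlled by the mean value inequality and joint continuity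
of the spatial derivative. -/
theorem HasWeakTimeDeriv.hasDerivWithinAt_mollify (hv : HasWeakTimeDeriv v vt)
    (hloc : ∀ t, 0 ≤ t → LocallyIntegrable fun y => v y t) (hφ : IsTest φ) (c x : ℝ) {s : ℝ}
    (hs : 0 ≤ s) : HasDerivWithinAt (fun r => mollify φ (fun y => v y r) (x + c * r))
      (mollify φ (fun y => vt y s) (x + c * s) +
        c * mollify (deriv φ) (fun y => v y s) (x + c * s)) (Ici 0) s := by
  set x₀ := x + c * s with hx₀
  set L := mollify (deriv φ) (fun y => v y s) x₀ with hL
  have h1 : HasDerivWithinAt (fun r => mollify φ (fun y => v y r) x₀)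
      (mollify φ (fun y => vt y s) x₀) (Ici 0) s := hv _ (hφ.comp_sub x₀).1 (hφ.comp_sub x₀).2 s hs
  have h2 : HasDerivWithinAt (fun r => mollify φ (fun y => v y r) (x + c * r) -
      mollify φ (fun y => v y r) x₀) (c * L) (Ici 0) s := by
    rw [hasDerivWithinAt_iff_isLittleO, Asymptotics.isLittleO_iff]
    intro κ hκ
    have h3 := (hv.continuousOn_mollify hloc hφ.test_deriv) (x₀, s) ⟨mem_univ _, hs⟩
    obtain ⟨δ, hδ, h4⟩ := Metric.continuousWithinAt_iff.1 h3 (κ / (|c| + 1)) (by positivity)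
    have h5 : ∀ᶠ r in 𝓝 s, |r - s| < δ / (|c| + 1) ∧ |r - s| < δ := by
      have hc : Continuous fun r : ℝ => |r - s| := by fun_prop
      exact (hc.continuousAt.eventually_lt_const (by simpa using by positivity)).and
        (hc.continuousAt.eventually_lt_const (by simpa using hδ))
    filter_upwards [self_mem_nhdsWithin, mem_nhdsWithin_of_mem_nhds h5] with r hr0 hr
    have hr0 : 0 ≤ r := hr0
    have hcr : |c * (r - s)| < δ := by
      have h6 := (lt_div_iff₀ (by positivity)).1 hr.1
      rw [abs_mul]
      nlinarith [abs_nonneg (r - s)]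
    have h7 := (convex_ball x₀ δ).norm_image_sub_le_of_norm_hasDerivWithin_le
      (f := fun ξ => mollify φ (fun y => v y r) ξ - L * ξ) (C := κ / (|c| + 1))
      (fun ξ _ => ((hasDerivAt_mollify hφ (hloc r hr0) ξ).sub
        ((hasDerivAt_id ξ).const_mul L)).hasDerivWithinAt) (fun ξ hξ => by
          rw [mul_one]
          refine (le_of_lt (h4 (x := (ξ, r)) ⟨mem_univ _, hr0⟩ ?_))
          rw [Prod.dist_eq]
          exact max_lt hξ hr.2) (Metric.mem_ball_self hδ) (y := x + c * r) (by
            rw [Metric.mem_ball, Real.dist_eq, show x + c * r - x₀ = c * (r - s) by rw [hx₀]; ring]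
            exact hcr)
    have h8 : mollify φ (fun y => v y r) (x + c * r) - mollify φ (fun y => v y r) x₀ -
        (mollify φ (fun y => v y s) (x + c * s) - mollify φ (fun y => v y s) x₀) -
          (r - s) • (c * L) = (mollify φ (fun y => v y r) (x + c * r) - L * (x + c * r)) -
            (mollify φ (fun y => v y r) x₀ - L * x₀) := by
      rw [← hx₀, smul_eq_mul, hx₀]
      ring
    rw [h8]
    refine h7.trans ?_
    rw [show x + c * r - x₀ = c * (r - s) by rw [hx₀]; ring, norm_mul, ← mul_assoc]
    refine mul_le_mul_of_nonneg_right ?_ (norm_nonneg _)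
    rw [div_mul_eq_mul_div, div_le_iff₀ (by positivity), Real.norm_eq_abs]
    nlinarith [abs_nonneg c]
  refine (h1.add h2).congr_of_eventuallyEq (Eventually.of_forall fun r => ?_) ?_ <;>
    simp only [Pi.add_apply] <;> ring

theorem mollify_congr_ae {w w' : ℝ → ℝ} (h : w =ᵐ[volume] w') (x : ℝ) :
    mollify φ w x = mollify φ w' x :=
  integral_congr_ae (by filter_upwards [h] with y hy; rw [hy])

/-- Mollification is averaging with a probability density supported near 0, so it preserves a bound
|w - γ| ≤ η that holds near x. -/
theorem abs_mollify_sub_le {w : ℝ → ℝ} (hφ : IsTest φ) (hpos : ∀ y, 0 ≤ φ y)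
    (hone : ∫ y, φ y = 1) {r : ℝ} (hr : ∀ y, r ≤ |y| → φ y = 0) (hw : LocallyIntegrable w)
    {x γ η : ℝ} (h : ∀ y, |y - x| < r → |w y - γ| ≤ η) : |mollify φ w x - γ| ≤ η := by
  have h1 : ∫ y, φ (x - y) = 1 := by rw [integral_sub_left_eq_self, hone]
  have h2 : mollify φ w x - γ = ∫ y, (w y - γ) * φ (x - y) := by
    simp only [sub_mul]
    rw [integral_sub ((hφ.comp_sub x).integrable_mul hw) ((hφ.comp_sub x).integrable.const_mul γ),
      integral_const_mul, h1, mul_one, mollify]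
  have h3 : η = ∫ y, η * φ (x - y) := by rw [integral_const_mul, h1, mul_one]
  rw [h2, ← Real.norm_eq_abs]
  refine (norm_integral_le_of_norm_le ((hφ.comp_sub x).integrable.const_mul η)
    (Eventually.of_forall fun y => ?_)).trans h3.ge
  rw [norm_mul, Real.norm_eq_abs, Real.norm_eq_abs, abs_of_nonneg (hpos _)]
  by_cases hy : |y - x| < r
  · exact mul_le_mul_of_nonneg_right (h y hy) (hpos _)
  · rw [hr (x - y) (by rw [abs_sub_comm]; exact not_lt.1 hy), mul_zero, mul_zero]

theorem exists_mollifier {r : ℝ} (hr : 0 < r) : ∃ φ : ℝ → ℝ, IsTest φ ∧ (∀ y, 0 ≤ φ y) ∧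
    ∫ y, φ y = 1 ∧ ∀ y, r ≤ |y| → φ y = 0 := by
  let b : ContDiffBump (0 : ℝ) := ⟨r / 2, r, half_pos hr, half_lt_self hr⟩
  refine ⟨b.normed volume, ⟨b.contDiff_normed, b.hasCompactSupport_normed⟩, b.nonneg_normed,
    b.integral_normed, fun y hy => ?_⟩
  have h1 : y ∉ Function.support (b.normed volume) := by
    rw [b.support_normed_eq, mem_ball_zero_iff, not_lt]
    exact hy
  simpa using h1

/-- Solutions `v` of `v_t + c v_x = g` in the weak sense change along characteristics as
predicted by `g`. -/
theorem HasWeakTimeDeriv.transport_estimate (hv : HasWeakTimeDeriv v vt)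
    (hvx : ∀ t, 0 ≤ t → HasWeakDeriv (fun y => v y t) fun y => vx y t)
    (hvt : ∀ t, 0 ≤ t → LocallyIntegrable fun y => vt y t)
    (hw : ∀ t, 0 ≤ t → Continuous fun y => w y t)
    (hae : ∀ t, 0 ≤ t → (fun y => v y t) =ᵐ[volume] fun y => w y t) {c : ℝ}
    (hg : ∀ t, 0 ≤ t → (fun y => vt y t + c * vx y t) =ᵐ[volume] fun y => g y t)
    {a b x γ η δ : ℝ} (ha : 0 ≤ a) (hab : a ≤ b) (hδ : 0 < δ)
    (hη : ∀ s ∈ Icc a b, ∀ y, |y - (x + c * s)| < δ → |g y s - γ| ≤ η) :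
    |w (x + c * b) b - w (x + c * a) a - γ * (b - a)| ≤ η * (b - a) := by
  have hb : 0 ≤ b := ha.trans hab
  -- The estimate is proved for mollifications of width below `δ`, with an error κ/2 at either end
  -- where w is replaced by its mollification.
  refine le_of_forall_pos_le_add fun κ hκ => ?_
  obtain ⟨δ₁, hδ₁, h1⟩ := Metric.continuous_iff.1 (hw a ha) (x + c * a) (κ / 2) (half_pos hκ)
  obtain ⟨δ₂, hδ₂, h2⟩ := Metric.continuous_iff.1 (hw b hb) (x + c * b) (κ / 2) (half_pos hκ)
  obtain ⟨φ, hφ, hpos, hone, hr⟩ := exists_mollifier (lt_min hδ (lt_min hδ₁ hδ₂))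
  set r := min δ (min δ₁ δ₂) with hr_def
  have hloc : ∀ t, 0 ≤ t → LocallyIntegrable fun y => v y t := fun t ht => (hvx t ht).1
  have h3 : |mollify φ (fun y => v y a) (x + c * a) - w (x + c * a) a| ≤ κ / 2 := by
    rw [mollify_congr_ae (hae a ha)]
    exact abs_mollify_sub_le hφ hpos hone hr (hw a ha).locallyIntegrable fun y hy =>
      (h1 y (hy.trans_le ((min_le_right _ _).trans (min_le_left _ _)))).le
  have h4 : |mollify φ (fun y => v y b) (x + c * b) - w (x + c * b) b| ≤ κ / 2 := by
    rw [mollify_congr_ae (hae b hb)]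
    exact abs_mollify_sub_le hφ hpos hone hr (hw b hb).locallyIntegrable fun y hy =>
      (h2 y (hy.trans_le ((min_le_right _ _).trans (min_le_right _ _)))).le
  have h5 : ∀ s ∈ Icc a b, HasDerivWithinAt
      (fun s => mollify φ (fun y => v y s) (x + c * s) - γ * s)
      (mollify φ (fun y => g y s) (x + c * s) - γ) (Icc a b) s := fun s hs => by
    have hs0 : 0 ≤ s := ha.trans hs.1
    have h6 := ((hv.hasDerivWithinAt_mollify hloc hφ c x hs0).sub
      ((hasDerivWithinAt_id s _).const_mul γ)).mono
        (fun r hr => ha.trans hr.1 : Icc a b ⊆ Ici 0)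
    refine h6.congr_deriv ?_
    rw [(hvx s hs0).mollify_deriv hφ, mul_one, ← mollify_congr_ae (hg s hs0)]
    congr 1
    rw [mollify, mollify, mollify, ← integral_const_mul, ← integral_add
      ((hφ.comp_sub _).integrable_mul (hvt s hs0))
      (((hφ.comp_sub _).integrable_mul (hvx s hs0).2.1).const_mul c)]
    refine integral_congr_ae (Eventually.of_forall fun y => ?_)
    ring
  -- The mollification only sees g in a tube of width at most `δ` around the characteristic, where g
  -- differs from γ by at most η.
  have h6 := norm_image_sub_le_of_norm_deriv_le_segment' h5 (C := η) (fun s hs => by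
    have hs' := Ico_subset_Icc_self hs
    have hs0 : 0 ≤ s := ha.trans hs.1
    have hgl : LocallyIntegrable fun y => g y s :=
      ((hvt s hs0).add ((hvx s hs0).2.1.smul c)).congr (hg s hs0)
    exact abs_mollify_sub_le hφ hpos hone hr hgl fun y hy =>
      hη s hs' y (hy.trans_le (min_le_left _ _))) b ⟨hab, le_rfl⟩
  rw [Real.norm_eq_abs] at h6
  rw [abs_le] at h3 h4 h6 ⊢
  constructor <;> nlinarith [h3.1, h3.2, h4.1, h4.2, h6.1, h6.2]

end Transport

/-! ### Classical regularity of solutions -/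

/-- `w` changes along the characteristics `x = const + c t` at the rate `g`. -/
structure IsTransported (c : ℝ) (w g : ℝ → ℝ → ℝ) : Prop where
  continuous : ∀ t, 0 ≤ t → Continuous fun y => w y t
  estimate : ∀ {a b x γ η δ : ℝ}, 0 ≤ a → a ≤ b → 0 < δ →
    (∀ s ∈ Icc a b, ∀ y, |y - (x + c * s)| < δ → |g y s - γ| ≤ η) →
    |w (x + c * b) b - w (x + c * a) a - γ * (b - a)| ≤ η * (b - a)

theorem IsTransported.estimate_abs {c : ℝ} {w g : ℝ → ℝ → ℝ} (hw : IsTransported c w g)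
    {s r x γ η δ : ℝ} (hs : 0 ≤ s) (hr : 0 ≤ r) (hδ : 0 < δ)
    (h : ∀ ρ, 0 ≤ ρ → |ρ - s| ≤ |r - s| → ∀ y, |y - (x + c * ρ)| < δ → |g y ρ - γ| ≤ η) :
    |w (x + c * r) r - w (x + c * s) s - γ * (r - s)| ≤ η * |r - s| := by
  rcases le_total s r with h1 | h1
  · rw [abs_of_nonneg (sub_nonneg.2 h1)] at h ⊢
    refine hw.estimate hs h1 hδ fun ρ hρ => h ρ (hs.trans hρ.1) ?_
    rw [abs_of_nonneg (sub_nonneg.2 hρ.1)]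
    linarith [hρ.2]
  · rw [abs_of_nonpos (sub_nonpos.2 h1), neg_sub] at h ⊢
    have h2 := hw.estimate hr h1 hδ fun ρ hρ => h ρ (hr.trans hρ.1) (by
      rw [abs_of_nonpos (sub_nonpos.2 hρ.2)]
      linarith [hρ.1])
    rw [← abs_neg]
    refine le_of_eq_of_le ?_ h2
    congr 1
    ring

/-- Take γ to be the value of g at the base point: continuity makes the deviation η arbitrarily
small on short tubes. -/
theorem IsTransported.hasDerivWithinAt {c : ℝ} {w g : ℝ → ℝ → ℝ} (hw : IsTransported c w g)
    (hg : ContinuousOn (fun q : ℝ × ℝ => g q.1 q.2) (univ ×ˢ Ici 0)) (x : ℝ) {s : ℝ} (hs : 0 ≤ s) :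
    HasDerivWithinAt (fun r => w (x + c * r) r) (g (x + c * s) s) (Ici 0) s := by
  rw [hasDerivWithinAt_iff_isLittleO, Asymptotics.isLittleO_iff]
  intro κ hκ
  obtain ⟨δ, hδ, h1⟩ := Metric.continuousWithinAt_iff.1
    (hg (x + c * s, s) ⟨mem_univ _, hs⟩) κ hκ
  have h2 : ∀ᶠ r in 𝓝 s, |r - s| < δ ∧ |c| * |r - s| < δ / 2 := by
    have hc : Continuous fun r : ℝ => |r - s| := by fun_prop
    have hc' : Continuous fun r : ℝ => |c| * |r - s| := by fun_prop
    exact (hc.continuousAt.eventually_lt_const (by simpa using hδ)).and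
      (hc'.continuousAt.eventually_lt_const (by simpa using half_pos hδ))
  filter_upwards [self_mem_nhdsWithin, mem_nhdsWithin_of_mem_nhds h2] with r hr0 hr
  have h3 := hw.estimate_abs (x := x) (γ := g (x + c * s) s) (η := κ) hs hr0 (half_pos hδ)
    fun ρ hρ0 hρ y hy => by
      refine le_of_lt (h1 (x := (y, ρ)) ⟨mem_univ _, hρ0⟩ ?_)
      rw [Prod.dist_eq]
      refine max_lt ?_ (hρ.trans_lt hr.1)
      have h4 : y - (x + c * s) = (y - (x + c * ρ)) + c * (ρ - s) := by ring
      have h5 : |c * (ρ - s)| ≤ |c| * |r - s| := by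
        rw [abs_mul]
        exact mul_le_mul_of_nonneg_left hρ (abs_nonneg _)
      change |y - (x + c * s)| < δ
      rw [h4]
      linarith [abs_add_le (y - (x + c * ρ)) (c * (ρ - s)), hr.2]
  rw [smul_eq_mul, mul_comm (r - s)]
  exact h3

/-- Slide along the characteristic to the fixed time s, where w is continuous in space; the cost is
at most M times the time difference. A local bound on g suffices, which starts the bootstrap before
g is known to be continuous. -/
theorem IsTransported.continuousOn {c : ℝ} {w g : ℝ → ℝ → ℝ} (hw : IsTransported c w g)
    (hg : ∀ x s : ℝ, 0 ≤ s → ∃ M δ : ℝ, 0 < δ ∧ ∀ r, 0 ≤ r → |r - s| < δ → ∀ y, |y - x| < δ →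
      |g y r| ≤ M) : ContinuousOn (fun q : ℝ × ℝ => w q.1 q.2) (univ ×ˢ Ici 0) := by
  rintro ⟨x, s⟩ ⟨-, hs⟩
  have hs : 0 ≤ s := hs
  obtain ⟨M, δ, hδ, hM⟩ := hg x s hs
  have h1 : Tendsto (fun q : ℝ × ℝ => w (q.1 + c * (s - q.2)) s) (𝓝[univ ×ˢ Ici 0] (x, s))
      (𝓝 (w x s)) := by
    have h2 : Continuous fun q : ℝ × ℝ => w (q.1 + c * (s - q.2)) s :=
      (hw.continuous s hs).comp (by fun_prop)
    simpa using (h2.tendsto (x, s)).mono_left nhdsWithin_le_nhds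
  have h3 : Tendsto (fun q : ℝ × ℝ => M * |q.2 - s|) (𝓝[univ ×ˢ Ici 0] (x, s)) (𝓝 0) := by
    have : Continuous fun q : ℝ × ℝ => M * |q.2 - s| := by fun_prop
    simpa using (this.tendsto (x, s)).mono_left nhdsWithin_le_nhds
  refine tendsto_of_tendsto_of_dist h1 (squeeze_zero' (Eventually.of_forall fun _ => dist_nonneg)
    ?_ h3)
  have h4 : ∀ᶠ q : ℝ × ℝ in 𝓝 (x, s), |q.2 - s| < δ ∧ |q.1 - x| + |c| * (2 * |q.2 - s|) < δ / 2 := by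
    have hc : Continuous fun q : ℝ × ℝ => |q.2 - s| := by fun_prop
    have hc' : Continuous fun q : ℝ × ℝ => |q.1 - x| + |c| * (2 * |q.2 - s|) := by fun_prop
    exact (hc.continuousAt.eventually_lt_const (by simpa using hδ)).and
      (hc'.continuousAt.eventually_lt_const (by simpa using half_pos hδ))
  filter_upwards [self_mem_nhdsWithin, mem_nhdsWithin_of_mem_nhds h4] with q hq hq'
  have h5 := hw.estimate_abs (x := q.1 - c * q.2) (γ := 0) (η := M) hs hq.2 (half_pos hδ)
    fun ρ hρ0 hρ y hy => by
      rw [sub_zero]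
      refine hM ρ hρ0 (hρ.trans_lt hq'.1) y ?_
      have h6 : y - x = (y - (q.1 - c * q.2 + c * ρ)) + ((q.1 - x) + c * (ρ - q.2)) := by ring
      have h7 : |c * (ρ - q.2)| ≤ |c| * (2 * |q.2 - s|) := by
        rw [abs_mul]
        refine mul_le_mul_of_nonneg_left ?_ (abs_nonneg _)
        have := abs_sub_le ρ s q.2
        rw [abs_sub_comm s] at this
        linarith
      rw [h6]
      linarith [abs_add_le (y - (q.1 - c * q.2 + c * ρ)) ((q.1 - x) + c * (ρ - q.2)),
        abs_add_le (q.1 - x) (c * (ρ - q.2)), hq'.2]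
  rw [dist_comm, Real.dist_eq]
  rw [zero_mul, sub_zero, show q.1 - c * q.2 + c * q.2 = q.1 by ring,
    show q.1 - c * q.2 + c * s = q.1 + c * (s - q.2) by ring] at h5
  exact h5

theorem HasWeakTimeDeriv.isTransported {v vt vx w g : ℝ → ℝ → ℝ} (hv : HasWeakTimeDeriv v vt)
    (hvx : ∀ t, 0 ≤ t → HasWeakDeriv (fun y => v y t) fun y => vx y t)
    (hvt : ∀ t, 0 ≤ t → LocallyIntegrable fun y => vt y t)
    (hw : ∀ t, 0 ≤ t → Continuous fun y => w y t)
    (hae : ∀ t, 0 ≤ t → (fun y => v y t) =ᵐ[volume] fun y => w y t) {c : ℝ}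
    (hg : ∀ t, 0 ≤ t → (fun y => vt y t + c * vx y t) =ᵐ[volume] fun y => g y t) :
    IsTransported c w g :=
  ⟨hw, fun ha hab hδ hη => hv.transport_estimate hvx hvt hw hae hg ha hab hδ hη⟩

theorem HasWeakDeriv.add {f g f' g' : ℝ → ℝ} (hf : HasWeakDeriv f f') (hg : HasWeakDeriv g g') :
    HasWeakDeriv (fun x => f x + g x) fun x => f' x + g' x := by
  refine ⟨hf.1.add hg.1, hf.2.1.add hg.2.1, fun φ hφ hφc => ?_⟩
  have ht : IsTest φ := ⟨hφ, hφc⟩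
  simp only [add_mul]
  rw [integral_add (ht.test_deriv.integrable_mul hf.1) (ht.test_deriv.integrable_mul hg.1),
    integral_add (ht.integrable_mul hf.2.1) (ht.integrable_mul hg.2.1), hf.2.2 φ hφ hφc,
    hg.2.2 φ hφ hφc, neg_add]

theorem HasWeakTimeDeriv.add {v w vt wt : ℝ → ℝ → ℝ} (hv : HasWeakTimeDeriv v vt)
    (hw : HasWeakTimeDeriv w wt) (hvl : ∀ t, 0 ≤ t → LocallyIntegrable fun y => v y t)
    (hwl : ∀ t, 0 ≤ t → LocallyIntegrable fun y => w y t)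
    (hvtl : ∀ t, 0 ≤ t → LocallyIntegrable fun y => vt y t)
    (hwtl : ∀ t, 0 ≤ t → LocallyIntegrable fun y => wt y t) :
    HasWeakTimeDeriv (fun y t => v y t + w y t) fun y t => vt y t + wt y t := by
  intro φ hφ hφc t ht
  have hφt : IsTest φ := ⟨hφ, hφc⟩
  simp only [add_mul]
  rw [integral_add (hφt.integrable_mul (hvtl t ht)) (hφt.integrable_mul (hwtl t ht))]
  have h1 : ∀ s ∈ Ici (0 : ℝ), ∫ y, (v y s * φ y + w y s * φ y) =
      (∫ y, v y s * φ y) + ∫ y, w y s * φ y := fun s hs =>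
    integral_add (hφt.integrable_mul (hvl s hs)) (hφt.integrable_mul (hwl s hs))
  exact ((hv φ hφ hφc t ht).add (hw φ hφ hφc t ht)).congr h1 (h1 t ht)

section Solution

variable {ε : ℝ} {u ux uxx ut utx : ℝ → ℝ → ℝ}

/-- The mixed derivative may be taken in either order: test u_t against φ' and integrate by parts in
x. -/
theorem IsL1SobolevSolution.weakTimeDeriv_x (hu : IsL1SobolevSolution ε u ux uxx ut utx) :
    HasWeakTimeDeriv ux utx := by
  intro φ hφ hφc t ht
  have hφt : IsTest φ := ⟨hφ, hφc⟩
  have h1 := (hu.weakDeriv_t _ hφt.test_deriv.1 hφt.test_deriv.2 t ht).neg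
  have h2 : ∀ s ∈ Ici (0 : ℝ), ∫ y, ux y s * φ y = -∫ y, u y s * deriv φ y := fun s hs => by
    rw [(hu.weakDeriv_x s hs).2.2 φ hφ hφc, neg_neg]
  rw [(hu.weakDeriv_tx t ht).2.2 φ hφ hφc, neg_neg] at h1
  exact h1.congr h2 (h2 t ht)

/-- Two successive primitives of u_xx and one primitive of u_tx give representatives that are C¹ for
u and continuous for u_x and u_t. -/
theorem IsL1SobolevSolution.exists_nicePotential (hu : IsL1SobolevSolution ε u ux uxx ut utx)
    {t : ℝ} (ht : 0 ≤ t) : ∃ f f' h : ℝ → ℝ, NicePotential f f' h ∧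
      (fun y => u y t) =ᵐ[volume] f ∧ (fun y => ux y t) =ᵐ[volume] f' ∧
      (fun y => ut y t) =ᵐ[volume] h := by
  obtain ⟨c, hc⟩ := (hu.weakDeriv_x t ht).exists_primitive
  obtain ⟨c', hc'⟩ := (hu.weakDeriv_xx t ht).exists_primitive
  obtain ⟨d, hd⟩ := (hu.weakDeriv_tx t ht).exists_primitive
  have h1 := continuous_primitive_of_locallyIntegrable (hu.weakDeriv_xx t ht).2.1 c'
  have h2 := continuous_primitive_of_locallyIntegrable (hu.weakDeriv_tx t ht).2.1 d
  set f' : ℝ → ℝ := fun x => c' + ∫ y in (0 : ℝ)..x, uxx y t with hf'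
  have h3 : (fun y => u y t) =ᵐ[volume] fun x => c + ∫ y in (0 : ℝ)..x, f' y := by
    filter_upwards [hc] with x hx
    rw [hx]
    congr 1
    refine intervalIntegral.integral_congr_ae ?_
    filter_upwards [hc'] with y hy _
    exact hy
  refine ⟨_, f', _, ⟨fun x => ?_, h1, h2, ?_, ?_, ?_, ?_⟩, h3, hc', hd⟩
  · exact (intervalIntegral.integral_hasDerivAt_right (h1.intervalIntegrable _ _)
      h1.stronglyMeasurable.stronglyMeasurableAtFilter h1.continuousAt).const_add c
  · refine (hu.integrable_one_sub_cos t ht).congr ?_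
    filter_upwards [h3] with x hx
    rw [hx]
  · refine (hu.integrable_sin t ht).congr ?_
    filter_upwards [h3] with x hx
    rw [hx]
  · exact (hu.integrable_ux t ht).congr hc'
  · exact (hu.integrable_ut t ht).congr hd

/-- Classical regularity: `U` and `P = U_x + U_t` are continuous, and are differentiable along
the characteristics of the sine-Gordon equation. -/
structure IsRegularSolution (ε : ℝ) (U Ux Ut : ℝ → ℝ → ℝ) : Prop where
  nice : ∀ t, 0 ≤ t → NicePotential (fun y => U y t) (fun y => Ux y t) fun y => Ut y t
  continuousOn_U : ContinuousOn (fun q : ℝ × ℝ => U q.1 q.2) (univ ×ˢ Ici 0)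
  continuousOn_P : ContinuousOn (fun q : ℝ × ℝ => Ux q.1 q.2 + Ut q.1 q.2) (univ ×ˢ Ici 0)
  deriv_U : ∀ x s : ℝ, 0 ≤ s →
    HasDerivWithinAt (fun r => U (x + r) r) (Ux (x + s) s + Ut (x + s) s) (Ici 0) s
  deriv_P : ∀ x s : ℝ, 0 ≤ s →
    HasDerivWithinAt (fun r => Ux (x - r) r + Ut (x - r) r)
      (-(Real.sin (U (x - s) s) / ε ^ 2)) (Ici 0) s

/-- The factorization of the wave operator drives a bootstrap. P = U_x + U_t is transported with
speed -1 at a rate bounded by 1/ε², hence jointly continuous. U is transported with speed 1 at the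
rate P, hence jointly continuous as well. Both rates are then continuous, which gives the
derivatives along characteristics. -/
theorem IsL1SobolevSolution.exists_isRegularSolution
    (hu : IsL1SobolevSolution ε u ux uxx ut utx) : ∃ U Ux Ut : ℝ → ℝ → ℝ,
      IsRegularSolution ε U Ux Ut ∧ ∀ t, 0 ≤ t → (fun y => u y t) =ᵐ[volume] (fun y => U y t) ∧
        (fun y => ux y t) =ᵐ[volume] (fun y => Ux y t) ∧
        (fun y => ut y t) =ᵐ[volume] fun y => Ut y t := by
  have h1 : ∀ t, ∃ f f' h : ℝ → ℝ, 0 ≤ t → NicePotential f f' h ∧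
      (fun y => u y t) =ᵐ[volume] f ∧ (fun y => ux y t) =ᵐ[volume] f' ∧
      (fun y => ut y t) =ᵐ[volume] h := fun t => by
    by_cases ht : 0 ≤ t
    · obtain ⟨f, f', h, hf⟩ := hu.exists_nicePotential ht
      exact ⟨f, f', h, fun _ => hf⟩
    · exact ⟨0, 0, 0, fun h => absurd h ht⟩
  choose U Ux Ut hU using h1
  have hloc := fun t (ht : 0 ≤ t) => (hu.weakDeriv_x t ht).1
  have hlocx := fun t (ht : 0 ≤ t) => (hu.weakDeriv_xx t ht).1
  have hloct := fun t (ht : 0 ≤ t) => (hu.weakDeriv_tx t ht).1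
  have hlocxx := fun t (ht : 0 ≤ t) => (hu.weakDeriv_xx t ht).2.1
  have hloctx := fun t (ht : 0 ≤ t) => (hu.weakDeriv_tx t ht).2.1
  have hloctt : ∀ t, 0 ≤ t → LocallyIntegrable fun y => uxx y t - Real.sin (u y t) / ε ^ 2 :=
    fun t ht => (hlocxx t ht).sub ((hu.integrable_sin t ht).div_const _).locallyIntegrable
  have hP : IsTransported (-1) (fun x t => Ux t x + Ut t x)
      fun x t => -(Real.sin (U t x) / ε ^ 2) :=
    (hu.weakTimeDeriv_x.add hu.equation hlocx hloct hloctx hloctt).isTransported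
      (vx := fun y t => uxx y t + utx y t)
      (fun t ht => (hu.weakDeriv_xx t ht).add (hu.weakDeriv_tx t ht))
      (fun t ht => (hloctx t ht).add (hloctt t ht))
      (fun t ht => (hU t ht).1.continuous_deriv.add (hU t ht).1.continuous_h)
      (fun t ht => by
        filter_upwards [(hU t ht).2.2.1, (hU t ht).2.2.2] with y hy hy'
        rw [hy, hy']
        rfl)
      (fun t ht => by
        filter_upwards [(hU t ht).2.1] with y hy
        rw [hy]
        ring)
  have hPc := hP.continuousOn fun x s _ => ⟨1 / ε ^ 2, 1, one_pos, fun r _ _ y _ => by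
    rw [abs_neg, abs_div, abs_of_nonneg (sq_nonneg ε)]
    exact div_le_div_of_nonneg_right (Real.abs_sin_le_one _) (sq_nonneg ε)⟩
  have hUt : IsTransported 1 (fun x t => U t x) fun x t => Ux t x + Ut t x :=
    hu.weakDeriv_t.isTransported hu.weakDeriv_x hloct (fun t ht => (hU t ht).1.continuous)
      (fun t ht => (hU t ht).2.1) fun t ht => by
        filter_upwards [(hU t ht).2.2.1, (hU t ht).2.2.2] with y hy hy'
        rw [hy, hy']
        ring
  have hUc := hUt.continuousOn fun x s hs => by
    obtain ⟨δ, hδ, h2⟩ := Metric.continuousWithinAt_iff.1 (hPc (x, s) ⟨mem_univ _, hs⟩) 1 one_pos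
    refine ⟨|Ux s x + Ut s x| + 1, δ, hδ, fun r hr hrs y hy => ?_⟩
    have h3 := h2 (x := (y, r)) ⟨mem_univ _, hr⟩ (by
      rw [Prod.dist_eq]
      exact max_lt hy hrs)
    rw [Real.dist_eq] at h3
    have h4 := abs_sub_abs_le_abs_sub (Ux r y + Ut r y) (Ux s x + Ut s x)
    linarith
  refine ⟨fun x t => U t x, fun x t => Ux t x, fun x t => Ut t x,
    ⟨fun t ht => (hU t ht).1, hUc, hPc, fun x s hs => ?_, fun x s hs => ?_⟩,
    fun t ht => (hU t ht).2⟩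
  · have h2 := hUt.hasDerivWithinAt hPc x hs
    simpa only [one_mul] using h2
  · have h2 := hP.hasDerivWithinAt ((Real.continuous_sin.comp_continuousOn hUc).div_const
      (ε ^ 2)).neg x hs
    simpa only [neg_one_mul, ← sub_eq_add_neg] using h2

end Solution

/-! ### Transport of solutions of linear equations with zero curvature -/

section ZeroCurvature

theorem eventually_nhdsGT_lt {δ : ℝ} (hδ : 0 < δ) : ∀ᶠ h in 𝓝[>] (0 : ℝ), h < δ :=
  mem_nhdsWithin_of_mem_nhds (Iio_mem_nhds hδ)

variable {X : Type*} [PseudoMetricSpace X]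

theorem exists_uniform_of_continuousOn {F : ℝ × ℝ → X} (hF : ContinuousOn F (univ ×ˢ Ici 0))
    (y t : ℝ) {κ : ℝ} (hκ : 0 < κ) : ∃ δ > 0, ∀ s ∈ Icc 0 t, ∀ y' s' : ℝ, 0 ≤ s' →
      |y' - y| < δ → |s' - s| < δ → dist (F (y', s')) (F (y, s)) < κ := by
  have h1 : Continuous fun q : ℝ × ℝ => F (q.1, max q.2 0) := by
    rw [← continuousOn_univ]
    exact hF.comp (by fun_prop) fun q _ => ⟨mem_univ _, mem_Ici.2 (le_max_right q.2 0)⟩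
  have hc : IsCompact ({y} ×ˢ Icc (0 : ℝ) t) := isCompact_singleton.prod isCompact_Icc
  have h2 := hc.uniformContinuousAt_of_continuousAt _ (fun q _ => h1.continuousAt)
    (Metric.dist_mem_uniformity hκ)
  obtain ⟨δ, hδ, h3⟩ := Metric.mem_uniformity_dist.1 h2
  refine ⟨δ, hδ, fun s hs y' s' hs' hy hss => ?_⟩
  have h4 := h3 (a := (y, s)) (b := (y', s')) (by
    rw [dist_comm, Prod.dist_eq]
    exact max_lt hy hss) ⟨rfl, hs⟩
  simp only [max_eq_left hs', max_eq_left hs.1] at h4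
  rw [dist_comm]
  exact h4

variable {E : Type*} [NormedAddCommGroup E] [NormedSpace ℝ E] {W : ℝ → ℝ → E}
  {A B A' B' : ℝ → ℝ → E →L[ℝ] E} {T t y : ℝ}

/-- The increment in s is taken at the shifted point y + 2h; joint continuity of BW allows its rate
to be replaced by the value at (y, s). -/
theorem norm_increment_le (hW : Continuous fun q : ℝ × ℝ => W q.1 q.2)
    (hB : ContinuousOn (fun q : ℝ × ℝ => B q.1 q.2) (univ ×ˢ Ici 0))
    (hWs : ∀ y, ∀ s ∈ Ico 0 T, HasDerivWithinAt (W y) (B y s (W y s)) (Ici s) s) (y : ℝ) {s : ℝ}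
    (hs : s ∈ Ico 0 T) {κ : ℝ} (hκ : 0 < κ) : ∀ᶠ h in 𝓝[>] (0 : ℝ),
      ‖W (y + 2 * h) (s + h) - W (y + 2 * h) s - h • B y s (W y s)‖ ≤ κ * h := by
  have h1 : ContinuousOn (fun q : ℝ × ℝ => B q.1 q.2 (W q.1 q.2)) (univ ×ˢ Ici 0) :=
    hB.clm_apply hW.continuousOn
  obtain ⟨δ, hδ, h2⟩ := exists_uniform_of_continuousOn h1 y s hκ
  have h3 : ∀ᶠ h in 𝓝[>] (0 : ℝ), h < δ / 2 ∧ h < T - s := by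
    have := hs.2
    exact Eventually.and (eventually_nhdsGT_lt (half_pos hδ)) (eventually_nhdsGT_lt (sub_pos.2 this))
  filter_upwards [h3, self_mem_nhdsWithin] with h hh hpos
  have hpos : 0 < h := hpos
  have hcont : Continuous fun r => W (y + 2 * h) r := hW.comp (Continuous.prodMk_right _)
  have h4 := norm_image_sub_le_of_norm_deriv_right_le_segment
    (f := fun r => W (y + 2 * h) r - r • B y s (W y s)) (a := s) (b := s + h) (C := κ)
    (f' := fun r => B (y + 2 * h) r (W (y + 2 * h) r) - (1 : ℝ) • B y s (W y s))
    (by fun_prop) (fun r hr => ?_) (fun r hr => ?_) (s + h) ⟨by linarith, le_rfl⟩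
  · rw [add_sub_cancel_left] at h4
    refine le_of_eq_of_le ?_ h4
    congr 1
    rw [add_smul]
    abel
  · exact (hWs _ r ⟨hs.1.trans hr.1, by linarith [hr.2]⟩).sub
      ((hasDerivWithinAt_id r _).smul_const _)
  · rw [one_smul, ← dist_eq_norm]
    refine (h2 s ⟨hs.1, le_rfl⟩ (y + 2 * h) r (hs.1.trans hr.1) ?_ ?_).le
    · rw [add_sub_cancel_left, abs_of_pos (by positivity)]
      linarith
    · rw [abs_of_nonneg (by linarith [hr.1])]
      linarith [hr.2]

/-- If `W_s = B W`, if `A` and `B` satisfy the zero curvature equation along the directions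
`(0, 1)` and `(2, 1)`, and if `W_y = (A - B) W / 2` initially, then this holds at later times. -/
theorem hasDerivWithinAt_of_zero_curvature (hW : Continuous fun q : ℝ × ℝ => W q.1 q.2)
    (hA : ContinuousOn (fun q : ℝ × ℝ => A q.1 q.2) (univ ×ˢ Ici 0))
    (hB : ContinuousOn (fun q : ℝ × ℝ => B q.1 q.2) (univ ×ˢ Ici 0))
    (hB' : ContinuousOn (fun q : ℝ × ℝ => B' q.1 q.2) (univ ×ˢ Ici 0))
    (hWs : ∀ y, ∀ s ∈ Ico 0 T, HasDerivWithinAt (W y) (B y s (W y s)) (Ici s) s)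
    (hAs : ∀ s, 0 ≤ s → HasDerivWithinAt (A y) (A' y s) (Ici s) s)
    (hBs : ∀ s r, 0 ≤ s → 0 ≤ r → HasDerivWithinAt (fun r => B (y + 2 * r) (s + r))
      (B' (y + 2 * r) (s + r)) (Ici r) r)
    (hcurv : ∀ s, 0 ≤ s → B' y s + B y s * A y s = A' y s + A y s * B y s)
    (h0 : HasDerivWithinAt (fun y => W y 0) ((1 / 2 : ℝ) • (A y 0 - B y 0) (W y 0)) (Ici y) y)
    (ht : t ∈ Ico 0 T) :
    HasDerivWithinAt (fun y => W y t) ((1 / 2 : ℝ) • (A y t - B y t) (W y t)) (Ici y) y := by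
  have hT : (0 : ℝ) ∈ Ico 0 T := ⟨le_rfl, ht.1.trans_lt ht.2⟩
  have hline : ContinuousOn (fun s : ℝ => (y, s)) (Icc 0 t) := by fun_prop
  have hmaps : MapsTo (fun s : ℝ => (y, s)) (Icc 0 t) (univ ×ˢ Ici 0) :=
    fun s hs => ⟨mem_univ _, hs.1⟩
  have hAc : ContinuousOn (A y) (Icc 0 t) := hA.comp hline hmaps
  obtain ⟨MA, hMA⟩ := isCompact_Icc.exists_bound_of_continuousOn hAc
  obtain ⟨MB, hMB⟩ := isCompact_Icc.exists_bound_of_continuousOn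
    (f := fun s => B y s) (hB.comp hline hmaps)
  have hWy : ∀ y, Continuous (W y) := fun y => hW.comp (Continuous.prodMk_right y)
  obtain ⟨MW, hMW⟩ := isCompact_Icc.exists_bound_of_continuousOn (hWy y).continuousOn (s := Icc 0 t)
  have hMA0 : 0 ≤ MA := (norm_nonneg _).trans (hMA 0 ⟨le_rfl, ht.1⟩)
  have hMB0 : 0 ≤ MB := (norm_nonneg _).trans (hMB 0 ⟨le_rfl, ht.1⟩)
  have hMW0 : 0 ≤ MW := (norm_nonneg _).trans (hMW 0 ⟨le_rfl, ht.1⟩)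
  set K := MB + 1 with hK
  have hKpos : 0 < K := by positivity
  -- Γ is the amplification factor in Grönwall's bound below, so starting with accuracy κ/Γ yields
  -- accuracy κ at time t.
  set Γ := Real.exp (K * t) + (MW + MA * MW) / K * (Real.exp (K * t) - 1) with hΓ
  have hexp : 1 ≤ Real.exp (K * t) := Real.one_le_exp (by have := ht.1; positivity)
  have hΓpos : 0 < Γ := by
    have : 0 ≤ (MW + MA * MW) / K * (Real.exp (K * t) - 1) :=
      mul_nonneg (by positivity) (by linarith)
    linarith
  -- the initial increment
  have hinit : ∀ κ : ℝ, 0 < κ → ∀ᶠ h in 𝓝[>] (0 : ℝ),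
      ‖W (y + 2 * h) h - W y 0 - h • A y 0 (W y 0)‖ ≤ κ * h := fun κ hκ => by
    have h1 := norm_increment_le hW hB hWs y hT (half_pos hκ)
    have h2 := (hasDerivWithinAt_iff_isLittleO.1 h0)
    have h3 : Tendsto (fun h : ℝ => y + 2 * h) (𝓝[>] 0) (𝓝[Ici y] y) := by
      refine tendsto_nhdsWithin_iff.2 ⟨?_, ?_⟩
      · have : Continuous fun h : ℝ => y + 2 * h := by fun_prop
        simpa using (this.tendsto 0).mono_left nhdsWithin_le_nhds
      · filter_upwards [self_mem_nhdsWithin] with h hh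
        have hh : 0 < h := hh
        exact mem_Ici.2 (by linarith)
    have h4 := h3.eventually ((Asymptotics.isLittleO_iff.1 h2) (c := κ / 4) (by positivity))
    filter_upwards [h1, h4, self_mem_nhdsWithin] with h h5 h6 hpos
    have hpos : 0 < h := hpos
    rw [add_sub_cancel_left, norm_mul, Real.norm_two, Real.norm_of_nonneg hpos.le] at h6
    rw [zero_add] at h5
    -- A step of size h in the direction (2, 1) is a step 2h in y followed by a step h in s: 2h · (A
    -- - B)/2 + hB = hA.
    have h7 : W (y + 2 * h) h - W y 0 - h • A y 0 (W y 0) =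
        (W (y + 2 * h) h - W (y + 2 * h) 0 - h • B y 0 (W y 0)) +
        (W (y + 2 * h) 0 - W y 0 - (2 * h) • (1 / 2 : ℝ) • (A y 0 - B y 0) (W y 0)) := by
      rw [smul_smul, show 2 * h * (1 / 2) = h by ring, sub_apply, smul_sub]
      abel
    rw [h7]
    refine (norm_add_le _ _).trans ?_
    linarith
  -- the increment at time `t`
  have hfinal : ∀ κ : ℝ, 0 < κ → ∀ᶠ h in 𝓝[>] (0 : ℝ),
      ‖W (y + 2 * h) (t + h) - W y t - h • A y t (W y t)‖ ≤ κ * h := fun κ hκ => by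
    set κ₁ := κ / Γ with hκ₁
    have hκ₁pos : 0 < κ₁ := div_pos hκ hΓpos
    -- The bound by 1 keeps the shifted B below K = MB + 1; the bound by κ₁ makes the error terms
    -- small.
    obtain ⟨δ₁, hδ₁, hu₁⟩ := exists_uniform_of_continuousOn hB y t (lt_min one_pos hκ₁pos)
    obtain ⟨δ₂, hδ₂, hu₂⟩ := exists_uniform_of_continuousOn hB' y t hκ₁pos
    have hsmall : ∀ᶠ h in 𝓝[>] (0 : ℝ), h < δ₁ / 2 ∧ h < δ₂ / 2 ∧ h < T - t :=
      (eventually_nhdsGT_lt (half_pos hδ₁)).and ((eventually_nhdsGT_lt (half_pos hδ₂)).and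
        (eventually_nhdsGT_lt (sub_pos.2 ht.2)))
    filter_upwards [hinit κ₁ hκ₁pos, hsmall, self_mem_nhdsWithin] with h hi hh hpos
    have hpos : 0 < h := hpos
    have hBp : ∀ s ∈ Icc 0 t, ‖B (y + 2 * h) (s + h) - B y s‖ < min 1 κ₁ := fun s hs => by
      rw [← dist_eq_norm]
      refine hu₁ s hs _ _ (by linarith [hs.1]) ?_ ?_
      · rw [add_sub_cancel_left, abs_of_pos (by positivity)]
        linarith
      · rw [add_sub_cancel_left, abs_of_pos hpos]
        linarith
    have hBd : ∀ s ∈ Icc 0 t, ‖B (y + 2 * h) (s + h) - B y s - h • B' y s‖ ≤ κ₁ * h := by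
      intro s hs
      have h4 := norm_image_sub_le_of_norm_deriv_right_le_segment
        (f := fun r => B (y + 2 * r) (s + r) - r • B' y s) (a := 0) (b := h) (C := κ₁)
        (f' := fun r => B' (y + 2 * r) (s + r) - (1 : ℝ) • B' y s) ?_ (fun r hr => ?_)
        (fun r hr => ?_) h ⟨hpos.le, le_rfl⟩
      · rw [sub_zero] at h4
        refine le_of_eq_of_le ?_ h4
        congr 1
        simp only [mul_zero, add_zero, zero_smul, sub_zero]
        abel
      · refine ContinuousOn.sub (hB.comp (f := fun r : ℝ => (y + 2 * r, s + r)) (by fun_prop)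
          fun r hr => ⟨mem_univ _, ?_⟩) (by fun_prop)
        exact add_nonneg hs.1 hr.1
      · exact (hBs s r hs.1 hr.1).sub ((hasDerivWithinAt_id r (Ici r)).smul_const (B' y s))
      · rw [one_smul, ← dist_eq_norm]
        refine (hu₂ s hs _ _ (add_nonneg hs.1 hr.1) ?_ ?_).le
        · rw [add_sub_cancel_left, abs_of_nonneg (by linarith [hr.1])]
          linarith [hr.2]
        · rw [add_sub_cancel_left, abs_of_nonneg hr.1]
          linarith [hr.2]
    have hcont : ContinuousOn (fun s => W (y + 2 * h) (s + h) - W y s - h • A y s (W y s))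
        (Icc 0 t) := by
      have h1 : Continuous fun s => W (y + 2 * h) (s + h) := (hWy _).comp (by fun_prop)
      exact (h1.sub (hWy y)).continuousOn.sub ((hAc.clm_apply (hWy y).continuousOn).const_smul h)
    -- Grönwall's inequality for the defect R(s) = W(y + 2h, s + h) - W(y, s) - h A W(y, s), the
    -- failure of W to follow the coefficient A along the direction (2, 1).
    have hg := norm_le_gronwallBound_of_norm_deriv_right_le
      (f := fun s => W (y + 2 * h) (s + h) - W y s - h • A y s (W y s)) (a := 0) (b := t)
      (f' := fun s => B (y + 2 * h) (s + h) (W (y + 2 * h) (s + h)) - B y s (W y s) -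
        h • (A' y s (W y s) + A y s (B y s (W y s)))) (δ := κ₁ * h) (K := K)
      (ε := κ₁ * h * (MW + MA * MW)) hcont (fun s hs => ?_) (by simpa using hi)
      (fun s hs => ?_) t ⟨ht.1, le_rfl⟩
    · rw [sub_zero, gronwallBound_of_K_ne_0 hKpos.ne'] at hg
      refine hg.trans (le_of_eq ?_)
      have : κ = κ₁ * Γ := by rw [hκ₁, div_mul_cancel₀ _ hΓpos.ne']
      rw [this, hΓ]
      ring
    · have h1 := hWs (y + 2 * h) (s + h) ⟨by linarith [hs.1], by linarith [hs.2]⟩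
      have h2 : HasDerivWithinAt (fun r => W (y + 2 * h) (r + h))
          (B (y + 2 * h) (s + h) (W (y + 2 * h) (s + h))) (Ici s) s := by
        have h3 := h1.scomp (h := fun r => r + h) (h' := 1) s
          ((hasDerivWithinAt_id s (Ici s)).add_const h) fun r hr => by
            have hr : s ≤ r := hr
            exact mem_Ici.2 (by simpa using hr)
        rwa [one_smul] at h3
      have hs' := hWs y s ⟨hs.1, hs.2.trans ht.2⟩
      exact (h2.sub hs').sub (((hAs s hs.1).clm_apply hs').const_smul h)
    · have hs' : s ∈ Icc 0 t := Ico_subset_Icc_self hs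
      set w := W y s with hw
      set wp := W (y + 2 * h) (s + h) with hwp
      set Bp := B (y + 2 * h) (s + h) with hBp_def
      have hcw := congrArg (fun L : E →L[ℝ] E => L w) (hcurv s hs.1)
      simp only [add_apply, mul_apply_eq_comp] at hcw
      -- By zero curvature A' + AB = B' + BA, so the derivative of the defect is B applied to the
      -- defect plus errors of size o(h). A is differentiated only along (0, 1) and B only along (2,
      -- 1).
      have hid : Bp wp - B y s w - h • (A' y s w + A y s (B y s w)) =
          Bp (wp - w - h • A y s w) + (Bp - B y s - h • B' y s) w +
            h • (Bp - B y s) (A y s w) := by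
        rw [← hcw]
        simp only [map_sub, map_smul, sub_apply,
          smul_apply, smul_add, smul_sub]
        abel
      rw [hid]
      have h1 : ‖Bp‖ ≤ K := by
        have h2 := norm_add_le (Bp - B y s) (B y s)
        rw [sub_add_cancel] at h2
        have h3 := (hBp s hs').trans_le (min_le_left _ _)
        linarith [hMB s hs']
      have h2 : ‖w‖ ≤ MW := hMW s hs'
      have h3 : ‖Bp (wp - w - h • A y s w)‖ ≤ K * ‖wp - w - h • A y s w‖ :=
        Bp.le_of_opNorm_le h1 _
      have h4 : ‖(Bp - B y s - h • B' y s) w‖ ≤ κ₁ * h * MW :=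
        ((Bp - B y s - h • B' y s).le_of_opNorm_le (hBd s hs') w).trans
          (mul_le_mul_of_nonneg_left h2 (by positivity))
      have h5 : ‖(Bp - B y s) (A y s w)‖ ≤ κ₁ * (MA * MW) :=
        ((Bp - B y s).le_of_opNorm_le ((hBp s hs').le.trans (min_le_right _ _)) _).trans
          (mul_le_mul_of_nonneg_left (((A y s).le_of_opNorm_le (hMA s hs') w).trans
            (mul_le_mul_of_nonneg_left h2 hMA0)) hκ₁pos.le)
      have h6 : ‖h • (Bp - B y s) (A y s w)‖ ≤ h * (κ₁ * (MA * MW)) := by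
        rw [norm_smul, Real.norm_of_nonneg hpos.le]
        exact mul_le_mul_of_nonneg_left h5 hpos.le
      refine (norm_add₃_le).trans ?_
      linarith
  rw [← hasDerivWithinAt_Ioi_iff_Ici, hasDerivWithinAt_iff_isLittleO, Asymptotics.isLittleO_iff]
  intro κ hκ
  have htend : Tendsto (fun y' : ℝ => (y' - y) / 2) (𝓝[>] y) (𝓝[>] 0) := by
    refine tendsto_nhdsWithin_iff.2 ⟨?_, ?_⟩
    · have : Continuous fun y' : ℝ => (y' - y) / 2 := by fun_prop
      simpa using (this.tendsto y).mono_left nhdsWithin_le_nhds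
    · filter_upwards [self_mem_nhdsWithin] with y' hy'
      have hy' : y < y' := hy'
      exact mem_Ioi.2 (by linarith)
  have h1 := htend.eventually (hfinal κ hκ)
  have h2 := htend.eventually (norm_increment_le hW hB hWs y ht hκ)
  filter_upwards [h1, h2, self_mem_nhdsWithin] with y' h3 h4 hy'
  have hy' : y < y' := hy'
  rw [show y + 2 * ((y' - y) / 2) = y' by ring] at h3 h4
  set h := (y' - y) / 2 with hh
  -- The y-increment is the increment along (2, 1) minus the increment in s, with h = (y' - y)/2;
  -- hence the difference A - B and the factor 1/2.
  have h5 : W y' t - W y t - (y' - y) • (1 / 2 : ℝ) • (A y t - B y t) (W y t) =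
      (W y' (t + h) - W y t - h • A y t (W y t)) -
        (W y' (t + h) - W y' t - h • B y t (W y t)) := by
    rw [smul_smul, show (y' - y) * (1 / 2) = h by rw [hh]; ring, sub_apply,
      smul_sub]
    abel
  rw [h5, Real.norm_of_nonneg (by linarith)]
  refine (norm_sub_le _ _).trans ?_
  have : y' - y = h + h := by rw [hh]; ring
  rw [this]
  linarith

/-- A continuous function with continuous right derivative is the integral of that derivative. This
repairs the one-sidedness forced by stepping only forward in time. -/
theorem hasDerivAt_of_right {E : Type*} [NormedAddCommGroup E] [NormedSpace ℝ E] [CompleteSpace E]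
    {f f' : ℝ → E} (hf : ∀ x, HasDerivWithinAt f (f' x) (Ici x) x) (hc : Continuous f)
    (hf' : Continuous f') (x : ℝ) : HasDerivAt f (f' x) x := by
  have h1 : ∀ y, f y = f 0 + ∫ s in (0 : ℝ)..y, f' s := fun y => by
    rw [intervalIntegral.integral_eq_sub_of_hasDeriv_right hc.continuousOn
      (fun s _ => (hf s).mono Ioi_subset_Ici_self) (hf'.intervalIntegrable _ _)]
    abel
  have h2 : f = fun y => f 0 + ∫ s in (0 : ℝ)..y, f' s := funext h1
  rw [h2]
  exact (intervalIntegral.integral_hasDerivAt_right (hf'.intervalIntegrable _ _)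
    hf'.stronglyMeasurable.stronglyMeasurableAtFilter hf'.continuousAt).const_add _

end ZeroCurvature

/-! ### Evolution of the Jost solutions -/

/-- The matrix `c (cos θ σ₃ + sin θ σ₁)`. -/
def rotated (c : ℂ) (θ : ℝ) : Matrix (Fin 2) (Fin 2) ℂ :=
  !![c * Real.cos θ, c * Real.sin θ; c * Real.sin θ, -(c * Real.cos θ)]

theorem rotated_apply_diag (c : ℂ) (θ : ℝ) (i : Fin 2) :
    rotated c θ i i = c * sgn i * Real.cos θ := by
  fin_cases i <;> simp [rotated, sgn]

/-- A weight must be continuous on the whole line, so the constant is dominated on (0, T] by a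
Gaussian rather than by an indicator function. -/
theorem exists_isWeight_ge (c T : ℝ) : ∃ ν : ℝ → ℝ, IsWeight ν ∧ ∀ s ∈ Ioc 0 T, c ≤ ν s := by
  refine ⟨fun s => |c| * Real.exp (T ^ 2) * Real.exp (-1 * s ^ 2),
    ⟨by fun_prop, fun s => by positivity, (integrable_exp_neg_mul_sq one_pos).const_mul _⟩,
    fun s hs => ?_⟩
  dsimp only
  rw [mul_assoc, ← Real.exp_add]
  refine (le_abs_self c).trans (le_mul_of_one_le_right (abs_nonneg c) (Real.one_le_exp ?_))
  nlinarith [hs.1, hs.2]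

/-! ### The propagator along x + t = const, as a Volterra equation in time -/

section Kernel

variable {c : ℂ} {θ : ℝ → ℝ → ℝ} {T : ℝ}

/-- The deviation of `rotated c (θ y s)` from its diagonal limit, in the interaction picture. -/
def interaction (c : ℂ) (θ : ℝ → ℝ → ℝ) (y s : ℝ) : Matrix (Fin 2) (Fin 2) ℂ :=
  Matrix.of fun i j => Complex.exp ((c * sgn j - c * sgn i) * s) *
    (rotated c (θ y s) i j - if i = j then c * sgn i else 0)

theorem continuous_interaction (hθ : Continuous fun q : ℝ × ℝ => θ q.1 q.2) :
    Continuous fun q : ℝ × ℝ => interaction c θ q.1 q.2 := by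
  have h1 : Continuous fun q : ℝ × ℝ => rotated c (θ q.1 q.2) := by
    refine continuous_matrix fun i j => ?_
    fin_cases i <;> fin_cases j <;> simp [rotated] <;> fun_prop
  refine continuous_matrix fun i j => ?_
  have h2 := h1.matrix_elem i j
  simp only [interaction, Matrix.of_apply]
  fun_prop

theorem norm_interaction_le (y : ℝ) {s : ℝ} (hs : s ∈ Ioc 0 T) (i j : Fin 2) :
    ‖interaction c θ y s i j‖ ≤ Real.exp (2 * ‖c‖ * T) * (2 * ‖c‖) := by
  have hsgn : ∀ i, ‖sgn i‖ = 1 := fun i => by fin_cases i <;> simp [sgn]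
  have hcs : ∀ i, ‖c * sgn i‖ = ‖c‖ := fun i => by rw [norm_mul, hsgn, mul_one]
  have hr : ‖rotated c (θ y s) i j‖ ≤ ‖c‖ := by
    have h1 := Real.abs_cos_le_one (θ y s)
    have h2 := Real.abs_sin_le_one (θ y s)
    have h3 := norm_nonneg c
    fin_cases i <;> fin_cases j <;>
      simp only [rotated, Fin.zero_eta, Fin.mk_one, Matrix.of_apply, Matrix.cons_val',
        Matrix.cons_val_zero, Matrix.cons_val_one, Matrix.cons_val_fin_one, norm_neg, norm_mul,
        Complex.norm_real, Real.norm_eq_abs] <;>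
      exact mul_le_of_le_one_right h3 (by assumption)
  rw [interaction, Matrix.of_apply, norm_mul]
  refine mul_le_mul ?_ ?_ (norm_nonneg _) (Real.exp_pos _).le
  · rw [Complex.norm_exp]
    refine Real.exp_le_exp.2 ((Complex.re_le_norm _).trans ?_)
    rw [norm_mul, Complex.norm_real, Real.norm_of_nonneg hs.1.le]
    refine mul_le_mul ?_ hs.2 hs.1.le (by positivity)
    refine (norm_sub_le _ _).trans ?_
    rw [hcs, hcs, two_mul]
  · refine (norm_sub_le _ _).trans ?_
    have : ‖if i = j then c * sgn i else 0‖ ≤ ‖c‖ := by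
      split_ifs
      · rw [hcs]
      · simp
    linarith

theorem tendsto_interaction {l : Filter ℝ} {s : ℝ}
    (hcos : Tendsto (fun y => Real.cos (θ y s)) l (𝓝 1))
    (hsin : Tendsto (fun y => Real.sin (θ y s)) l (𝓝 0)) :
    Tendsto (fun y => interaction c θ y s) l (𝓝 0) := by
  have hcos' : Tendsto (fun y => (Real.cos (θ y s) : ℂ)) l (𝓝 1) := by
    rw [← Complex.ofReal_one]
    exact (Complex.continuous_ofReal.tendsto _).comp hcos
  have hsin' : Tendsto (fun y => (Real.sin (θ y s) : ℂ)) l (𝓝 0) := by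
    rw [← Complex.ofReal_zero]
    exact (Complex.continuous_ofReal.tendsto _).comp hsin
  refine tendsto_pi_nhds.2 fun i => tendsto_pi_nhds.2 fun j => ?_
  by_cases hij : i = j
  · subst hij
    have h1 := ((hcos'.const_mul (c * sgn i)).sub_const (c * sgn i)).const_mul
      (Complex.exp ((c * sgn i - c * sgn i) * s))
    simpa [interaction, rotated_apply_diag] using h1
  · have h1 := (hsin'.const_mul c).const_mul (Complex.exp ((c * sgn j - c * sgn i) * s))
    have h2 : ∀ y, rotated c (θ y s) i j = c * Real.sin (θ y s) := fun y => by
      fin_cases i <;> fin_cases j <;> simp_all [rotated]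
    simp only [mul_zero] at h1
    simpa only [interaction, Matrix.of_apply, if_neg hij, sub_zero, h2, Matrix.zero_apply,
      Pi.zero_apply] using h1

/-- The interaction kernel, cut off to the time interval `(0, T]`. -/
def interactionKernel (c : ℂ) (θ : ℝ → ℝ → ℝ) (T y _x s : ℝ) : Matrix (Fin 2) (Fin 2) ℂ :=
  (Ioc 0 T).indicator (interaction c θ y) s

/-- This reuses the theory of the Jost solutions with time as the integration variable and y as the
parameter. The cutoff to (0, T] turns an initial value problem at time 0 into an equation normalized
at -∞. -/
theorem isVolterraFamily_interactionKernel (hθ : Continuous fun q : ℝ × ℝ => θ q.1 q.2)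
    {ν : ℝ → ℝ} (hν : IsWeight ν) (hc : ∀ s ∈ Ioc 0 T, Real.exp (2 * ‖c‖ * T) * (2 * ‖c‖) ≤ ν s) :
    IsVolterraFamily ν (interactionKernel c θ T) where
  meas y x := (aestronglyMeasurable_matrix
    ((continuous_interaction hθ).comp (Continuous.prodMk_right y))).indicator measurableSet_Ioc
  bound y x s _ i j := by
    by_cases hs : s ∈ Ioc 0 T
    · rw [interactionKernel, indicator_of_mem hs]
      exact (norm_interaction_le y hs i j).trans (hc s hs)
    · rw [interactionKernel, indicator_of_notMem hs]
      simpa using hν.nonneg s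
  cont y₀ x₀ := Eventually.of_forall fun s => by
    by_cases hs : s ∈ Ioc 0 T
    · simp only [interactionKernel, indicator_of_mem hs]
      exact ((continuous_interaction hθ).comp (by fun_prop : Continuous fun q : ℝ × ℝ =>
        (q.1, s))).continuousAt
    · simp only [interactionKernel, indicator_of_notMem hs]
      exact continuousAt_const

theorem hasDerivAt_add_integral {g : ℝ → Fin 2 → ℂ} (hg : Continuous g) (e : Fin 2 → ℂ) (s : ℝ) :
    HasDerivAt (fun s => e + ∫ r in (0 : ℝ)..s, g r) (g s) s :=
  (intervalIntegral.integral_hasDerivAt_right (hg.intervalIntegrable 0 s)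
    hg.stronglyMeasurable.stronglyMeasurableAtFilter hg.continuousAt).const_add e

/-- The solution of the interaction equation with initial value `e`. -/
def interactionSol (c : ℂ) (θ : ℝ → ℝ → ℝ) (T : ℝ) (e : Fin 2 → ℂ) (y s : ℝ) : Fin 2 → ℂ :=
  volterraSol (interactionKernel c θ T y) e s

theorem continuous_interactionSol (hθ : Continuous fun q : ℝ × ℝ => θ q.1 q.2) (e : Fin 2 → ℂ) :
    Continuous fun q : ℝ × ℝ => interactionSol c θ T e q.1 q.2 := by
  obtain ⟨ν, hν, hc⟩ := exists_isWeight_ge (Real.exp (2 * ‖c‖ * T) * (2 * ‖c‖)) T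
  exact (isVolterraFamily_interactionKernel hθ hν hc).continuous_sol hν e

theorem interactionSol_eq (hθ : Continuous fun q : ℝ × ℝ => θ q.1 q.2) (e : Fin 2 → ℂ) (y : ℝ)
    {s : ℝ} (hs : s ∈ Icc 0 T) : interactionSol c θ T e y s =
      e + ∫ r in (0 : ℝ)..s, (interaction c θ y r).mulVec (interactionSol c θ T e y r) := by
  obtain ⟨ν, hν, hc⟩ := exists_isWeight_ge (Real.exp (2 * ‖c‖ * T) * (2 * ‖c‖)) T
  have hL := isVolterraFamily_interactionKernel hθ hν hc
  rw [interactionSol, hL.sol_eq hν _ y s, intervalIntegral.integral_of_le hs.1]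
  congr 1
  have h1 : (fun r => (interactionKernel c θ T y s r).mulVec
      (volterraSol (interactionKernel c θ T y) e r)) = (Ioc 0 T).indicator
      fun r => (interaction c θ y r).mulVec (interactionSol c θ T e y r) := by
    funext r
    by_cases hr : r ∈ Ioc 0 T
    · simp only [interactionKernel, indicator_of_mem hr]
      rfl
    · simp only [interactionKernel, indicator_of_notMem hr, Matrix.zero_mulVec]
  rw [h1, setIntegral_indicator measurableSet_Ioc]
  congr 2
  ext r
  simp only [mem_inter_iff, mem_Iic, mem_Ioc]
  exact ⟨fun h => ⟨h.2.1, h.1⟩, fun h => ⟨h.2, h.1, h.2.trans hs.2⟩⟩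

theorem hasDerivWithinAt_interactionSol (hθ : Continuous fun q : ℝ × ℝ => θ q.1 q.2)
    (e : Fin 2 → ℂ) (y : ℝ) {s : ℝ} (hs : s ∈ Ico 0 T) :
    HasDerivWithinAt (interactionSol c θ T e y)
      ((interaction c θ y s).mulVec (interactionSol c θ T e y s)) (Ici s) s := by
  have h0 : Continuous (interactionSol c θ T e y) :=
    Continuous.comp (g := fun q : ℝ × ℝ => interactionSol c θ T e q.1 q.2) (f := fun s => (y, s))
      (continuous_interactionSol hθ e) (Continuous.prodMk_right y)
  have h1 : Continuous fun r => (interaction c θ y r).mulVec (interactionSol c θ T e y r) :=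
    ((continuous_interaction hθ).comp (Continuous.prodMk_right y)).matrix_mulVec h0
  have h2 := (hasDerivAt_add_integral h1 e s).hasDerivWithinAt (s := Ici s)
  have h3 := interactionSol_eq (c := c) hθ e y (Ico_subset_Icc_self hs)
  refine h2.congr_of_eventuallyEq ?_ h3
  filter_upwards [Icc_mem_nhdsGE hs.2] with r hr
  exact interactionSol_eq hθ e y ⟨hs.1.trans hr.1, hr.2⟩

/-- As y → ±∞ the interaction vanishes pointwise in s, so the first iterate tends to 0 by dominated
convergence and the whole series reduces to its first term. -/
theorem tendsto_interactionSol (hθ : Continuous fun q : ℝ × ℝ => θ q.1 q.2) (e : Fin 2 → ℂ)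
    {l : Filter ℝ} [l.IsCountablyGenerated]
    (hcos : ∀ s ∈ Ioc 0 T, Tendsto (fun y => Real.cos (θ y s)) l (𝓝 1))
    (hsin : ∀ s ∈ Ioc 0 T, Tendsto (fun y => Real.sin (θ y s)) l (𝓝 0)) (s : ℝ) :
    Tendsto (fun y => interactionSol c θ T e y s) l (𝓝 e) := by
  obtain ⟨ν, hν, hc⟩ := exists_isWeight_ge (Real.exp (2 * ‖c‖ * T) * (2 * ‖c‖)) T
  have hL := isVolterraFamily_interactionKernel hθ hν hc
  have h1 : ∀ x, Tendsto (fun y => volterraIter (interactionKernel c θ T y) e 1 x) l (𝓝 0) := by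
    intro x
    have h2 := tendsto_integral_filter_of_dominated_convergence (l := l)
      (μ := volume.restrict (Iic x))
      (F := fun y s => (interactionKernel c θ T y x s).mulVec e) (f := fun _ => 0)
      (fun s => 2 * ν s * ‖e‖)
      (Eventually.of_forall fun y => (aestronglyMeasurable_mulVec (hL.meas y x)
        aestronglyMeasurable_const).restrict)
      (Eventually.of_forall fun y => ?_) ((hν.integrable.const_mul 2).mul_const _).integrableOn
      (Eventually.of_forall fun s => ?_)
    · simpa [volterraIter] using h2
    · filter_upwards [ae_restrict_mem measurableSet_Iic] with s hs
      exact norm_mulVec_le (hL.bound y x s hs) _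
    · have h3 : Tendsto (fun y => interactionKernel c θ T y x s) l (𝓝 0) := by
        by_cases hs : s ∈ Ioc 0 T
        · simp only [interactionKernel, indicator_of_mem hs]
          exact tendsto_interaction (hcos s hs) (hsin s hs)
        · simp only [interactionKernel, indicator_of_notMem hs]
          exact tendsto_const_nhds
      have h4 : Continuous fun M : Matrix (Fin 2) (Fin 2) ℂ => M.mulVec e :=
        continuous_id.matrix_mulVec continuous_const
      have h5 := (h4.tendsto 0).comp h3
      rwa [Matrix.zero_mulVec] at h5
  exact hL.tendsto_sol hν e s fun n => hL.tendsto_iter_succ hν e h1 n s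

/-- The `k`-th fundamental solution of `F_s = c (cos θ σ₃ + sin θ σ₁) F`. -/
def propagator (c : ℂ) (θ : ℝ → ℝ → ℝ) (T : ℝ) (k : Fin 2) (y s : ℝ) (i : Fin 2) : ℂ :=
  Complex.exp (c * sgn i * s) * interactionSol c θ T (Pi.single k 1) y s i

theorem continuous_propagator (hθ : Continuous fun q : ℝ × ℝ => θ q.1 q.2) (k : Fin 2) :
    Continuous fun q : ℝ × ℝ => propagator c θ T k q.1 q.2 := by
  refine continuous_pi fun i => ?_
  have h1 : Continuous fun q : ℝ × ℝ => interactionSol c θ T (Pi.single k 1) q.1 q.2 i :=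
    (continuous_apply i).comp (continuous_interactionSol hθ _)
  exact Continuous.mul (by fun_prop) h1

theorem propagator_zero (hθ : Continuous fun q : ℝ × ℝ => θ q.1 q.2) (hT : 0 ≤ T) (k : Fin 2)
    (y : ℝ) : propagator c θ T k y 0 = Pi.single k 1 := by
  have h1 := interactionSol_eq (c := c) hθ (Pi.single k 1) y ⟨le_rfl, hT⟩
  rw [intervalIntegral.integral_same, add_zero] at h1
  ext i
  simp [propagator, h1]

theorem hasDerivWithinAt_propagator (hθ : Continuous fun q : ℝ × ℝ => θ q.1 q.2) (k : Fin 2)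
    (y : ℝ) {s : ℝ} (hs : s ∈ Ico 0 T) : HasDerivWithinAt (propagator c θ T k y)
      ((rotated c (θ y s)).mulVec (propagator c θ T k y s)) (Ici s) s := by
  refine hasDerivWithinAt_pi.2 fun i => ?_
  have h1 := hasDerivWithinAt_pi.1
    (hasDerivWithinAt_interactionSol (c := c) hθ (Pi.single k 1) y hs) i
  have h2 : HasDerivAt (fun s : ℝ => Complex.exp (c * sgn i * s))
      (Complex.exp (c * sgn i * s) * (c * sgn i)) s := by
    simpa using ((Complex.ofRealCLM.hasDerivAt (x := s)).const_mul (c * sgn i)).cexp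
  refine (h2.hasDerivWithinAt.mul h1).congr_deriv ?_
  have h3 : ∀ j, Complex.exp (c * sgn i * s) * interaction c θ y s i j =
      Complex.exp (c * sgn j * s) * (rotated c (θ y s) i j - if i = j then c * sgn i else 0) :=
    fun j => by
      rw [interaction, Matrix.of_apply, ← mul_assoc, ← Complex.exp_add]
      congr 2
      ring
  rw [mulVec_apply_two, mulVec_apply_two, propagator, propagator]
  have h4 := h3 0
  have h5 := h3 1
  have h6 : (if i = 0 then c * sgn i else 0) * Complex.exp (c * sgn 0 * s) *
      interactionSol c θ T (Pi.single k 1) y s 0 + (if i = 1 then c * sgn i else 0) *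
      Complex.exp (c * sgn 1 * s) * interactionSol c θ T (Pi.single k 1) y s 1 =
      Complex.exp (c * sgn i * s) * (c * sgn i) * interactionSol c θ T (Pi.single k 1) y s i := by
    rcases Fin.exists_fin_two.1 ⟨i, rfl⟩ with h6 | h6 <;> rw [h6] <;> simp [mul_comm]
  linear_combination h4 * interactionSol c θ T (Pi.single k 1) y s 0 +
    h5 * interactionSol c θ T (Pi.single k 1) y s 1 - h6

theorem tendsto_propagator (hθ : Continuous fun q : ℝ × ℝ => θ q.1 q.2)
    {l : Filter ℝ} [l.IsCountablyGenerated]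
    (hcos : ∀ s ∈ Ioc 0 T, Tendsto (fun y => Real.cos (θ y s)) l (𝓝 1))
    (hsin : ∀ s ∈ Ioc 0 T, Tendsto (fun y => Real.sin (θ y s)) l (𝓝 0)) (k : Fin 2) (s : ℝ) :
    Tendsto (fun y => propagator c θ T k y s) l
      (𝓝 (Complex.exp (c * sgn k * s) • (Pi.single k 1 : Fin 2 → ℂ))) := by
  refine tendsto_pi_nhds.2 fun i => ?_
  have h1 := (tendsto_pi_nhds.1 (tendsto_interactionSol (c := c) hθ (Pi.single k 1) hcos hsin s)
    i).const_mul (Complex.exp (c * sgn i * s))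
  have h2 : (Complex.exp (c * sgn k * s) • (Pi.single k 1 : Fin 2 → ℂ)) i =
      Complex.exp (c * sgn i * s) * (Pi.single k 1 : Fin 2 → ℂ) i := by
    by_cases hik : i = k
    · rw [hik]
      rfl
    · simp [hik]
  rwa [h2]

/-- The coefficient matrix has trace zero, and at time 0 the determinant is 1. -/
theorem det_propagator (hθ : Continuous fun q : ℝ × ℝ => θ q.1 q.2) (y : ℝ) {s : ℝ}
    (hs : s ∈ Icc 0 T) : (ofCols (propagator c θ T 0 y s) (propagator c θ T 1 y s)).det = 1 := by
  have hc : ∀ k, Continuous (propagator c θ T k y) := fun k =>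
    Continuous.comp (g := fun q : ℝ × ℝ => propagator c θ T k q.1 q.2) (f := fun s => (y, s))
      (continuous_propagator hθ k) (Continuous.prodMk_right y)
  have h1 := constant_of_has_deriv_right_zero (a := 0) (b := T)
    (f := fun s => (ofCols (propagator c θ T 0 y s) (propagator c θ T 1 y s)).det)
    (continuous_det_ofCols.comp ((hc 0).prodMk (hc 1))).continuousOn (fun r hr => ?_) s hs
  · rw [h1, propagator_zero hθ (hs.1.trans hs.2), propagator_zero hθ (hs.1.trans hs.2)]
    simp [det_ofCols]
  · have h2 := hasDerivWithinAt_pi.1 (hasDerivWithinAt_propagator (c := c) hθ 0 y hr)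
    have h3 := hasDerivWithinAt_pi.1 (hasDerivWithinAt_propagator (c := c) hθ 1 y hr)
    simp only [det_ofCols]
    refine (((h2 0).mul (h3 1)).sub ((h3 0).mul (h2 1))).congr_deriv ?_
    simp only [mulVec_apply_two]
    simp only [rotated, Matrix.of_apply, Matrix.cons_val', Matrix.cons_val_zero,
      Matrix.cons_val_one, Matrix.cons_val_fin_one]
    ring

end Kernel

theorem NicePotential.tendsto_cos_sin {f f' h : ℝ → ℝ} (hf : NicePotential f f' h) {l : Filter ℝ}
    (hl : l = atBot ∨ l = atTop) : Tendsto (fun x => Real.cos (f x)) l (𝓝 1) ∧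
      Tendsto (fun x => Real.sin (f x)) l (𝓝 0) := by
  have key : ∀ {g : ℝ → ℝ} {l : Filter ℝ} {a : ℝ}, Tendsto g l (𝓝 a) → Real.cos a = 1 →
      Tendsto (fun x => Real.cos (g x)) l (𝓝 1) ∧ Tendsto (fun x => Real.sin (g x)) l (𝓝 0) := by
    intro g l a hg ha
    have h1 : Real.sin a = 0 := by
      have := Real.sin_sq_add_cos_sq a
      rw [ha] at this
      exact pow_eq_zero_iff two_ne_zero |>.1 (by linarith)
    rw [← ha, ← h1]
    exact ⟨(Real.continuous_cos.tendsto a).comp hg, (Real.continuous_sin.tendsto a).comp hg⟩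
  rcases hl with rfl | rfl
  · obtain ⟨a, h1, h2⟩ := cos_eq_one_of_tendsto_atBot hf
    exact key h1 h2
  · obtain ⟨a, h1, h2⟩ := cos_eq_one_of_tendsto_atBot hf.reflect
    refine key (a := -a) ?_ (by rwa [Real.cos_neg])
    simpa [Function.comp_def] using (h1.comp tendsto_neg_atTop_atBot).neg

/-! ### The fundamental matrix and its action on varying vectors -/

section PropagatorMatrix

variable {c : ℂ} {θ : ℝ → ℝ → ℝ} {T : ℝ}

/-- The fundamental matrix of `F_s = c (cos θ σ₃ + sin θ σ₁) F`. -/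
def propMatrix (c : ℂ) (θ : ℝ → ℝ → ℝ) (T y s : ℝ) : Matrix (Fin 2) (Fin 2) ℂ :=
  ofCols (propagator c θ T 0 y s) (propagator c θ T 1 y s)

theorem propMatrix_mulVec (y s : ℝ) (v : Fin 2 → ℂ) : (propMatrix c θ T y s).mulVec v =
    v 0 • propagator c θ T 0 y s + v 1 • propagator c θ T 1 y s := by
  ext i
  rw [mulVec_apply_two]
  fin_cases i <;> simp [propMatrix, ofCols] <;> ring

theorem continuous_propMatrix (hθ : Continuous fun q : ℝ × ℝ => θ q.1 q.2) :
    Continuous fun q : ℝ × ℝ => propMatrix c θ T q.1 q.2 :=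
  continuous_ofCols.comp ((continuous_propagator hθ 0).prodMk (continuous_propagator hθ 1))

theorem hasDerivWithinAt_propMatrix_mulVec (hθ : Continuous fun q : ℝ × ℝ => θ q.1 q.2)
    (v : Fin 2 → ℂ) (y : ℝ) {s : ℝ} (hs : s ∈ Ico 0 T) :
    HasDerivWithinAt (fun s => (propMatrix c θ T y s).mulVec v)
      ((rotated c (θ y s)).mulVec ((propMatrix c θ T y s).mulVec v)) (Ici s) s := by
  have h1 := (hasDerivWithinAt_propagator (c := c) hθ 0 y hs).const_smul (v 0)
  have h2 := (hasDerivWithinAt_propagator (c := c) hθ 1 y hs).const_smul (v 1)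
  simp only [propMatrix_mulVec]
  refine (h1.add h2).congr_deriv ?_
  rw [Matrix.mulVec_add, Matrix.mulVec_smul, Matrix.mulVec_smul]

theorem propMatrix_zero_mulVec (hθ : Continuous fun q : ℝ × ℝ => θ q.1 q.2) (hT : 0 ≤ T) (y : ℝ)
    (v : Fin 2 → ℂ) : (propMatrix c θ T y 0).mulVec v = v := by
  rw [propMatrix_mulVec, propagator_zero hθ hT, propagator_zero hθ hT]
  ext i
  fin_cases i <;> simp

theorem tendsto_propMatrix_mulVec (hθ : Continuous fun q : ℝ × ℝ => θ q.1 q.2)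
    {l : Filter ℝ} [l.IsCountablyGenerated]
    (hcos : ∀ s ∈ Ioc 0 T, Tendsto (fun y => Real.cos (θ y s)) l (𝓝 1))
    (hsin : ∀ s ∈ Ioc 0 T, Tendsto (fun y => Real.sin (θ y s)) l (𝓝 0)) (s : ℝ)
    {v : ℝ → Fin 2 → ℂ} {k : Fin 2} (hv : Tendsto v l (𝓝 (Pi.single k 1))) :
    Tendsto (fun y => (propMatrix c θ T y s).mulVec (v y)) l
      (𝓝 (Complex.exp (c * sgn k * s) • (Pi.single k 1 : Fin 2 → ℂ))) := by
  simp only [propMatrix_mulVec]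
  have h1 := ((tendsto_pi_nhds.1 hv 0).smul (tendsto_propagator (c := c) hθ hcos hsin 0 s)).add
    ((tendsto_pi_nhds.1 hv 1).smul (tendsto_propagator (c := c) hθ hcos hsin 1 s))
  convert h1 using 2
  rcases Fin.exists_fin_two.1 ⟨k, rfl⟩ with h2 | h2 <;> rw [h2] <;> simp

theorem det_propMatrix_mulVec (hθ : Continuous fun q : ℝ × ℝ => θ q.1 q.2) (y : ℝ) {s : ℝ}
    (hs : s ∈ Icc 0 T) (v w : Fin 2 → ℂ) :
    (ofCols ((propMatrix c θ T y s).mulVec v) ((propMatrix c θ T y s).mulVec w)).det =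
      (ofCols v w).det := by
  have h1 := det_propagator (c := c) hθ y hs
  rw [propMatrix_mulVec, propMatrix_mulVec]
  rw [det_ofCols] at h1 ⊢
  rw [det_ofCols]
  simp only [Pi.add_apply, Pi.smul_apply, smul_eq_mul]
  linear_combination (v 0 * w 1 - v 1 * w 0) * h1

end PropagatorMatrix

/-- Multiplication by a matrix as a continuous real-linear map. -/
def mulVecOp (M : Matrix (Fin 2) (Fin 2) ℂ) : (Fin 2 → ℂ) →L[ℝ] Fin 2 → ℂ :=
  (LinearMap.toContinuousLinearMap M.mulVecLin).restrictScalars ℝ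

theorem mulVecOp_apply (M : Matrix (Fin 2) (Fin 2) ℂ) (v : Fin 2 → ℂ) :
    mulVecOp M v = M.mulVec v := rfl

/-- The coefficient of the linear equation along `x - t = const`. -/
def rightOp (ε : ℝ) (z : ℂ) (P : ℝ) : (Fin 2 → ℂ) →L[ℝ] Fin 2 → ℂ :=
  mulVecOp !![z / (2 * Complex.I * ε), 0; 0, -(z / (2 * Complex.I * ε))] +
    P • mulVecOp !![0, -(1 / 2); 1 / 2, 0]

/-- The coefficient of the linear equation along `x + t = const`. -/
def leftOp (ε : ℝ) (z : ℂ) (θ : ℝ) : (Fin 2 → ℂ) →L[ℝ] Fin 2 → ℂ :=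
  Real.cos θ • mulVecOp (rotated (1 / (2 * Complex.I * ε * z)) 0) +
    Real.sin θ • mulVecOp (rotated (1 / (2 * Complex.I * ε * z)) (Real.pi / 2))

theorem leftOp_apply (ε : ℝ) (z : ℂ) (θ : ℝ) (v : Fin 2 → ℂ) :
    leftOp ε z θ v = (rotated (1 / (2 * Complex.I * ε * z)) θ).mulVec v := by
  ext i
  simp only [leftOp, add_apply, smul_apply, mulVecOp_apply, Pi.add_apply, Pi.smul_apply,
    mulVec_apply_two, Complex.real_smul]
  fin_cases i <;> simp [rotated] <;> ring

/-- At fixed time ∂ₓ is half the difference of the derivatives along the two characteristic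
directions, so the spatial Lax equation is half the difference of the characteristic ones. -/
theorem half_rightOp_sub_leftOp {ε : ℝ} (hε : ε ≠ 0) (f f' h : ℝ → ℝ) {z : ℂ} (hz : z ≠ 0) (x : ℝ)
    (v : Fin 2 → ℂ) : (1 / 2 : ℝ) • (rightOp ε z (f' x + h x) - leftOp ε z (f x)) v =
      (1 / (4 * Complex.I * ε) : ℂ) • (lax ε f f' h z x).mulVec v := by
  have hεc : (ε : ℂ) ≠ 0 := by exact_mod_cast hε
  ext i
  rw [sub_apply, leftOp_apply]
  simp only [rightOp, add_apply, smul_apply, mulVecOp_apply, Pi.add_apply, Pi.sub_apply,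
    Pi.smul_apply, mulVec_apply_two, Complex.real_smul, smul_eq_mul]
  have hI : Complex.I * Complex.I = -1 := Complex.I_mul_I
  fin_cases i <;> simp [rotated, lax, Q, sgn, E] <;> field_simp <;> ring_nf <;> simp <;> ring

/-- Compatibility of the two characteristic linear equations. The derivative of `leftOp` enters with
θ changing at the rate P, and that of `rightOp` with P changing at the rate -sin θ/ε². Together
these are the sine-Gordon equation as a first-order system. -/
theorem zero_curvature {ε : ℝ} (hε : ε ≠ 0) {z : ℂ} (hz : z ≠ 0) (θ P : ℝ) :
    ((-Real.sin θ * P) • mulVecOp (rotated (1 / (2 * Complex.I * ε * z)) 0) +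
      (Real.cos θ * P) • mulVecOp (rotated (1 / (2 * Complex.I * ε * z)) (Real.pi / 2))) +
        leftOp ε z θ * rightOp ε z P =
      (-(Real.sin θ / ε ^ 2)) • mulVecOp !![0, -(1 / 2); 1 / 2, 0] +
        rightOp ε z P * leftOp ε z θ := by
  have hεc : (ε : ℂ) ≠ 0 := by exact_mod_cast hε
  ext v i
  simp only [add_apply, mul_apply_eq_comp, leftOp_apply]
  simp only [rightOp, add_apply, smul_apply, mulVecOp_apply, Pi.add_apply,
    Pi.smul_apply, mulVec_apply_two, Complex.real_smul]
  fin_cases i <;> simp [rotated] <;> field_simp <;> ring_nf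

/-! ### Evolution of solutions of the eigenvalue equation -/

section Evolution

variable {ε : ℝ} {U Ux Ut : ℝ → ℝ → ℝ} {z : ℂ}

/-- The angle `U` in the coordinate `y = x + t`, extended to negative times. -/
def charAngle (U : ℝ → ℝ → ℝ) (y s : ℝ) : ℝ := U (y - max s 0) (max s 0)

theorem IsRegularSolution.continuous_charAngle (hU : IsRegularSolution ε U Ux Ut) :
    Continuous fun q : ℝ × ℝ => charAngle U q.1 q.2 :=
  hU.continuousOn_U.comp_continuous (f := fun q : ℝ × ℝ => (q.1 - max q.2 0, max q.2 0))
    (by fun_prop) fun q => ⟨mem_univ _, mem_Ici.2 (le_max_right q.2 0)⟩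

theorem charAngle_of_nonneg (U : ℝ → ℝ → ℝ) (y : ℝ) {s : ℝ} (hs : 0 ≤ s) :
    charAngle U y s = U (y - s) s := by
  rw [charAngle, max_eq_left hs]

theorem IsRegularSolution.tendsto_charAngle (hU : IsRegularSolution ε U Ux Ut) {l : Filter ℝ}
    (hl : l = atBot ∨ l = atTop) (s : ℝ) :
    Tendsto (fun y => Real.cos (charAngle U y s)) l (𝓝 1) ∧
      Tendsto (fun y => Real.sin (charAngle U y s)) l (𝓝 0) := by
  have h1 := (hU.nice (max s 0) (le_max_right _ _)).tendsto_cos_sin hl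
  have h2 : Tendsto (fun y => y - max s 0) l l := by
    rcases hl with rfl | rfl
    · exact tendsto_atBot_add_const_right _ _ tendsto_id
    · exact tendsto_atTop_add_const_right _ _ tendsto_id
  exact ⟨h1.1.comp h2, h1.2.comp h2⟩

/-- The matrix carrying the Jost solutions at time `0` to those at time `t`. -/
def evolution (ε : ℝ) (U : ℝ → ℝ → ℝ) (z : ℂ) (t y : ℝ) : Matrix (Fin 2) (Fin 2) ℂ :=
  propMatrix (1 / (2 * Complex.I * ε * z)) (charAngle U) (t + 1) y t

/-- The derivative of `leftOp ε z u` if `u` changes at the rate `P`. -/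
def leftOpDeriv (ε : ℝ) (z : ℂ) (θ P : ℝ) : (Fin 2 → ℂ) →L[ℝ] Fin 2 → ℂ :=
  (-Real.sin θ * P) • mulVecOp (rotated (1 / (2 * Complex.I * ε * z)) 0) +
    (Real.cos θ * P) • mulVecOp (rotated (1 / (2 * Complex.I * ε * z)) (Real.pi / 2))

theorem continuous_rightOp (ε : ℝ) (z : ℂ) : Continuous (rightOp ε z) :=
  continuous_const.add (continuous_id.smul continuous_const)

theorem continuous_leftOp (ε : ℝ) (z : ℂ) : Continuous (leftOp ε z) :=
  (Real.continuous_cos.smul continuous_const).add (Real.continuous_sin.smul continuous_const)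

theorem continuous_leftOpDeriv (ε : ℝ) (z : ℂ) :
    Continuous fun q : ℝ × ℝ => leftOpDeriv ε z q.1 q.2 :=
  ((((Real.continuous_sin.comp continuous_fst).neg.mul continuous_snd).smul
    continuous_const).add (((Real.continuous_cos.comp continuous_fst).mul continuous_snd).smul
    continuous_const))

theorem hasDerivWithinAt_leftOp {θ : ℝ → ℝ} {P r : ℝ} {S : Set ℝ} (hθ : HasDerivWithinAt θ P S r) :
    HasDerivWithinAt (fun r => leftOp ε z (θ r)) (leftOpDeriv ε z (θ r) P) S r :=
  (hθ.cos.smul_const (mulVecOp (rotated (1 / (2 * Complex.I * ε * z)) 0))).add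
    (hθ.sin.smul_const (mulVecOp (rotated (1 / (2 * Complex.I * ε * z)) (Real.pi / 2))))

theorem hasDerivWithinAt_rightOp {P : ℝ → ℝ} {P' r : ℝ} {S : Set ℝ}
    (hP : HasDerivWithinAt P P' S r) : HasDerivWithinAt (fun r => rightOp ε z (P r))
      (P' • mulVecOp !![0, -(1 / 2); 1 / 2, 0]) S r :=
  (hP.smul_const (mulVecOp !![0, -(1 / 2); 1 / 2, 0])).const_add _

theorem IsRegularSolution.continuousOn_shift (hU : IsRegularSolution ε U Ux Ut) :
    ContinuousOn (fun q : ℝ × ℝ => U (q.1 - q.2) q.2) (univ ×ˢ Ici 0) ∧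
      ContinuousOn (fun q : ℝ × ℝ => Ux (q.1 - q.2) q.2 + Ut (q.1 - q.2) q.2) (univ ×ˢ Ici 0) := by
  have hshift : ContinuousOn (fun q : ℝ × ℝ => (q.1 - q.2, q.2)) (univ ×ˢ Ici 0) := by fun_prop
  have hmaps : MapsTo (fun q : ℝ × ℝ => (q.1 - q.2, q.2)) (univ ×ˢ Ici 0) (univ ×ˢ Ici 0) :=
    fun q hq => ⟨mem_univ _, hq.2⟩
  exact ⟨hU.continuousOn_U.comp hshift hmaps, hU.continuousOn_P.comp hshift hmaps⟩

theorem IsRegularSolution.hasDerivWithinAt_shift (hU : IsRegularSolution ε U Ux Ut) (y : ℝ)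
    {s r : ℝ} (hs : 0 ≤ s) (hr : 0 ≤ r) :
    HasDerivWithinAt (fun r => U (y + 2 * r - (s + r)) (s + r))
      (Ux (y + 2 * r - (s + r)) (s + r) + Ut (y + 2 * r - (s + r)) (s + r)) (Ici r) r := by
  have h2 := (hU.deriv_U (y - 2 * s) (s + r) (add_nonneg hs hr)).scomp r
    (h := fun r => s + r) (h' := 1) (s := Ici r)
    ((hasDerivWithinAt_id r (Ici r)).const_add s) fun ρ hρ => by
      have hρ : r ≤ ρ := hρ
      exact mem_Ici.2 (by linarith)
  have e1 : ∀ r, y + 2 * r - (s + r) = y - 2 * s + (s + r) := fun r => by ring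
  simp only [e1]
  simpa [Function.comp_def] using h2

/-- In the coordinates y = x + t, s = t the directions (0, 1) and (2, 1) are the two
characteristics. Only the derivative of P along the first and of U along the second are required,
and these are the ones a regular solution has. -/
theorem IsRegularSolution.hasDerivWithinAt_evolution (hU : IsRegularSolution ε U Ux Ut)
    (hε : 0 < ε) (hz : z ≠ 0) {t : ℝ} (ht : 0 ≤ t) {w : ℝ → Fin 2 → ℂ}
    (hw : SolvesLax ε (fun y => U y 0) (fun y => Ux y 0) (fun y => Ut y 0) z w) :
    ∀ y, HasDerivWithinAt (fun y => (evolution ε U z t y).mulVec (w y)) ((1 / 2 : ℝ) •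
      (rightOp ε z (Ux (y - t) t + Ut (y - t) t) - leftOp ε z (U (y - t) t))
        ((evolution ε U z t y).mulVec (w y))) (Ici y) y := by
  have hθ := hU.continuous_charAngle
  obtain ⟨hUc, hPc⟩ := hU.continuousOn_shift
  -- The horizon t + 1 instead of t leaves room for the forward difference quotients at time t.
  let W : ℝ → ℝ → Fin 2 → ℂ := fun y s =>
    (propMatrix (1 / (2 * Complex.I * ε * z)) (charAngle U) (t + 1) y s).mulVec (w y)
  have hW : Continuous fun q : ℝ × ℝ => W q.1 q.2 :=
    (continuous_propMatrix hθ).matrix_mulVec (hw.continuous.comp continuous_fst)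
  have hA := (continuous_rightOp ε z).comp_continuousOn hPc
  have hB := (continuous_leftOp ε z).comp_continuousOn hUc
  have hB' := (continuous_leftOpDeriv ε z).comp_continuousOn (hUc.prodMk hPc)
  have hWs : ∀ y, ∀ s ∈ Ico 0 (t + 1),
      HasDerivWithinAt (W y) (leftOp ε z (U (y - s) s) (W y s)) (Ici s) s := fun y s hs => by
    rw [leftOp_apply, ← charAngle_of_nonneg U y hs.1]
    exact hasDerivWithinAt_propMatrix_mulVec hθ (w y) y hs
  have hW0 : (fun y => W y 0) = w :=
    funext fun y => propMatrix_zero_mulVec hθ (by linarith : 0 ≤ t + 1) y (w y)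
  intro y
  refine hasDerivWithinAt_of_zero_curvature (W := W)
    (A := fun y s => rightOp ε z (Ux (y - s) s + Ut (y - s) s))
    (B := fun y s => leftOp ε z (U (y - s) s))
    (A' := fun y s => (-(Real.sin (U (y - s) s) / ε ^ 2)) • mulVecOp !![0, -(1 / 2); 1 / 2, 0])
    (B' := fun y s => leftOpDeriv ε z (U (y - s) s) (Ux (y - s) s + Ut (y - s) s))
    hW hA hB hB' hWs ?_ ?_ (fun s _ => zero_curvature hε.ne' hz _ _) ?_ ⟨ht, by linarith⟩
  · exact fun s hs => hasDerivWithinAt_rightOp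
      ((hU.deriv_P y s hs).mono (Ici_subset_Ici.2 hs))
  · exact fun s r hs hr => hasDerivWithinAt_leftOp (hU.hasDerivWithinAt_shift y hs hr)
  · rw [hW0, congrFun hW0 y, half_rightOp_sub_leftOp hε.ne' (fun y => U y 0) (fun y => Ux y 0)
      (fun y => Ut y 0) hz, sub_zero]
    exact (hw y).hasDerivWithinAt

theorem IsRegularSolution.solvesLax (hU : IsRegularSolution ε U Ux Ut) (hε : 0 < ε) (hz : z ≠ 0)
    {t : ℝ} (ht : 0 ≤ t) {w : ℝ → Fin 2 → ℂ}
    (hw : SolvesLax ε (fun y => U y 0) (fun y => Ux y 0) (fun y => Ut y 0) z w) :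
    SolvesLax ε (fun y => U y t) (fun y => Ux y t) (fun y => Ut y t) z
      fun x => (evolution ε U z t (x + t)).mulVec (w (x + t)) := by
  have hU' : Continuous fun y => U (y - t) t :=
    (hU.nice t ht).continuous.comp (continuous_id.sub continuous_const)
  have hP' : Continuous fun y => Ux (y - t) t + Ut (y - t) t :=
    ((hU.nice t ht).continuous_deriv.comp (continuous_id.sub continuous_const)).add
      ((hU.nice t ht).continuous_h.comp (continuous_id.sub continuous_const))
  have hK : Continuous fun y => evolution ε U z t y :=
    Continuous.comp (f := fun y => (y, t)) (continuous_propMatrix hU.continuous_charAngle)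
      (Continuous.prodMk_left t)
  have hWt : Continuous fun y => (evolution ε U z t y).mulVec (w y) :=
    hK.matrix_mulVec hw.continuous
  have hcont : Continuous fun y => (1 / 2 : ℝ) •
      (rightOp ε z (Ux (y - t) t + Ut (y - t) t) - leftOp ε z (U (y - t) t)) 
        ((evolution ε U z t y).mulVec (w y)) :=
    ((((continuous_rightOp ε z).comp hP').sub ((continuous_leftOp ε z).comp hU')).clm_apply
      hWt).const_smul (1 / 2 : ℝ)
  intro x
  have h1 := (hasDerivAt_of_right (hU.hasDerivWithinAt_evolution hε hz ht hw) hWt hcont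
    (x + t)).comp_add_const x t
  rw [add_sub_cancel_right, half_rightOp_sub_leftOp hε.ne' (fun y => U y t) (fun y => Ux y t)
    (fun y => Ut y t) hz] at h1
  exact h1

theorem phase_add (ε : ℝ) (z : ℂ) (k : Fin 2) (x t : ℝ) : phase ε z k (x + t) =
    phase ε z k x * phase ε z k t := by
  rw [phase, phase, phase, ← Complex.exp_add]
  congr 1
  push_cast
  ring

/-- The phase `exp(i D(z) t (σ₃)ₖₖ / ε)`. -/
def timePhase (ε : ℝ) (z : ℂ) (k : Fin 2) (t : ℝ) : ℂ :=
  Complex.exp (Complex.I * D z * t * sgn k / ε)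

/-- This is the identity D(z) - 1/(2z) = E(z): the time phase times the limiting propagator is the
spatial phase of a shift by t. -/
theorem timePhase_mul (hε : ε ≠ 0) (hz : z ≠ 0) (k : Fin 2) (t : ℝ) :
    timePhase ε z k t * Complex.exp (1 / (2 * Complex.I * ε * z) * sgn k * t) =
      phase ε z k t := by
  have hεc : (ε : ℂ) ≠ 0 := by exact_mod_cast hε
  rw [timePhase, phase, ← Complex.exp_add]
  congr 1
  rw [D, E]
  field_simp
  ring_nf
  simp
  ring

/-- At spatial infinity the propagator multiplies eₖ by the exponential of ±t/(2iεz). The time phase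
combines with this into phase(t), which cancels the effect of evaluating w at x + t. -/
theorem IsRegularSolution.isJost (hU : IsRegularSolution ε U Ux Ut) (hε : 0 < ε) (hz : z ≠ 0)
    {t : ℝ} (ht : 0 ≤ t) {k : Fin 2} {l : Filter ℝ} (hl : l = atBot ∨ l = atTop)
    {w : ℝ → Fin 2 → ℂ}
    (hw : IsJost ε (fun y => U y 0) (fun y => Ux y 0) (fun y => Ut y 0) z k l w) :
    IsJost ε (fun y => U y t) (fun y => Ux y t) (fun y => Ut y t) z k l
      fun x => timePhase ε z k t • (evolution ε U z t (x + t)).mulVec (w (x + t)) := by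
  refine ⟨(hU.solvesLax hε hz ht hw.1).smul _, ?_⟩
  have hcg : l.IsCountablyGenerated := by
    rcases hl with rfl | rfl <;> infer_instance
  have h1 := tendsto_propMatrix_mulVec (c := 1 / (2 * Complex.I * ε * z)) (T := t + 1)
    hU.continuous_charAngle
    (fun s _ => (hU.tendsto_charAngle hl s).1) (fun s _ => (hU.tendsto_charAngle hl s).2) t hw.2
  have h2 : Tendsto (fun x => x + t) l l := by
    rcases hl with rfl | rfl
    · exact tendsto_atBot_add_const_right _ _ tendsto_id
    · exact tendsto_atTop_add_const_right _ _ tendsto_id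
  have h3 := (h1.comp h2).const_smul ((phase ε z k t)⁻¹ * timePhase ε z k t)
  have h4 := phase_ne_zero ε z k t
  rw [smul_smul, mul_assoc _ (timePhase ε z k t), timePhase_mul hε.ne' hz,
    inv_mul_cancel₀ h4, one_smul] at h3
  refine h3.congr fun x => ?_
  rw [Function.comp_apply, Matrix.mulVec_smul, smul_smul, smul_smul, phase_add, evolution]
  congr 1
  field_simp

theorem IsRegularSolution.det_evolution (hU : IsRegularSolution ε U Ux Ut) {t : ℝ} (ht : 0 ≤ t)
    (y : ℝ) (v w : Fin 2 → ℂ) :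
    (ofCols ((evolution ε U z t y).mulVec v) ((evolution ε U z t y).mulVec w)).det =
      (ofCols v w).det :=
  det_propMatrix_mulVec hU.continuous_charAngle y ⟨ht, by linarith⟩ v w

end Evolution

/-! ### Evolution of the scattering data -/

section ScatteringData

variable {ε : ℝ} {U Ux Ut : ℝ → ℝ → ℝ} {z : ℂ} {t : ℝ}

theorem IsRegularSolution.jMinus_zero (hU : IsRegularSolution ε U Ux Ut) (hε : 0 < ε) (hz : z ≠ 0)
    (hz' : 0 ≤ z.im) (ht : 0 ≤ t) (x : ℝ) :
    jMinus ε (fun y => U y t) (fun y => Ux y t) (fun y => Ut y t) 0 z x =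
      timePhase ε z 0 t • (evolution ε U z t (x + t)).mulVec
        (jMinus ε (fun y => U y 0) (fun y => Ux y 0) (fun y => Ut y 0) 0 z (x + t)) :=
  (congrFun ((hU.nice t ht).eq_jMinus_zero hε hz hz' (hU.isJost hε hz ht (Or.inl rfl)
    ((hU.nice 0 le_rfl).isJost_jMinus_zero hε hz hz'))) x).symm

theorem IsRegularSolution.jPlus_one (hU : IsRegularSolution ε U Ux Ut) (hε : 0 < ε) (hz : z ≠ 0)
    (hz' : 0 ≤ z.im) (ht : 0 ≤ t) (x : ℝ) :
    jPlus ε (fun y => U y t) (fun y => Ux y t) (fun y => Ut y t) 1 z x =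
      timePhase ε z 1 t • (evolution ε U z t (x + t)).mulVec
        (jPlus ε (fun y => U y 0) (fun y => Ux y 0) (fun y => Ut y 0) 1 z (x + t)) :=
  (congrFun ((hU.nice t ht).eq_jPlus_one hε hz hz' (hU.isJost hε hz ht (Or.inr rfl)
    ((hU.nice 0 le_rfl).isJost_jPlus_one hε hz hz'))) x).symm

theorem IsRegularSolution.jPlus_zero (hU : IsRegularSolution ε U Ux Ut) (hε : 0 < ε) (hz : z ≠ 0)
    (hz' : z.im ≤ 0) (ht : 0 ≤ t) (x : ℝ) :
    jPlus ε (fun y => U y t) (fun y => Ux y t) (fun y => Ut y t) 0 z x =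
      timePhase ε z 0 t • (evolution ε U z t (x + t)).mulVec
        (jPlus ε (fun y => U y 0) (fun y => Ux y 0) (fun y => Ut y 0) 0 z (x + t)) :=
  (congrFun ((hU.nice t ht).eq_jPlus_zero hε hz hz' (hU.isJost hε hz ht (Or.inr rfl)
    ((hU.nice 0 le_rfl).isJost_jPlus_zero hε hz hz'))) x).symm

theorem timePhase_zero_mul_one (ε : ℝ) (z : ℂ) (t : ℝ) :
    timePhase ε z 0 t * timePhase ε z 1 t = 1 := by
  rw [timePhase, timePhase, ← Complex.exp_add, ← Complex.exp_zero]
  congr 1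
  simp [sgn]
  ring

theorem timePhase_zero_mul_self (ε : ℝ) (z : ℂ) (t : ℝ) :
    timePhase ε z 0 t * timePhase ε z 0 t = Complex.exp (2 * Complex.I * (D z * t) / ε) := by
  rw [timePhase, ← Complex.exp_add]
  congr 1
  simp [sgn]
  ring

/-- The function `S₂₂` does not depend on time. -/
theorem IsRegularSolution.S22_eq (hU : IsRegularSolution ε U Ux Ut) (hε : 0 < ε) (hz : z ≠ 0)
    (hz' : 0 ≤ z.im) (ht : 0 ≤ t) :
    S22 ε (fun y => U y t) (fun y => Ux y t) (fun y => Ut y t) z =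
      S22 ε (fun y => U y 0) (fun y => Ux y 0) (fun y => Ut y 0) z := by
  rw [← (hU.nice t ht).det_j_eq_S22 hε hz hz' 0, hU.jMinus_zero hε hz hz' ht,
    hU.jPlus_one hε hz hz' ht, det_ofCols_smul, timePhase_zero_mul_one, one_mul,
    hU.det_evolution ht, (hU.nice 0 le_rfl).det_j_eq_S22 hε hz hz']

/-- S₂₁ is the Wronskian of two solutions with index 0, so it picks up the time phase twice, while
in S₂₂ the two phases are inverse to each other. -/
theorem IsRegularSolution.reflection_eq (hU : IsRegularSolution ε U Ux Ut) (hε : 0 < ε) {s : ℝ}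
    (hs : s ≠ 0) (ht : 0 ≤ t) :
    reflection ε (fun y => U y 0) (fun y => Ux y 0) (fun y => Ut y 0) s *
        Complex.exp (2 * Complex.I * (D s * t) / ε) =
      reflection ε (fun y => U y t) (fun y => Ux y t) (fun y => Ut y t) s := by
  have hs' : (s : ℂ) ≠ 0 := by exact_mod_cast hs
  rw [reflection, reflection, (hU.nice t ht).scatteringMatrix_one_one hε hs,
    (hU.nice 0 le_rfl).scatteringMatrix_one_one hε hs, hU.S22_eq hε hs' (by simp) ht,
    (hU.nice t ht).scatteringMatrix_one_zero hε hs 0,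
    (hU.nice 0 le_rfl).scatteringMatrix_one_zero hε hs (0 + t),
    hU.jMinus_zero hε hs' (by simp) ht, hU.jPlus_zero hε hs' (by simp) ht, det_ofCols_smul,
    timePhase_zero_mul_self, hU.det_evolution ht]
  ring

theorem IsRegularSolution.eigenvalues_eq (hU : IsRegularSolution ε U Ux Ut) (hε : 0 < ε)
    (ht : 0 ≤ t) : eigenvalues ε (fun y => U y 0) (fun y => Ux y 0) (fun y => Ut y 0) =
      eigenvalues ε (fun y => U y t) (fun y => Ux y t) (fun y => Ut y t) := by
  ext z
  refine and_congr_right fun hz => and_congr_right fun _ => ?_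
  rw [hU.S22_eq hε (ne_zero_of_im_pos hz) hz.le ht]

theorem IsRegularSolution.deriv_S22_eq (hU : IsRegularSolution ε U Ux Ut) (hε : 0 < ε)
    (hz : 0 < z.im) (ht : 0 ≤ t) :
    deriv (S22 ε (fun y => U y t) (fun y => Ux y t) (fun y => Ut y t)) z =
      deriv (S22 ε (fun y => U y 0) (fun y => Ux y 0) (fun y => Ut y 0)) z := by
  refine EventuallyEq.deriv_eq ?_
  filter_upwards [isOpen_upperHalfPlane.mem_nhds hz] with w hw
  exact hU.S22_eq hε (ne_zero_of_im_pos hw) (le_of_lt hw) ht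

theorem NicePotential.exists_jPlus_one_ne_zero {f f' h : ℝ → ℝ} (hf : NicePotential f f' h)
    (hε : 0 < ε) (hz : z ≠ 0) (hz' : 0 ≤ z.im) : ∃ x, jPlus ε f f' h 1 z x ≠ 0 := by
  by_contra! h0
  have h1 := (hf.isJost_jPlus_one hε hz hz').2
  simp only [h0, smul_zero] at h1
  have h2 := congrFun (tendsto_nhds_unique h1 tendsto_const_nhds) 1
  simp at h2

/-- The constant changes by the quotient of the time phases of j₁⁻ and j₂⁺, which is the square of
the first. It is identified by comparison at a point where j₂⁺ does not vanish. -/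
theorem IsRegularSolution.proportionality_eq (hU : IsRegularSolution ε U Ux Ut) (hε : 0 < ε)
    (hz : 0 < z.im) (ht : 0 ≤ t)
    (hS : S22 ε (fun y => U y 0) (fun y => Ux y 0) (fun y => Ut y 0) z = 0) :
    proportionality ε (fun y => U y 0) (fun y => Ux y 0) (fun y => Ut y 0) z *
        Complex.exp (2 * Complex.I * (D z * t) / ε) =
      proportionality ε (fun y => U y t) (fun y => Ux y t) (fun y => Ut y t) z := by
  have hz0 := ne_zero_of_im_pos hz
  obtain ⟨x, hx⟩ := (hU.nice t ht).exists_jPlus_one_ne_zero hε hz0 hz.le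
  have h1 := (hU.nice t ht).jMinus_eq_smul hε hz (by rwa [hU.S22_eq hε hz0 hz.le ht]) x
  refine smul_left_injective ℂ hx ?_
  dsimp only
  rw [← h1, hU.jMinus_zero hε hz0 hz.le ht, (hU.nice 0 le_rfl).jMinus_eq_smul hε hz hS,
    Matrix.mulVec_smul, hU.jPlus_one hε hz0 hz.le ht, smul_smul, smul_smul,
    ← timePhase_zero_mul_self]
  congr 1
  linear_combination proportionality ε (fun y => U y 0) (fun y => Ux y 0) (fun y => Ut y 0) z *
    timePhase ε z 0 t * timePhase_zero_mul_one ε z t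

theorem IsRegularSolution.modifiedProportionality_eq (hU : IsRegularSolution ε U Ux Ut)
    (hε : 0 < ε) (hz : 0 < z.im) (ht : 0 ≤ t)
    (hS : S22 ε (fun y => U y 0) (fun y => Ux y 0) (fun y => Ut y 0) z = 0) :
    modifiedProportionality ε (fun y => U y 0) (fun y => Ux y 0) (fun y => Ut y 0) z *
        Complex.exp (2 * Complex.I * (D z * t) / ε) =
      modifiedProportionality ε (fun y => U y t) (fun y => Ux y t) (fun y => Ut y t) z := by
  rw [modifiedProportionality, modifiedProportionality, ← hU.proportionality_eq hε hz ht hS,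
    hU.deriv_S22_eq hε hz ht]
  ring

/-- The Riemann-Hilbert problem with the scattering data at time `0`. -/
theorem IsRegularSolution.solvesRHPOf (hU : IsRegularSolution ε U Ux Ut) (hε : 0 < ε)
    (hsimple : ∀ z : ℂ, 0 < z.im →
      S22 ε (fun y => U y 0) (fun y => Ux y 0) (fun y => Ut y 0) z = 0 →
      deriv (S22 ε (fun y => U y 0) (fun y => Ux y 0) (fun y => Ut y 0)) z ≠ 0)
    (hreal : ∀ s : ℝ, s ≠ 0 → S22 ε (fun y => U y 0) (fun y => Ux y 0) (fun y => Ut y 0) s ≠ 0)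
    (x : ℝ) (ht : 0 ≤ t) :
    SolvesRHPOf ε (fun y => U y 0) (fun y => Ux y 0) (fun y => Ut y 0) x t
        (G ε (fun y => U y t) (fun y => Ux y t) (fun y => Ut y t) x) ∧
      ∀ H, SolvesRHPOf ε (fun y => U y 0) (fun y => Ux y 0) (fun y => Ut y 0) x t H →
        EqOn H (G ε (fun y => U y t) (fun y => Ux y t) (fun y => Ut y t) x)
          (domain (eigenvalues ε (fun y => U y 0) (fun y => Ux y 0) (fun y => Ut y 0))) := by
  have hf := hU.nice t ht
  have hsimple' : ∀ z : ℂ, 0 < z.im →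
      S22 ε (fun y => U y t) (fun y => Ux y t) (fun y => Ut y t) z = 0 →
      deriv (S22 ε (fun y => U y t) (fun y => Ux y t) (fun y => Ut y t)) z ≠ 0 := fun z hz h0 => by
    rw [hU.S22_eq hε (ne_zero_of_im_pos hz) hz.le ht] at h0
    rw [hU.deriv_S22_eq hε hz ht]
    exact hsimple z hz h0
  have hG : SolvesRHPOf ε (fun y => U y 0) (fun y => Ux y 0) (fun y => Ut y 0) x t
      (G ε (fun y => U y t) (fun y => Ux y t) (fun y => Ut y t) x) :=
    hf.solvesRHP hε hsimple'
      (fun s hs => by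
        rw [hU.S22_eq hε (by exact_mod_cast hs) (by simp) ht]
        exact hreal s hs)
      (hU.eigenvalues_eq hε ht) (fun s hs => hU.reflection_eq hε hs ht)
      (fun z hz => hU.modifiedProportionality_eq hε hz.1 ht hz.2.2) x
  refine ⟨hG, fun H hH => SolvesRHP.eqOn hH hG (fun z hz => ?_) fun w hw => ?_⟩
  · rw [hU.eigenvalues_eq hε ht] at hz
    exact hf.det_G hε x hz
  · rw [hU.eigenvalues_eq hε ht]
    exact hf.eventually_mem_domain hε hsimple' hw

end ScatteringData

/-! ### Dependence on the almost everywhere classes of the potentials -/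

section Congr

variable {ε : ℝ} {f f' h g g' k : ℝ → ℝ}

theorem jostIntegrand_ae_eq (hf : f =ᵐ[volume] g) (hf' : f' =ᵐ[volume] g') (hh : h =ᵐ[volume] k)
    (z : ℂ) (j : Fin 2) (m : ℝ → Fin 2 → ℂ) (x : ℝ) :
    jostIntegrand ε f f' h z j m x =ᵐ[volume] jostIntegrand ε g g' k z j m x := by
  filter_upwards [hf, hf', hh] with y h1 h2 h3
  simp only [jostIntegrand, Q, h1, h2, h3]

/-- The integrals do not see null sets, so the defining predicates are equal. The solutions chosen
from them by `Classical.epsilon` are then literally the same, and so is everything derived from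
them. -/
theorem isJostPlus_congr (hf : f =ᵐ[volume] g) (hf' : f' =ᵐ[volume] g') (hh : h =ᵐ[volume] k) :
    IsJostPlus ε f f' h = IsJostPlus ε g g' k := by
  funext z j m
  simp only [IsJostPlus,
    fun x => integral_congr_ae (ae_restrict_of_ae (s := Ioi x)
      (jostIntegrand_ae_eq (ε := ε) hf hf' hh z j m x))]

theorem isJostMinus_congr (hf : f =ᵐ[volume] g) (hf' : f' =ᵐ[volume] g') (hh : h =ᵐ[volume] k) :
    IsJostMinus ε f f' h = IsJostMinus ε g g' k := by
  funext z j m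
  simp only [IsJostMinus,
    fun x => integral_congr_ae (ae_restrict_of_ae (s := Iic x)
      (jostIntegrand_ae_eq (ε := ε) hf hf' hh z j m x))]

theorem jPlus_congr (hf : f =ᵐ[volume] g) (hf' : f' =ᵐ[volume] g') (hh : h =ᵐ[volume] k) :
    jPlus ε f f' h = jPlus ε g g' k := by
  funext j z x
  rw [jPlus, jPlus, mPlus, mPlus, isJostPlus_congr hf hf' hh]

theorem jMinus_congr (hf : f =ᵐ[volume] g) (hf' : f' =ᵐ[volume] g') (hh : h =ᵐ[volume] k) :
    jMinus ε f f' h = jMinus ε g g' k := by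
  funext j z x
  rw [jMinus, jMinus, mMinus, mMinus, isJostMinus_congr hf hf' hh]

theorem S22_congr (hf : f =ᵐ[volume] g) (hf' : f' =ᵐ[volume] g') (hh : h =ᵐ[volume] k) :
    S22 ε f f' h = S22 ε g g' k := by
  funext z
  rw [S22, S22, jPlus_congr hf hf' hh, jMinus_congr hf hf' hh]

theorem scatteringMatrix_congr (hf : f =ᵐ[volume] g) (hf' : f' =ᵐ[volume] g')
    (hh : h =ᵐ[volume] k) : scatteringMatrix ε f f' h = scatteringMatrix ε g g' k := by
  funext z
  rw [scatteringMatrix, scatteringMatrix, jPlus_congr hf hf' hh, jMinus_congr hf hf' hh]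

theorem eigenvalues_congr (hf : f =ᵐ[volume] g) (hf' : f' =ᵐ[volume] g') (hh : h =ᵐ[volume] k) :
    eigenvalues ε f f' h = eigenvalues ε g g' k := by
  rw [eigenvalues, eigenvalues, S22_congr hf hf' hh]

theorem solvesRHPOf_congr (hf : f =ᵐ[volume] g) (hf' : f' =ᵐ[volume] g') (hh : h =ᵐ[volume] k) :
    SolvesRHPOf ε f f' h = SolvesRHPOf ε g g' k := by
  have h1 : reflection ε f f' h = reflection ε g g' k := by
    funext s
    rw [reflection, reflection, scatteringMatrix_congr hf hf' hh]
  have h2 : modifiedProportionality ε f f' h = modifiedProportionality ε g g' k := by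
    funext z
    rw [modifiedProportionality, modifiedProportionality, proportionality, proportionality,
      S22_congr hf hf' hh, jPlus_congr hf hf' hh, jMinus_congr hf hf' hh]
  funext x t H
  rw [SolvesRHPOf, SolvesRHPOf, h1, h2, eigenvalues_congr hf hf' hh]

theorem G_congr (hf : f =ᵐ[volume] g) (hf' : f' =ᵐ[volume] g') (hh : h =ᵐ[volume] k) :
    G ε f f' h = G ε g g' k := by
  funext x z
  simp only [G, S22_congr hf hf' hh, S11, jPlus_congr hf hf' hh, jMinus_congr hf hf' hh, mPlus,
    mMinus, isJostPlus_congr hf hf' hh, isJostMinus_congr hf hf' hh]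

end Congr

end SineGordon

end

theorem mainTheorem2 (ε : ℝ) (hε : 0 < ε) (u ux uxx ut utx : ℝ → ℝ → ℝ)
    (ha : SineGordon.IsL1SobolevSolution ε u ux uxx ut utx)
    (hb : ∀ z : ℂ, 0 < z.im →
      SineGordon.S22 ε (fun y => u y 0) (fun y => ux y 0) (fun y => ut y 0) z = 0 →
      deriv (SineGordon.S22 ε (fun y => u y 0) (fun y => ux y 0) (fun y => ut y 0)) z ≠ 0)
    (hc : ∀ s : ℝ, s ≠ 0 →
      SineGordon.scatteringMatrix ε (fun y => u y 0) (fun y => ux y 0) (fun y => ut y 0) s 0 0 ≠ 0 ∧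
      SineGordon.scatteringMatrix ε (fun y => u y 0) (fun y => ux y 0) (fun y => ut y 0) s 1 1 ≠ 0)
    (x t : ℝ) (ht : 0 ≤ t) :
    SineGordon.SolvesRHPOf ε (fun y => u y 0) (fun y => ux y 0) (fun y => ut y 0) x t
      (SineGordon.G ε (fun y => u y t) (fun y => ux y t) (fun y => ut y t) x) ∧
    ∀ H : ℂ → Matrix (Fin 2) (Fin 2) ℂ,
      SineGordon.SolvesRHPOf ε (fun y => u y 0) (fun y => ux y 0) (fun y => ut y 0) x t H →
      Set.EqOn H (SineGordon.G ε (fun y => u y t) (fun y => ux y t) (fun y => ut y t) x)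
        (SineGordon.domain
          (SineGordon.eigenvalues ε (fun y => u y 0) (fun y => ux y 0) (fun y => ut y 0))) := by
  -- Pass to continuous representatives at times 0 and t; scattering data and G depend only on
  -- almost everywhere classes.
  obtain ⟨U, Ux, Ut, hU, hae⟩ := ha.exists_isRegularSolution
  obtain ⟨h1, h2, h3⟩ := hae 0 le_rfl
  obtain ⟨h4, h5, h6⟩ := hae t ht
  rw [SineGordon.S22_congr h1 h2 h3] at hb
  rw [SineGordon.scatteringMatrix_congr h1 h2 h3] at hc
  rw [SineGordon.solvesRHPOf_congr h1 h2 h3, SineGordon.G_congr h4 h5 h6,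
    SineGordon.eigenvalues_congr h1 h2 h3]
  refine hU.solvesRHPOf hε hb (fun s hs => ?_) x ht
  rw [← (hU.nice 0 le_rfl).scatteringMatrix_one_one hε hs]
  exact (hc s hs).2
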